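/- Let $d\ge 2$, $m\ge 1$, $N\ge 1$ be integers. For a multiindex $\alpha\in\mathbb N_0^d$ with $m-\frac d2<|\alpha|\le m$ let $\frac1{2_\alpha}=\frac12-\frac{m-|\alpha|}{d}$. For open $\Omega\subseteq\mathbb R^d$ let $Y^{m,2}(\Omega)$ be the set of locally integrable $\vec u:\Omega\to\mathbb C^N$ whose weak derivatives $\partial^\alpha\vec u$ exist and lie in $L^{2_\alpha}(\Omega)$ for $m-\frac d2<|\alpha|\le m$, and let $\|\vec u\|_{Y^{m,2}(\Omega)}=\sum_{m-d/2<|\alpha|\le m}\|\partial^\alpha\vec u\|_{L^{2_\alpha}(\Omega)}$. Let $Y^{m,2}_0(\Omega)=\{\vec\varphi\in Y^{m,2}(\mathbb R^d):\vec\varphi=0\text{ a.e. outside }\Omega\}$, and let $Y^{-m,2}(\Omega)$ be the space of linear functionals $T=\langle T,\cdot\rangle_\Omega$ on $Y^{m,2}_0(\Omega)$ for which there is a finite $K\ge0$ with $|\langle T,\vec\psi\rangle_\Omega|\le K\|\vec\psi\|_{Y^{m,2}(\Omega)}$ for all $\vec\psi\in Y_0^{m,2}(\Omega)$; the smallest such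 $K$ is $\|T\|$. Write $|\nabla^j\vec u|^2=\sum_{|\alpha|=j}|\partial^\alpha\vec u|^2$. Let $A^{j,k}_{\alpha,\beta}:\mathbb R^d\to\mathbb C$ ($1\le j,k\le N$, $|\alpha|,|\beta|\le m$) be measurable and let $L$ be the associated operator of order $2m$, $$\langle L\vec u,\vec\varphi\rangle_\Omega=\sum_{j,k=1}^N\sum_{|\alpha|\le m}\sum_{|\beta|\le m}\int_\Omega \partial^\alpha\varphi_j\,\overline{A^{j,k}_{\alpha,\beta}\,\partial^\beta u_k}.$$ Suppose that, for some $\lambda>0$ and $\delta\ge0$, the weak Gårding inequality $$\operatorname{Re}\sum_{j,k=1}^N\sum_{|\alpha|\le m}\sum_{|\beta|\le m}\int_{\mathbb R^d}\overline{\partial^\alpha\varphi_j}\,A^{j,k}_{\alpha,\beta}\,\partial^\beta\varphi_k\ \ge\ \lambda\|\nabla^m\vec\varphi\|_{L^2(\mathbb R^d)}^2-\delta\|\vec\varphi\|_{L^2(\mathbb R^d)}^2$$ holds for all smooth compactly supported $\vec\varphi:\mathbb R^d\to\mathbb C^N$, and that for some $\Lambda$ one of the following two bounds holds for all $j,k$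 and all $|\alpha|,|\beta|\le m$: (a) $\|A^{j,k}_{\alpha,\beta}\|_{L^{q}(\mathbb R^d)}\le\Lambda$ with $q=\frac{d}{2m-|\alpha|-|\beta|}$ if $|\alpha|,|\beta|>m-\frac d2$, and $A^{j,k}_{\alpha,\beta}=0$ otherwise; or (b) writing points of $\mathbb R^d$ as $(x,t)$ with $x\in\mathbb R^{d-1}$, $t\in\mathbb R$: $\operatorname{ess\,sup}_{t}\|A^{j,k}_{\alpha,\beta}(\cdot,t)\|_{L^{q}(\mathbb R^{d-1})}\le\Lambda$ with $q=\frac{d-1}{2m-|\alpha|-|\beta|}$ if $|\alpha|,|\beta|>m-\frac{d-1}2$, and $A^{j,k}_{\alpha,\beta}=0$ otherwise. (Here $q=\infty$ if $|\alpha|=|\beta|=m$.) Let $Q\subset\mathbb R^d$ be an open cube with sides parallel to the coordinate axes, let $1<\theta\le2$, and let $\theta Q$ be the concentric cube with side length $\theta|Q|^{1/d}$. Let $\vec u\in Y^{m,2}(\theta Q)$ and $T\in Y^{-m,2}(\theta Q)$ with $L\vec u=T$ in $\theta Q$, that is, $\langle L\vec u,\vec\varphi\rangle_{\theta Q}=\langle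 T,\vec\varphi\rangle_{\theta Q}$ for all $\vec\varphi\in Y^{m,2}_0(\theta Q)$. Then all weak derivatives of $\vec u$ of order at most $m$ exist in $\theta Q$, and there is a constant $C>0$ depending only on $d$, $m$, $N$, $\lambda$ and $\Lambda$ such that $$\int_Q|\nabla^m\vec u|^2\le\sum_{k=0}^{m-1}\frac{C}{((\theta-1)|Q|^{1/d})^{2m-2k}}\int_{\theta Q\setminus Q}|\nabla^k\vec u|^2+C\delta\int_{\theta Q}|\vec u|^2+C\|T\|^2,$$ $$\int_Q|\nabla^m\vec u|^2\le\frac{C}{((\theta-1)|Q|^{1/d})^{2m}}\int_{\theta Q\setminus Q}|\vec u|^2+C\delta\int_{\theta Q}|\vec u|^2+C\|T\|^2,$$ and, for all integers $j$ with $1\le j\le m-1$, $$\frac1{|Q|^{(2m-2j)/d}}\int_Q|\nabla^j\vec u|^2\le\frac{C}{(\theta-1)^{2j}|Q|^{2m/d}}\int_{\theta Q}|\vec u|^2+C\delta\int_{\theta Q}|\vec u|^2+C\|T\|^2.$$ -/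

import Mathlib

open MeasureTheory Set
open scoped ENNReal ContDiff ComplexConjugate

namespace HigherOrderElliptic

/-- The ambient space `ℝ^d`. Only its topology, smooth structure and Lebesgue measure are used, so
the choice of a norm on it plays no role. -/
abbrev E (d : ℕ) := Fin d → ℝ

/-- The space `ℂ^N` of values, with its Euclidean (Hermitian) norm. -/
abbrev V (N : ℕ) := EuclideanSpace ℂ (Fin N)

/-- Multiindices in `(ℕ_0)^d`. -/
abbrev MIndex (d : ℕ) := Fin d → ℕ

/-- The length `|α| = α_1 + ⋯ + α_d` of a multiindex. -/
def order {d : ℕ} (α : MIndex d) : ℕ := ∑ i, α i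

/-- The finite set of multiindices with `|α| ≤ m`. -/
def indicesLE (d m : ℕ) : Finset (MIndex d) :=
  (Fintype.piFinset fun _ => Finset.range (m + 1)).filter fun α => order α ≤ m

/-- The finite set of multiindices with `|α| = m`. -/
def indicesEQ (d m : ℕ) : Finset (MIndex d) :=
  (Fintype.piFinset fun _ => Finset.range (m + 1)).filter fun α => order α = m

lemma coord_le_order {d : ℕ} (α : MIndex d) (i : Fin d) : α i ≤ order α :=
  Finset.single_le_sum (f := α) (fun _ _ => Nat.zero_le _) (Finset.mem_univ i)

lemma mem_indicesLE {d m : ℕ} {α : MIndex d} : α ∈ indicesLE d m ↔ order α ≤ m := by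
  simp only [indicesLE, Finset.mem_filter, Fintype.mem_piFinset, Finset.mem_range,
    and_iff_right_iff_imp]
  intro h i
  have := coord_le_order α i
  omega

lemma mem_indicesEQ {d m : ℕ} {α : MIndex d} : α ∈ indicesEQ d m ↔ order α = m := by
  simp only [indicesEQ, Finset.mem_filter, Fintype.mem_piFinset, Finset.mem_range,
    and_iff_right_iff_imp]
  intro h i
  have := coord_le_order α i
  omega

section Derivatives

variable {d : ℕ} {F : Type*} [NormedAddCommGroup F] [NormedSpace ℝ F]

/-- The classical partial derivative `∂_i f`. -/
noncomputable def pderiv (i : Fin d) (f : E d → F) : E d → F :=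
  fun x => fderiv ℝ f x (Pi.single i 1)

/-- The classical partial derivative `∂^α f = ∂_1^{α_1} ⋯ ∂_d^{α_d} f`
(used for smooth functions only). -/
noncomputable def mderiv (α : MIndex d) (f : E d → F) : E d → F :=
  (List.finRange d).foldr (fun i g => (pderiv i)^[α i] g) f

lemma contDiff_pderiv (i : Fin d) {f : E d → F} (hf : ContDiff ℝ ∞ f) :
    ContDiff ℝ ∞ (pderiv i f) :=
  (hf.fderiv_right (m := ∞) (by simp)).clm_apply contDiff_const

lemma hasCompactSupport_pderiv (i : Fin d) {f : E d → F} (hf : HasCompactSupport f) :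
    HasCompactSupport (pderiv i f) :=
  hf.fderiv_apply (𝕜 := ℝ) (Pi.single i 1)

lemma contDiff_mderiv (α : MIndex d) {f : E d → F} (hf : ContDiff ℝ ∞ f) :
    ContDiff ℝ ∞ (mderiv α f) := by
  unfold mderiv
  induction List.finRange d with
  | nil => simpa using hf
  | cons i l ih =>
    rw [List.foldr_cons]
    induction α i with
    | zero => simpa using ih
    | succ k hk =>
      rw [Function.iterate_succ_apply']
      exact contDiff_pderiv i hk

lemma hasCompactSupport_mderiv (α : MIndex d) {f : E d → F} (hf : HasCompactSupport f) :
    HasCompactSupport (mderiv α f) := by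
  unfold mderiv
  induction List.finRange d with
  | nil => simpa using hf
  | cons i l ih =>
    rw [List.foldr_cons]
    induction α i with
    | zero => simpa using ih
    | succ k hk =>
      rw [Function.iterate_succ_apply']
      exact hasCompactSupport_pderiv i hk

end Derivatives

section WeakDerivatives

variable {d N : ℕ}

/-- `v` is the weak derivative `∂^α u` in the open set `Ω`. -/
def IsWeakDeriv (α : MIndex d) (Ω : Set (E d)) (u v : E d → V N) : Prop :=
  LocallyIntegrableOn u Ω ∧ LocallyIntegrableOn v Ω ∧
    ∀ η : E d → ℝ, ContDiff ℝ ∞ η → HasCompactSupport η → tsupport η ⊆ Ω →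
      ∫ x in Ω, mderiv α η x • u x = (-1 : ℝ) ^ order α • ∫ x in Ω, η x • v x

open Classical in
/-- The weak derivative `∂^α u` in `Ω`: unique up to null sets where it exists (and `0`, by
convention, where it does not). -/
noncomputable def weakDeriv (α : MIndex d) (Ω : Set (E d)) (u : E d → V N) : E d → V N :=
  if h : ∃ v, IsWeakDeriv α Ω u v then h.choose else 0

/-- `|∇^j u(x)|^2`, the sum of `|∂^α u_k(x)|^2` over all `|α| = j` and all components `k`, with weak
derivatives taken in `Ω`. -/
noncomputable def gradSq (j : ℕ) (Ω : Set (E d)) (u : E d → V N) (x : E d) : ℝ≥0∞ :=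
  ∑ α ∈ indicesEQ d j, ‖weakDeriv α Ω u x‖ₑ ^ 2

/-- The exponent `2_k`, where `1 / 2_k = 1 / 2 - (m - k) / d`, for `m - d / 2 < k ≤ m`. -/
noncomputable def critExp (d m k : ℕ) : ℝ≥0∞ :=
  ENNReal.ofReal (1 / (1 / 2 - ((m : ℝ) - k) / d))

/-- The finite set of multiindices with `m - d / 2 < |α| ≤ m`. -/
noncomputable def indicesY (d m : ℕ) : Finset (MIndex d) :=
  {α ∈ indicesLE d m | (m : ℝ) - d / 2 < order α}

/-- `u` is (a representative of) an element of `Y^{m,2}(Ω)`: `u` is locally integrable, and for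
`m - d / 2 < |α| ≤ m` the weak derivative `∂^α u` exists in `Ω` and lies in `L^{2_α}(Ω)`. -/
def MemY (m : ℕ) (Ω : Set (E d)) (u : E d → V N) : Prop :=
  LocallyIntegrableOn u Ω ∧ ∀ α ∈ indicesY d m,
    ∃ v, IsWeakDeriv α Ω u v ∧ MemLp v (critExp d m (order α)) (volume.restrict Ω)

/-- The norm of `Y^{m,2}(Ω)`, the sum of `‖∂^α u‖` in `L^{2_α}(Ω)` over `m - d / 2 < |α| ≤ m`. -/
noncomputable def normY (m : ℕ) (Ω : Set (E d)) (u : E d → V N) : ℝ :=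
  ∑ α ∈ indicesY d m,
    (eLpNorm (weakDeriv α Ω u) (critExp d m (order α)) (volume.restrict Ω)).toReal

lemma integrable_mderiv_smul (α : MIndex d) {u : E d → V N}
    (hu : LocallyIntegrableOn u univ) {η : E d → ℝ} (hη : ContDiff ℝ ∞ η)
    (hc : HasCompactSupport η) : Integrable fun x => mderiv α η x • u x :=
  (locallyIntegrableOn_univ.1 hu).integrable_smul_left_of_hasCompactSupport
    (contDiff_mderiv α hη).continuous (hasCompactSupport_mderiv α hc)

lemma integrable_test_smul {u : E d → V N}
    (hu : LocallyIntegrableOn u univ) {η : E d → ℝ} (hη : ContDiff ℝ ∞ η)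
    (hc : HasCompactSupport η) : Integrable fun x => η x • u x :=
  (locallyIntegrableOn_univ.1 hu).integrable_smul_left_of_hasCompactSupport hη.continuous hc

lemma IsWeakDeriv.add {α : MIndex d} {u u' v v' : E d → V N}
    (h : IsWeakDeriv α univ u v) (h' : IsWeakDeriv α univ u' v') :
    IsWeakDeriv α univ (u + u') (v + v') := by
  refine ⟨h.1.add h'.1, h.2.1.add h'.2.1, fun η hη hc hs => ?_⟩
  have e := h.2.2 η hη hc hs
  have e' := h'.2.2 η hη hc hs
  simp only [Measure.restrict_univ, Pi.add_apply, smul_add] at e e' ⊢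
  rw [integral_add (integrable_mderiv_smul α h.1 hη hc) (integrable_mderiv_smul α h'.1 hη hc),
    integral_add (integrable_test_smul h.2.1 hη hc) (integrable_test_smul h'.2.1 hη hc), e, e',
    smul_add]

lemma IsWeakDeriv.const_smul {α : MIndex d} {u v : E d → V N} (c : ℂ)
    (h : IsWeakDeriv α univ u v) : IsWeakDeriv α univ (c • u) (c • v) := by
  refine ⟨locallyIntegrableOn_univ.2 ((locallyIntegrableOn_univ.1 h.1).smul c),
    locallyIntegrableOn_univ.2 ((locallyIntegrableOn_univ.1 h.2.1).smul c), fun η hη hc hs => ?_⟩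
  have e := h.2.2 η hη hc hs
  simp only [Pi.smul_apply, smul_comm _ c, integral_smul] at e ⊢
  rw [e]

/-- `Y_0^{m,2}(Ω)`: the functions in `Y^{m,2}(ℝ^d)` that vanish (almost everywhere) outside `Ω`. -/
def Y0 (d N m : ℕ) (Ω : Set (E d)) : Submodule ℂ (E d → V N) where
  carrier := {φ | MemY m univ φ ∧ ∀ᵐ x, x ∉ Ω → φ x = 0}
  zero_mem' := by
    refine ⟨⟨locallyIntegrableOn_zero, fun α _ => ⟨0, ⟨locallyIntegrableOn_zero,
      locallyIntegrableOn_zero, ?_⟩, MemLp.zero⟩⟩, ?_⟩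
    · intro η _ _ _
      simp
    · exact Filter.Eventually.of_forall fun _ _ => rfl
  add_mem' := by
    rintro a b ⟨⟨ha, ha'⟩, ha0⟩ ⟨⟨hb, hb'⟩, hb0⟩
    refine ⟨⟨ha.add hb, fun α hα => ?_⟩, ?_⟩
    · obtain ⟨v, hv, hvL⟩ := ha' α hα
      obtain ⟨w, hw, hwL⟩ := hb' α hα
      exact ⟨v + w, hv.add hw, hvL.add hwL⟩
    · filter_upwards [ha0, hb0] with x h h' hx
      simp [h hx, h' hx]
  smul_mem' := by
    rintro c a ⟨⟨ha, ha'⟩, ha0⟩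
    refine ⟨⟨locallyIntegrableOn_univ.2 ((locallyIntegrableOn_univ.1 ha).smul c),
      fun α hα => ?_⟩, ?_⟩
    · obtain ⟨v, hv, hvL⟩ := ha' α hα
      exact ⟨c • v, hv.const_smul c, hvL.const_smul c⟩
    · filter_upwards [ha0] with x h hx
      simp [h hx]

/-- `T` is bounded, that is, `T` belongs to the dual `Y^{-m,2}(Ω)` of `Y_0^{m,2}(Ω)`. -/
def MemYDual (m : ℕ) (Ω : Set (E d)) (T : Y0 d N m Ω →ₗ[ℂ] ℂ) : Prop :=
  ∃ K : ℝ, ∀ ψ : Y0 d N m Ω, ‖T ψ‖ ≤ K * normY m Ω (ψ : E d → V N)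

/-- The operator norm of `T` in `Y^{-m,2}(Ω)`: the smallest `K ≥ 0` with
`|⟨T, ψ⟩| ≤ K ‖ψ‖` for all `ψ`. -/
noncomputable def dualNorm (m : ℕ) (Ω : Set (E d)) (T : Y0 d N m Ω →ₗ[ℂ] ℂ) : ℝ :=
  sInf {K : ℝ | 0 ≤ K ∧ ∀ ψ : Y0 d N m Ω, ‖T ψ‖ ≤ K * normY m Ω (ψ : E d → V N)}

end WeakDerivatives

section Operators

/-- Arrays `A^{j,k}_{α,β}` of complex functions on `ℝ^d`. Only the entries with `|α| ≤ m` and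
`|β| ≤ m` enter an operator of order `2m`. -/
abbrev Coeff (d N : ℕ) := Fin N → Fin N → MIndex d → MIndex d → E d → ℂ

variable {d N : ℕ}

/-- The pairing `⟨Lu, φ⟩_Ω`, the sum over `j`, `k`, `|α| ≤ m`, `|β| ≤ m` of the integral over `Ω` of
`∂^α φ_j` times the conjugate of `A^{j,k}_{α,β} ∂^β u_k`. -/
noncomputable def pairing (m : ℕ) (A : Coeff d N) (Ω : Set (E d)) (u φ : E d → V N) : ℂ :=
  ∑ j, ∑ k, ∑ α ∈ indicesLE d m, ∑ β ∈ indicesLE d m,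
    ∫ x in Ω, weakDeriv α Ω φ x j * conj (A j k α β x * weakDeriv β Ω u x k)

/-- `Lu = T` in `Ω`. -/
def SolvesIn (m : ℕ) (A : Coeff d N) (Ω : Set (E d)) (u : E d → V N)
    (T : Y0 d N m Ω →ₗ[ℂ] ℂ) : Prop :=
  ∀ φ : Y0 d N m Ω, pairing m A Ω u (φ : E d → V N) = T φ

/-- The weak Gårding inequality with constants `lam` and `δ`. -/
def WeakGarding (m : ℕ) (A : Coeff d N) (lam δ : ℝ) : Prop :=
  ∀ φ : E d → V N, ContDiff ℝ ∞ φ → HasCompactSupport φ →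
    lam * (∑ α ∈ indicesEQ d m, ∫ x, ‖mderiv α φ x‖ ^ 2) - δ * ∫ x, ‖φ x‖ ^ 2 ≤
      (∑ j, ∑ k, ∑ α ∈ indicesLE d m, ∑ β ∈ indicesLE d m,
        ∫ x, conj (mderiv α φ x j) * (A j k α β x * mderiv β φ x k)).re

/-- The exponent `D / (2m - |α| - |β|)`, equal to `∞` if `|α| = |β| = m` (for `D ≥ 1`). -/
noncomputable def coeffExp (D m : ℕ) (α β : MIndex d) : ℝ≥0∞ :=
  (D : ℝ≥0∞) / ((2 * m - order α - order β : ℕ) : ℝ≥0∞)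

/-- The Lebesgue bound: for `|α|, |β| ≤ m`, the norm of `A^{j,k}_{α,β}` in `L^q(ℝ^d)`,
`q = d / (2m - |α| - |β|)`, is at most `Lam` if `|α|, |β| > m - d / 2`, and `A^{j,k}_{α,β} = 0`
otherwise. -/
def LebesgueBound (m : ℕ) (A : Coeff d N) (Lam : ℝ) : Prop :=
  ∀ j k, ∀ α ∈ indicesLE d m, ∀ β ∈ indicesLE d m,
    if (m : ℝ) - d / 2 < order α ∧ (m : ℝ) - d / 2 < order β then
      eLpNorm (A j k α β) (coeffExp d m α β) volume ≤ ENNReal.ofReal Lam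
    else A j k α β =ᵐ[volume] 0

/-- The Bochner bound in `ℝ^{n+1}`, whose points are written `(x, t)` with `x ∈ ℝ^n` and `t ∈ ℝ` the
last coordinate: for `|α|, |β| ≤ m`, the norm of `A^{j,k}_{α,β}` in `L^∞_t L^q_x`,
`q = n / (2m - |α| - |β|)`, is at most `Lam` if `|α|, |β| > m - n / 2`, and `A^{j,k}_{α,β} = 0`
otherwise. -/
def BochnerBound {n : ℕ} (m : ℕ) (A : Coeff (n + 1) N) (Lam : ℝ) : Prop :=
  ∀ j k, ∀ α ∈ indicesLE (n + 1) m, ∀ β ∈ indicesLE (n + 1) m,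
    if (m : ℝ) - n / 2 < order α ∧ (m : ℝ) - n / 2 < order β then
      ∀ᵐ t : ℝ, eLpNorm
        (fun x : E n => A j k α β (Fin.insertNth (α := fun _ => ℝ) (Fin.last n) t x))
        (coeffExp n m α β) volume ≤ ENNReal.ofReal Lam
    else A j k α β =ᵐ[volume] 0

/-- The open cube in `ℝ^d` with sides parallel to the axes, center `c` and side length `l`. -/
def cube (c : E d) (l : ℝ) : Set (E d) := {x | ∀ i, |x i - c i| < l / 2}

end Operators

end HigherOrderElliptic

/-!
The idea is Caccioppoli's: test the equation with `ρ^{2m} u`, where `ρ` is a smooth cutoff that is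
`1` on the small cube and whose derivatives are adapted to the width `R` of the region between the
cubes. The point is to keep track of the powers of `ρ`. Commuting `ρ^m` with `∂^β` costs terms
`R^{|γ| - |β|} ρ^{m - |β| + |γ|} ∂^γ u` with `|γ| < |β|`, supported where `ρ` is not locally
constant (`isErr_commutator`), and `∂^α (ρ^{2m} u)` is `ρ^m` times the sum of `ρ^m ∂^α u` and such
terms (`exists_isErr_mderiv_sq`). Taking `m - |β|` more derivatives of these errors leaves, in
`L^2`, only the weighted lower order terms `R^{k - m} ρ^k ∇^k u` with `k < m`. Smooth families with
constants that do not depend on the member (`IsSymbol`, `IsErr`) make all these estimates uniform.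

The coefficients enter in two ways. By the Sobolev and Hölder inequalities, the form is bounded by
`L^2` norms of derivatives of order `m` (`exists_form_bound`); under the Bochner condition
this is done in hyperplanes, with the Cauchy–Schwarz inequality in the remaining variable. The
Gårding inequality is applied to `ρ^m f` for smooth `f`. Since the form at the pair `ρ^m f`, `ρ^m f`
differs from the form at `ρ^{2m} f`, `f` only by products in which at least one factor is of lower
order (`exists_form_commutator`), Young's inequality gives `exists_smooth_caccioppoli`, where the
term of order zero from the Gårding inequality and the value of the form remain on the right.

The equation is used only in the limit of smooth approximations. A function in `Y^{m,2}` of a cube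
is locally integrable with square integrable derivatives of order `m`; the intermediate derivatives
exist because mollifications satisfy a Poincaré inequality on convex compact sets, so their
derivatives form Cauchy sequences (`exists_smooth_approx`, `exists_poincare`,
`exists_isWeakDeriv_ball`). Mollifications of `u` then converge near the support of `ρ` with all
derivatives of order at most `m`. Fatou's lemma carries the form bound and the Sobolev inequality
over to limits (`IsJetLimit`), so `ρ^{2m} u` belongs to `Y_0^{m,2}`, its norm is bounded by the
weighted derivatives of `u`, and the limit of the form is, up to conjugation, the value of the
functional there. Absorbing the norm of the test function gives `exists_weak_caccioppoli`, and with
it the first of the three inequalities.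

For the other two, integration by parts shows that the weighted integrals `R^{2(k - m)} ∫ ρ^{2k}
|∇^k u|^2` with `0 < k < m` are bounded by a small multiple of the one with `k = m` and a large
multiple of the one with `k = 0` (`exists_weighted_interpolation`). The lower order terms live where
`∇ρ ≠ 0`, so a second cutoff is chosen that is `1` there and vanishes on the small cube. The
Caccioppoli inequality for the second cutoff and interpolation eliminate the intermediate
derivatives using only the region between the cubes (`exists_cube_caccioppoli`), and interpolation
with the first cutoff bounds the derivatives of order `j < m`.
-/

namespace HigherOrderElliptic

open scoped NNReal Manifold

/-! ### Multiindices -/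

section MultiIndex

variable {d : ℕ}

lemma order_add_single (α : MIndex d) (i : Fin d) : order (α + Pi.single i 1) = order α + 1 := by
  simp [order, Finset.sum_add_distrib]

@[simp] lemma order_zero : order (0 : MIndex d) = 0 := by simp [order]

lemma order_eq_zero {α : MIndex d} : order α = 0 ↔ α = 0 := by
  simp [order, funext_iff]

lemma exists_eq_add_single {α : MIndex d} {k : ℕ} (h : order α = k + 1) :
    ∃ β i, α = β + Pi.single i 1 ∧ order β = k := by
  obtain ⟨i, hi⟩ : ∃ i, α i ≠ 0 := by
    by_contra! hc
    have : order α = 0 := by simp [order, hc]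
    omega
  have e : α = (α - Pi.single i 1) + Pi.single i 1 := by
    ext j
    rcases eq_or_ne j i with rfl | hj
    · simp; omega
    · simp [hj]
  refine ⟨α - Pi.single i 1, i, e, ?_⟩
  have := congrArg order e
  rw [order_add_single] at this
  omega

/-- Induction on a multiindex, one differentiation at a time. -/
lemma mindex_induction {P : MIndex d → Prop} (h0 : P 0)
    (hs : ∀ α i, P α → P (α + Pi.single i 1)) (α : MIndex d) : P α := by
  induction h : order α generalizing α with
  | zero => rwa [order_eq_zero.1 h]
  | succ k ih =>
    obtain ⟨β, i, rfl, hβ⟩ := exists_eq_add_single h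
    exact hs β i (ih β hβ)

end MultiIndex

/-! ### Calculus of iterated partial derivatives -/

section Calculus

variable {d : ℕ} {F : Type*} [NormedAddCommGroup F] [NormedSpace ℝ F]
variable {f g : E d → F}

lemma smooth_differentiableAt (hf : ContDiff ℝ ∞ f) (x : E d) : DifferentiableAt ℝ f x :=
  (hf.differentiable (by simp)) x

lemma pderiv_comm (i j : Fin d) (hf : ContDiff ℝ ∞ f) :
    pderiv i (pderiv j f) = pderiv j (pderiv i f) := by
  ext x
  have hs : IsSymmSndFDerivAt ℝ f x :=
    hf.contDiffAt.isSymmSndFDerivAt (by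
      simp only [minSmoothness_of_isRCLikeNormedField]
      exact WithTop.coe_le_coe.2 le_top)
  have hd : DifferentiableAt ℝ (fderiv ℝ f) x :=
    ((hf.fderiv_right (m := ∞) (by simp)).differentiable (by simp)) x
  have key : ∀ a b : E d, fderiv ℝ (fun y => fderiv ℝ f y a) x b
      = fderiv ℝ (fderiv ℝ f) x b a := by
    intro a b
    rw [fderiv_clm_apply hd (differentiableAt_const _)]
    simp
  change fderiv ℝ (fun y => fderiv ℝ f y _) x _ = fderiv ℝ (fun y => fderiv ℝ f y _) x _
  rw [key, key, hs]

@[simp] lemma mderiv_zero (f : E d → F) : mderiv 0 f = f := by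
  unfold mderiv
  induction List.finRange d with
  | nil => rfl
  | cons i l ih => simp

lemma contDiff_foldr (α : MIndex d) (l : List (Fin d)) (hf : ContDiff ℝ ∞ f) :
    ContDiff ℝ ∞ (l.foldr (fun i g => (pderiv i)^[α i] g) f) := by
  induction l with
  | nil => simpa using hf
  | cons i l ih =>
    rw [List.foldr_cons]
    induction α i with
    | zero => simpa using ih
    | succ k hk =>
      rw [Function.iterate_succ_apply']
      exact contDiff_pderiv i hk

lemma iterate_pderiv_comm (i j : Fin d) (k : ℕ) (hf : ContDiff ℝ ∞ f) :
    (pderiv j)^[k] (pderiv i f) = pderiv i ((pderiv j)^[k] f) ∧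
      ContDiff ℝ ∞ ((pderiv j)^[k] f) := by
  induction k with
  | zero => exact ⟨rfl, hf⟩
  | succ k ih =>
    rw [Function.iterate_succ_apply', Function.iterate_succ_apply', ih.1, pderiv_comm j i ih.2]
    exact ⟨rfl, contDiff_pderiv j ih.2⟩

lemma mderiv_pderiv (α : MIndex d) (i : Fin d) (hf : ContDiff ℝ ∞ f) :
    mderiv α (pderiv i f) = pderiv i (mderiv α f) := by
  unfold mderiv
  induction List.finRange d with
  | nil => rfl
  | cons j l ih =>
    rw [List.foldr_cons, List.foldr_cons, ih,
      (iterate_pderiv_comm i j _ (contDiff_foldr α l hf)).1]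

lemma mderiv_add_single (α : MIndex d) (i : Fin d) (hf : ContDiff ℝ ∞ f) :
    mderiv (α + Pi.single i 1) f = pderiv i (mderiv α f) := by
  have key : ∀ l : List (Fin d), l.Nodup →
      l.foldr (fun j g => (pderiv j)^[(α + Pi.single i 1 : MIndex d) j] g) f =
        if i ∈ l then pderiv i (l.foldr (fun j g => (pderiv j)^[α j] g) f)
          else l.foldr (fun j g => (pderiv j)^[α j] g) f := by
    intro l hl
    induction l with
    | nil => simp
    | cons j l ih =>
      rw [List.nodup_cons] at hl
      rw [List.foldr_cons, List.foldr_cons, ih hl.2]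
      rcases eq_or_ne i j with rfl | hij
      · simp only [Pi.add_apply, Pi.single_eq_same, hl.1, if_false, List.mem_cons, true_or, if_true]
        rw [Function.iterate_succ_apply']
      · have : (α + Pi.single i 1 : MIndex d) j = α j := by simp [hij.symm]
        rw [this]
        by_cases hil : i ∈ l
        · simp only [hil, if_true, List.mem_cons, or_true]
          exact (iterate_pderiv_comm i j _ (contDiff_foldr α l hf)).1
        · simp [hil, hij]
  have := key _ (List.nodup_finRange d)
  rw [if_pos (List.mem_finRange i)] at this
  exact this

/-- In `∂^{α + e_i}` the additional derivative may be taken first; in `mderiv_add_single` it is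
taken last. -/
lemma mderiv_add_single' (α : MIndex d) (i : Fin d) (hf : ContDiff ℝ ∞ f) :
    mderiv (α + Pi.single i 1) f = mderiv α (pderiv i f) := by
  rw [mderiv_add_single α i hf, mderiv_pderiv α i hf]

lemma mderiv_single (i : Fin d) (hf : ContDiff ℝ ∞ f) :
    mderiv (Pi.single i 1) f = pderiv i f := by
  have := mderiv_add_single 0 i hf
  simpa using this

lemma pderiv_add (i : Fin d) (hf : ContDiff ℝ ∞ f) (hg : ContDiff ℝ ∞ g) :
    pderiv i (f + g) = pderiv i f + pderiv i g := by
  ext x; simp [pderiv, fderiv_add (smooth_differentiableAt hf x) (smooth_differentiableAt hg x)]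

lemma pderiv_sub (i : Fin d) (hf : ContDiff ℝ ∞ f) (hg : ContDiff ℝ ∞ g) :
    pderiv i (f - g) = pderiv i f - pderiv i g := by
  ext x; simp [pderiv, fderiv_sub (smooth_differentiableAt hf x) (smooth_differentiableAt hg x)]

lemma mderiv_add (α : MIndex d) (hf : ContDiff ℝ ∞ f) (hg : ContDiff ℝ ∞ g) :
    mderiv α (f + g) = mderiv α f + mderiv α g := by
  induction α using mindex_induction with
  | h0 => simp
  | hs α i ih =>
    rw [mderiv_add_single _ _ (show ContDiff ℝ ∞ (f + g) from hf.add hg), ih,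
      mderiv_add_single _ _ hf, mderiv_add_single _ _ hg,
      pderiv_add i (contDiff_mderiv α hf) (contDiff_mderiv α hg)]

lemma mderiv_sub (α : MIndex d) (hf : ContDiff ℝ ∞ f) (hg : ContDiff ℝ ∞ g) :
    mderiv α (f - g) = mderiv α f - mderiv α g := by
  induction α using mindex_induction with
  | h0 => simp
  | hs α i ih =>
    rw [mderiv_add_single _ _ (show ContDiff ℝ ∞ (f - g) from hf.sub hg), ih,
      mderiv_add_single _ _ hf, mderiv_add_single _ _ hg,
      pderiv_sub i (contDiff_mderiv α hf) (contDiff_mderiv α hg)]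

lemma pderiv_smul (i : Fin d) {a : E d → ℝ} (ha : ContDiff ℝ ∞ a) (hf : ContDiff ℝ ∞ f) :
    pderiv i (a • f) = pderiv i a • f + a • pderiv i f := by
  ext x
  simp only [pderiv, Pi.add_apply, Pi.smul_apply']
  rw [fderiv_smul (smooth_differentiableAt ha x) (smooth_differentiableAt hf x)]
  simp [add_comm]

lemma pderiv_mul (i : Fin d) {a b : E d → ℝ} (ha : ContDiff ℝ ∞ a) (hb : ContDiff ℝ ∞ b) :
    pderiv i (a * b) = pderiv i a * b + a * pderiv i b :=
  pderiv_smul i ha hb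

lemma pderiv_pow (i : Fin d) {a : E d → ℝ} (ha : ContDiff ℝ ∞ a) (k : ℕ) :
    pderiv i (a ^ (k + 1)) = ((k : ℝ) + 1) • (a ^ k * pderiv i a) := by
  induction k with
  | zero => simp
  | succ k ih =>
    rw [pow_succ, pderiv_mul i (show ContDiff ℝ ∞ (a ^ (k + 1)) from ha.pow _) ha, ih]
    ext x
    simp
    ring

lemma pderiv_congr (i : Fin d) {x : E d} (h : f =ᶠ[nhds x] g) :
    pderiv i f =ᶠ[nhds x] pderiv i g := by
  filter_upwards [h.fderiv (𝕜 := ℝ)] with y hy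
  simp [pderiv, hy]

lemma mderiv_congr (α : MIndex d) {x : E d} (h : f =ᶠ[nhds x] g)
    (hf : ContDiff ℝ ∞ f) (hg : ContDiff ℝ ∞ g) :
    mderiv α f =ᶠ[nhds x] mderiv α g := by
  induction α using mindex_induction with
  | h0 => simpa
  | hs α i ih =>
    rw [mderiv_add_single _ _ hf, mderiv_add_single _ _ hg]
    exact pderiv_congr i ih

@[simp] lemma mderiv_zero_fun (α : MIndex d) : mderiv α (0 : E d → F) = 0 := by
  induction α using mindex_induction with
  | h0 => simp
  | hs α i ih =>
    rw [mderiv_add_single _ _ (show ContDiff ℝ ∞ (0 : E d → F) from contDiff_const), ih]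
    ext x; simp [pderiv]

lemma mderiv_eq_zero_of_eventually (α : MIndex d) {x : E d} (h : f =ᶠ[nhds x] 0)
    (hf : ContDiff ℝ ∞ f) : mderiv α f x = 0 := by
  have := (mderiv_congr α h hf contDiff_const).eq_of_nhds
  simpa using this

lemma tsupport_mderiv (α : MIndex d) (hf : ContDiff ℝ ∞ f) :
    tsupport (mderiv α f) ⊆ tsupport f := by
  refine closure_minimal (fun x hx => ?_) (isClosed_tsupport f)
  by_contra hn
  exact hx (mderiv_eq_zero_of_eventually α (notMem_tsupport_iff_eventuallyEq.1 hn) hf)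

lemma tsupport_pderiv (i : Fin d) (hf : ContDiff ℝ ∞ f) :
    tsupport (pderiv i f) ⊆ tsupport f := by
  rw [← mderiv_single i hf]; exact tsupport_mderiv _ hf

lemma norm_fderiv_le_sum (f : E d → F) (x : E d) :
    ‖fderiv ℝ f x‖ ≤ ∑ i, ‖pderiv i f x‖ := by
  refine ContinuousLinearMap.opNorm_le_bound _ (by positivity) fun v => ?_
  have hv : v = ∑ i, v i • (Pi.single i 1 : E d) := by
    ext j; simp [Finset.sum_apply, Pi.single_apply]
  conv_lhs => rw [hv]
  rw [map_sum, Finset.sum_mul]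
  refine (norm_sum_le _ _).trans (Finset.sum_le_sum fun i _ => ?_)
  rw [map_smul, norm_smul, mul_comm]
  exact mul_le_mul_of_nonneg_left (norm_le_pi_norm v i) (norm_nonneg _)

/-- Integration by parts in the `i`-th variable. -/
lemma integral_pderiv_smul (i : Fin d) {η : E d → ℝ} (hη : ContDiff ℝ ∞ η)
    (hc : HasCompactSupport η) (hf : ContDiff ℝ ∞ f) :
    ∫ x, pderiv i η x • f x = - ∫ x, η x • pderiv i f x := by
  have h1 : Continuous (pderiv i η) := (contDiff_pderiv i hη).continuous
  have h2 : Continuous (pderiv i f) := (contDiff_pderiv i hf).continuous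
  have := integral_bilinear_hasLineDerivAt_right_eq_neg_left_of_integrable
    (μ := (volume : Measure (E d))) (f := η) (g := f) (f' := pderiv i η) (g' := pderiv i f)
    (v := Pi.single i 1) (B := ContinuousLinearMap.lsmul ℝ ℝ)
    ?_ ?_ ?_ ?_ ?_
  · simp only [ContinuousLinearMap.lsmul_apply] at this
    rw [this, neg_neg]
  · exact (h1.smul hf.continuous).integrable_of_hasCompactSupport
      ((hasCompactSupport_pderiv i hc).smul_right)
  · exact (hη.continuous.smul h2).integrable_of_hasCompactSupport hc.smul_right
  · exact (hη.continuous.smul hf.continuous).integrable_of_hasCompactSupport hc.smul_right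
  · exact fun x _ => (smooth_differentiableAt hη x).hasFDerivAt.hasLineDerivAt _
  · exact fun x _ => (smooth_differentiableAt hf x).hasFDerivAt.hasLineDerivAt _

lemma integral_mderiv_smul (α : MIndex d) {η : E d → ℝ} (hη : ContDiff ℝ ∞ η)
    (hc : HasCompactSupport η) (hf : ContDiff ℝ ∞ f) :
    ∫ x, mderiv α η x • f x = (-1 : ℝ) ^ order α • ∫ x, η x • mderiv α f x := by
  induction α using mindex_induction generalizing f with
  | h0 => simp
  | hs α i ih =>
    rw [mderiv_add_single _ _ hη, integral_pderiv_smul i (contDiff_mderiv α hη)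
      (hasCompactSupport_mderiv α hc) hf, ih (contDiff_pderiv i hf), mderiv_add_single' _ _ hf,
      order_add_single, pow_succ]
    simp

lemma integral_pderiv_eq_zero (i : Fin d) (hf : ContDiff ℝ ∞ f)
    (hc : HasCompactSupport f) : ∫ x, pderiv i f x = 0 := by
  have h2 : Continuous (pderiv i f) := (contDiff_pderiv i hf).continuous
  have := integral_bilinear_hasLineDerivAt_right_eq_neg_left_of_integrable
    (μ := (volume : Measure (E d))) (f := fun _ => (1 : ℝ)) (g := f) (f' := fun _ => 0)
    (g' := pderiv i f) (v := Pi.single i 1) (B := ContinuousLinearMap.lsmul ℝ ℝ)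
    ?_ ?_ ?_ ?_ ?_
  · simpa using this
  · simp
  · simpa using h2.integrable_of_hasCompactSupport (hasCompactSupport_pderiv i hc)
  · simpa using hf.continuous.integrable_of_hasCompactSupport hc
  · exact fun x _ => (hasFDerivAt_const (1 : ℝ) x).hasLineDerivAt _
  · exact fun x _ => (smooth_differentiableAt hf x).hasFDerivAt.hasLineDerivAt _

end Calculus

/-! ### Symbols: derivative bounds with a length scale -/

section Symbols

variable {d : ℕ} {ι : Type*}

/-- The function `h` vanishes in a neighbourhood of each point outside `P`. -/
def VanishOff {F : Type*} [Zero F] (P : Set (E d)) (h : E d → F) : Prop :=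
  ∀ x, x ∉ P → h =ᶠ[nhds x] 0

/-- A family of smooth functions `h i` is a symbol of order `s` if `|∂^ξ h i| ≤ C r_i^{s + |ξ|}`
with constants independent of the member `i` of the family. Here `r i` is the reciprocal of the
length scale belonging to `i`. -/
def IsSymbol (r : ι → ℝ) (s : ℕ) (h : ι → E d → ℝ) : Prop :=
  (∀ i, ContDiff ℝ ∞ (h i)) ∧
    ∀ ξ : MIndex d, ∃ C : ℝ, 0 ≤ C ∧ ∀ i x, |mderiv ξ (h i) x| ≤ C * r i ^ (s + order ξ)

variable {r : ι → ℝ} {s t : ℕ} {a b h : ι → E d → ℝ}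

lemma IsSymbol.pderiv (hh : IsSymbol r s h) (j : Fin d) :
    IsSymbol r (s + 1) fun i => pderiv j (h i) := by
  refine ⟨fun i => contDiff_pderiv j (hh.1 i), fun ξ => ?_⟩
  obtain ⟨C, hC, hb⟩ := hh.2 (ξ + Pi.single j 1)
  refine ⟨C, hC, fun i x => ?_⟩
  have := hb i x
  rw [mderiv_add_single' _ _ (hh.1 i), order_add_single] at this
  convert this using 3
  ring

lemma IsSymbol.add (ha : IsSymbol r s a) (hb : IsSymbol r s b) :
    IsSymbol r s fun i => a i + b i := by
  refine ⟨fun i => (ha.1 i).add (hb.1 i), fun ξ => ?_⟩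
  obtain ⟨C, hC, h1⟩ := ha.2 ξ
  obtain ⟨D, hD, h2⟩ := hb.2 ξ
  refine ⟨C + D, by positivity, fun i x => ?_⟩
  rw [mderiv_add _ (ha.1 i) (hb.1 i), add_mul]
  exact (abs_add_le _ _).trans (add_le_add (h1 i x) (h2 i x))

lemma IsSymbol.mul (hr : ∀ i, 0 ≤ r i) (ha : IsSymbol r s a) (hb : IsSymbol r t b) :
    IsSymbol r (s + t) fun i => a i * b i := by
  refine ⟨fun i => (ha.1 i).mul (hb.1 i), fun ξ => ?_⟩
  induction ξ using mindex_induction generalizing s t a b with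
  | h0 =>
    obtain ⟨C, hC, h1⟩ := ha.2 0
    obtain ⟨D, hD, h2⟩ := hb.2 0
    refine ⟨C * D, by positivity, fun i x => ?_⟩
    have e1 := h1 i x
    have e2 := h2 i x
    simp only [mderiv_zero, order_zero, add_zero, Pi.mul_apply] at e1 e2 ⊢
    rw [abs_mul, pow_add, mul_mul_mul_comm]
    exact mul_le_mul e1 e2 (abs_nonneg _) (by have := hr i; positivity)
  | hs ξ j ih =>
    obtain ⟨C, hC, h1⟩ := ih (ha.pderiv j) hb
    obtain ⟨D, hD, h2⟩ := ih ha (hb.pderiv j)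
    refine ⟨C + D, by positivity, fun i x => ?_⟩
    have c1 : ContDiff ℝ ∞ (HigherOrderElliptic.pderiv j (a i) * b i) :=
      (contDiff_pderiv j (ha.1 i)).mul (hb.1 i)
    have c2 : ContDiff ℝ ∞ (a i * HigherOrderElliptic.pderiv j (b i)) :=
      (ha.1 i).mul (contDiff_pderiv j (hb.1 i))
    rw [mderiv_add_single' _ _ (show ContDiff ℝ ∞ (a i * b i) from (ha.1 i).mul (hb.1 i)),
      pderiv_mul j (ha.1 i) (hb.1 i), mderiv_add _ c1 c2, order_add_single, add_mul]
    refine (abs_add_le _ _).trans (add_le_add ?_ ?_)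
    · rw [show s + t + (order ξ + 1) = s + 1 + t + order ξ by ring]
      exact h1 i x
    · rw [show s + t + (order ξ + 1) = s + (t + 1) + order ξ by ring]
      exact h2 i x

lemma isSymbol_const (c : ℝ) (hr : ∀ i, 0 ≤ r i) : IsSymbol (d := d) r 0 fun _ _ => c := by
  refine ⟨fun i => contDiff_const, fun ξ => ?_⟩
  refine ⟨|c|, abs_nonneg _, fun i x => ?_⟩
  induction ξ using mindex_induction with
  | h0 => simp
  | hs ξ j ih =>
    have h0 : pderiv j (fun _ : E d => c) = 0 := by ext x; simp [HigherOrderElliptic.pderiv]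
    rw [mderiv_add_single' _ _ contDiff_const, h0, mderiv_zero_fun]
    have := hr i
    simp; positivity

lemma IsSymbol.const_mul (hr : ∀ i, 0 ≤ r i) (c : ℝ) (hh : IsSymbol r s h) :
    IsSymbol r s fun i => (fun _ => c) * h i := by
  simpa using (isSymbol_const c hr).mul hr hh

section VanishOff

variable {F : Type*} [NormedAddCommGroup F] {P : Set (E d)}

lemma VanishOff.add {g g' : E d → F} (hg : VanishOff P g) (hg' : VanishOff P g') :
    VanishOff P (g + g') := by
  intro x hx
  filter_upwards [hg x hx, hg' x hx] with y h1 h2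
  simp [h1, h2]

lemma VanishOff.eq_zero {g : E d → F} (hg : VanishOff P g) {x : E d} (hx : x ∉ P) : g x = 0 :=
  (hg x hx).eq_of_nhds

variable [NormedSpace ℝ F]

lemma VanishOff.pderiv {g : E d → F} (hg : VanishOff P g) (j : Fin d) :
    VanishOff P (pderiv j g) := by
  intro x hx
  refine (pderiv_congr j (hg x hx)).trans (Filter.Eventually.of_forall fun y => ?_)
  simp [HigherOrderElliptic.pderiv]

lemma VanishOff.mderiv {g : E d → F} (hg : VanishOff P g) (hs : ContDiff ℝ ∞ g) (ξ : MIndex d) :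
    VanishOff P (mderiv ξ g) := by
  intro x hx
  have := mderiv_congr ξ (hg x hx) hs contDiff_const
  rwa [mderiv_zero_fun] at this

lemma VanishOff.smul_left {a : E d → ℝ} (ha : VanishOff P a) (g : E d → F) :
    VanishOff P (a • g) := by
  intro x hx
  filter_upwards [ha x hx] with y h1
  simp [h1]

lemma VanishOff.smul_right {g : E d → F} (hg : VanishOff P g) (a : E d → ℝ) :
    VanishOff P (a • g) := by
  intro x hx
  filter_upwards [hg x hx] with y h1
  simp [h1]

end VanishOff

variable {F : Type*} [NormedAddCommGroup F] [NormedSpace ℝ F]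
variable {m : ℕ} {ρ : ι → E d → ℝ} {f : ι → E d → F} {P : ι → Set (E d)}

/-- The weighted sum `∑_{|γ| < k} r^{k - |γ|} ρ^{m - k + |γ|} |∂^γ f|`, which dominates the terms of
total order `k` that appear when a power of the cutoff `ρ` is commuted past a derivative. -/
noncomputable def wsum (m : ℕ) (r : ℝ) (ρ : E d → ℝ) (f : E d → F) (k : ℕ) (x : E d) : ℝ :=
  ∑ γ ∈ (indicesLE d m).filter (fun γ => order γ < k),
    r ^ (k - order γ) * ρ x ^ (m - k + order γ) * ‖mderiv γ f x‖

/-- The family `g` is an error term of order `k`: it vanishes off `P`, and its derivatives `∂^ξ g`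
are bounded by the weighted sum of total order `k + |ξ|`. -/
def IsErr (m : ℕ) (r : ι → ℝ) (ρ : ι → E d → ℝ) (f : ι → E d → F) (P : ι → Set (E d)) (k : ℕ)
    (g : ι → E d → F) : Prop :=
  (∀ i, ContDiff ℝ ∞ (g i)) ∧ (∀ i, VanishOff (P i) (g i)) ∧
    ∀ ξ : MIndex d, k + order ξ ≤ m → ∃ C : ℝ, 0 ≤ C ∧
      ∀ i x, ‖mderiv ξ (g i) x‖ ≤ C * wsum m (r i) (ρ i) (f i) (k + order ξ) x

lemma IsErr.pderiv {k : ℕ} {g : ι → E d → F} (hg : IsErr m r ρ f P k g) (j : Fin d) :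
    IsErr m r ρ f P (k + 1) fun i => pderiv j (g i) := by
  refine ⟨fun i => contDiff_pderiv j (hg.1 i), fun i => (hg.2.1 i).pderiv j, fun ξ hξ => ?_⟩
  obtain ⟨C, hC, hb⟩ := hg.2.2 (ξ + Pi.single j 1) (by rw [order_add_single]; omega)
  refine ⟨C, hC, fun i x => ?_⟩
  have := hb i x
  rw [mderiv_add_single' _ _ (hg.1 i), order_add_single] at this
  convert this using 3
  ring

lemma IsErr.add {k : ℕ} {g g' : ι → E d → F} (hg : IsErr m r ρ f P k g)
    (hg' : IsErr m r ρ f P k g') : IsErr m r ρ f P k fun i => g i + g' i := by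
  refine ⟨fun i => (hg.1 i).add (hg'.1 i), fun i => (hg.2.1 i).add (hg'.2.1 i), fun ξ hξ => ?_⟩
  obtain ⟨C, hC, h1⟩ := hg.2.2 ξ hξ
  obtain ⟨D, hD, h2⟩ := hg'.2.2 ξ hξ
  refine ⟨C + D, by positivity, fun i x => ?_⟩
  rw [mderiv_add _ (hg.1 i) (hg'.1 i), add_mul]
  exact (norm_add_le _ _).trans (add_le_add (h1 i x) (h2 i x))

lemma isErr_zero (k : ℕ) :
    IsErr m r ρ f P k fun _ => 0 := by
  refine ⟨fun i => contDiff_const, fun i x _ => Filter.EventuallyEq.rfl, fun ξ _ =>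
    ⟨0, le_rfl, fun i x => ?_⟩⟩
  simp

/-- Derivatives of `ρ^p h`, for a symbol `h`, keep the powers of `ρ` that are not used up. -/
lemma rho_pow_mul_bound (hr : ∀ i, 0 ≤ r i) (hρ : ∀ i x, 0 ≤ ρ i x) (hsρ : IsSymbol r 0 ρ)
    (hh : IsSymbol r s h) (p : ℕ) (ξ : MIndex d) (hp : order ξ ≤ p) :
    ∃ C : ℝ, 0 ≤ C ∧ ∀ i x,
      |mderiv ξ (ρ i ^ p * h i) x| ≤ C * (r i ^ (s + order ξ) * ρ i x ^ (p - order ξ)) := by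
  induction ξ using mindex_induction generalizing s h p with
  | h0 =>
    obtain ⟨C, hC, h1⟩ := hh.2 0
    refine ⟨C, hC, fun i x => ?_⟩
    have e := h1 i x
    have e2 := hρ i x
    simp only [mderiv_zero, order_zero, add_zero, Pi.mul_apply, Pi.pow_apply, tsub_zero] at e ⊢
    rw [abs_mul, abs_of_nonneg (by positivity), ← mul_assoc, mul_comm]
    gcongr
  | hs ξ j ih =>
    rw [order_add_single] at hp
    obtain ⟨q, rfl⟩ : ∃ q, p = q + 1 := ⟨p - 1, by omega⟩
    have hb : IsSymbol r (s + 1) fun i =>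
        (fun _ => (q : ℝ) + 1) * (HigherOrderElliptic.pderiv j (ρ i) * h i)
          + ρ i * HigherOrderElliptic.pderiv j (h i) := by
      refine IsSymbol.add ?_ ?_
      · have := ((hsρ.pderiv j).mul hr hh).const_mul hr ((q : ℝ) + 1)
        convert this using 1; ring
      · have := hsρ.mul hr (hh.pderiv j)
        convert this using 1; ring
    obtain ⟨C, hC, h1⟩ := ih hb q (by omega)
    refine ⟨C, hC, fun i x => ?_⟩
    have c0 : ContDiff ℝ ∞ (ρ i ^ (q + 1)) := (hsρ.1 i).pow _
    have c : ContDiff ℝ ∞ (ρ i ^ (q + 1) * h i) := c0.mul (hh.1 i)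
    have e : HigherOrderElliptic.pderiv j (ρ i ^ (q + 1) * h i) = ρ i ^ q *
        ((fun _ => (q : ℝ) + 1) * (HigherOrderElliptic.pderiv j (ρ i) * h i)
          + ρ i * HigherOrderElliptic.pderiv j (h i)) := by
      rw [pderiv_mul j c0 (hh.1 i), pderiv_pow j (hsρ.1 i)]
      ext y; simp; ring
    rw [mderiv_add_single' _ _ c, e, order_add_single]
    convert h1 i x using 4
    · ring
    · omega

/-- If `a` behaves like `ρ^{m - s}` times a symbol of order `s ≥ 1`, then `a ∂^γ f` is an error
term. -/
lemma isErr_smul_mderiv (hρ : ∀ i x, 0 ≤ ρ i x) (hr : ∀ i, 0 ≤ r i) (hsρ : IsSymbol r 0 ρ)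
    (hf : ∀ i, ContDiff ℝ ∞ (f i)) (hs : 1 ≤ s) (hh : IsSymbol r s h)
    (hP : ∀ i, VanishOff (P i) (h i)) (γ : MIndex d) :
    IsErr m r ρ f P (s + order γ) fun i => (ρ i ^ (m - s) * h i) • mderiv γ (f i) := by
  have c0 : ∀ i, ContDiff ℝ ∞ (ρ i ^ (m - s) * h i) := fun i => ((hsρ.1 i).pow _).mul (hh.1 i)
  refine ⟨fun i => (c0 i).smul (contDiff_mderiv γ (hf i)),
    fun i => VanishOff.smul_left ((hP i).smul_right _) _, fun ξ hξ => ?_⟩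
  have key : ∀ (ξ : MIndex d) (t : ℕ) (a : ι → E d → ℝ) (γ : MIndex d), (∀ i, ContDiff ℝ ∞ (a i)) →
      (∀ ζ : MIndex d, t + order ζ ≤ m → ∃ C : ℝ, 0 ≤ C ∧ ∀ i x, |mderiv ζ (a i) x| ≤
        C * (r i ^ (t + order ζ) * ρ i x ^ (m - (t + order ζ)))) → 1 ≤ t →
      t + order γ + order ξ ≤ m → ∃ C : ℝ, 0 ≤ C ∧ ∀ i x,
        ‖mderiv ξ (a i • mderiv γ (f i)) x‖ ≤
          C * wsum m (r i) (ρ i) (f i) (t + order γ + order ξ) x := by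
    intro ξ
    induction ξ using mindex_induction with
    | h0 =>
      intro t a γ ca ha ht hle
      obtain ⟨C, hC, h1⟩ := ha 0 (by simp at hle ⊢; omega)
      refine ⟨C, hC, fun i x => ?_⟩
      have e1 := h1 i x
      simp only [mderiv_zero, order_zero, add_zero, Pi.smul_apply'] at e1 hle ⊢
      have hmem : γ ∈ (indicesLE d m).filter (fun γ' => order γ' < t + order γ) := by
        rw [Finset.mem_filter, mem_indicesLE]; omega
      have h0 : ∀ γ' ∈ (indicesLE d m).filter (fun γ' => order γ' < t + order γ),
          0 ≤ r i ^ (t + order γ - order γ') * ρ i x ^ (m - (t + order γ) + order γ') *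
            ‖mderiv γ' (f i) x‖ := fun γ' _ => by
        have := hr i; have := hρ i x; positivity
      have h2 := Finset.single_le_sum h0 hmem
      rw [norm_smul, Real.norm_eq_abs]
      calc |a i x| * ‖mderiv γ (f i) x‖
          ≤ C * (r i ^ t * ρ i x ^ (m - t)) * ‖mderiv γ (f i) x‖ := by gcongr
        _ = C * (r i ^ (t + order γ - order γ) * ρ i x ^ (m - (t + order γ) + order γ) *
            ‖mderiv γ (f i) x‖) := by
          rw [show t + order γ - order γ = t by omega,
            show m - (t + order γ) + order γ = m - t by omega]; ring
        _ ≤ _ := by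
          refine mul_le_mul_of_nonneg_left ?_ hC
          exact h2
    | hs ξ j ih =>
      intro t a γ ca ha ht hle
      rw [order_add_single] at hle
      have ha' : ∀ ζ : MIndex d, (t + 1) + order ζ ≤ m → ∃ C : ℝ, 0 ≤ C ∧ ∀ i x,
          |mderiv ζ (pderiv j (a i)) x| ≤
            C * (r i ^ ((t + 1) + order ζ) * ρ i x ^ (m - ((t + 1) + order ζ))) := by
        intro ζ hζ
        obtain ⟨C, hC, h1⟩ := ha (ζ + Pi.single j 1) (by rw [order_add_single]; omega)
        refine ⟨C, hC, fun i x => ?_⟩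
        have := h1 i x
        rw [mderiv_add_single' _ _ (ca i), order_add_single] at this
        rw [show t + 1 + order ζ = t + (order ζ + 1) by ring]
        exact this
      obtain ⟨C, hC, h1⟩ := ih (t + 1) (fun i => pderiv j (a i)) γ
        (fun i => contDiff_pderiv j (ca i)) ha' (by omega) (by omega)
      obtain ⟨D, hD, h2⟩ := ih t a (γ + Pi.single j 1) ca ha ht
        (by rw [order_add_single]; omega)
      refine ⟨C + D, by positivity, fun i x => ?_⟩
      have cg := contDiff_mderiv γ (hf i)
      have c1 : ContDiff ℝ ∞ (pderiv j (a i) • mderiv γ (f i)) :=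
        (contDiff_pderiv j (ca i)).smul cg
      have c2 : ContDiff ℝ ∞ (a i • pderiv j (mderiv γ (f i))) :=
        (ca i).smul (contDiff_pderiv j cg)
      rw [mderiv_add_single' _ _ (show ContDiff ℝ ∞ (a i • mderiv γ (f i)) from (ca i).smul cg),
        pderiv_smul j (ca i) cg, mderiv_add _ c1 c2, order_add_single, add_mul]
      have e1 := h1 i x
      have e2 := h2 i x
      rw [mderiv_add_single _ _ (hf i), order_add_single] at e2
      refine (norm_add_le _ _).trans (add_le_add ?_ ?_)
      · rw [show t + order γ + (order ξ + 1) = t + 1 + order γ + order ξ by ring]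
        exact e1
      · rw [show t + order γ + (order ξ + 1) = t + (order γ + 1) + order ξ by ring]
        exact e2
  refine key ξ s (fun i => ρ i ^ (m - s) * h i) γ c0 (fun ζ hζ => ?_) hs hξ
  obtain ⟨C, hC, h1⟩ := rho_pow_mul_bound hr hρ hsρ hh (m - s) ζ (by omega)
  refine ⟨C, hC, fun i x => ?_⟩
  rw [← Nat.sub_sub]
  exact h1 i x

/-- The commutator of `ρ^m` with `∂^β` is an error term of order `|β|`. -/
lemma isErr_commutator (hρ : ∀ i x, 0 ≤ ρ i x) (hr : ∀ i, 0 ≤ r i) (hsρ : IsSymbol r 0 ρ)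
    (hP : ∀ i j, VanishOff (P i) (pderiv j (ρ i))) (hf : ∀ i, ContDiff ℝ ∞ (f i)) (β : MIndex d)
    (hβ : order β ≤ m) :
    IsErr m r ρ f P (order β) fun i => mderiv β (ρ i ^ m • f i) - ρ i ^ m • mderiv β (f i) := by
  induction β using mindex_induction with
  | h0 => simpa using isErr_zero (m := m) (r := r) (ρ := ρ) (f := f) (P := P) 0
  | hs β j ih =>
    rw [order_add_single] at hβ ⊢
    obtain ⟨q, rfl⟩ : ∃ q, m = q + 1 := ⟨m - 1, by omega⟩
    have h1 := (ih (by omega)).pderiv j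
    have h2 := isErr_smul_mderiv (m := q + 1) (s := 1) (P := P) hρ hr hsρ hf le_rfl
      ((hsρ.pderiv j).const_mul hr ((q : ℝ) + 1))
      (fun i => (hP i j).smul_right _) β
    rw [add_comm 1] at h2
    convert h1.add h2 using 1
    funext i
    have c0 : ContDiff ℝ ∞ (ρ i ^ (q + 1)) := (hsρ.1 i).pow _
    have c1 : ContDiff ℝ ∞ (ρ i ^ (q + 1) • f i) := c0.smul (hf i)
    have c2 : ContDiff ℝ ∞ (ρ i ^ (q + 1) • mderiv β (f i)) := c0.smul (contDiff_mderiv β (hf i))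
    rw [mderiv_add_single _ _ c1, mderiv_add_single _ _ (hf i),
      pderiv_sub j (contDiff_mderiv β c1) c2, pderiv_smul j c0 (contDiff_mderiv β (hf i)),
      pderiv_pow j (hsρ.1 i)]
    ext1 x
    simp only [Pi.sub_apply, Pi.add_apply, Pi.smul_apply, Pi.smul_apply', Pi.mul_apply,
      smul_eq_mul, add_tsub_cancel_right, Pi.pow_apply]
    rw [mul_left_comm]
    abel

/-- Derivatives of `ρ^{2m - s} h ∂^γ f`, for a symbol `h` of order `s ≥ 1`, are `ρ^m` times error
terms. -/
lemma exists_isErr_factor (hρ : ∀ i x, 0 ≤ ρ i x) (hr : ∀ i, 0 ≤ r i) (hsρ : IsSymbol r 0 ρ)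
    (hf : ∀ i, ContDiff ℝ ∞ (f i)) (ξ : MIndex d) (s : ℕ) (h : ι → E d → ℝ) (γ : MIndex d)
    (hs : 1 ≤ s) (hh : IsSymbol r s h) (hP : ∀ i, VanishOff (P i) (h i))
    (hle : s + order γ + order ξ ≤ m) :
    ∃ g : ι → E d → F, IsErr m r ρ f P (s + order γ + order ξ) g ∧
      ∀ i, mderiv ξ ((ρ i ^ (2 * m - s) * h i) • mderiv γ (f i)) = ρ i ^ m • g i := by
  induction ξ using mindex_induction generalizing s h γ with
  | h0 =>
    rw [order_zero, add_zero] at hle ⊢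
    refine ⟨_, isErr_smul_mderiv hρ hr hsρ hf hs hh hP γ, fun i => ?_⟩
    rw [mderiv_zero, show 2 * m - s = m + (m - s) by omega, pow_add, mul_assoc, smul_smul]
  | hs ξ j ih =>
    rw [order_add_single] at hle
    obtain ⟨q, hq⟩ : ∃ q, 2 * m - s = q + 1 := ⟨2 * m - s - 1, by omega⟩
    have hb : IsSymbol r (s + 1) fun i =>
        (fun _ => (q : ℝ) + 1) * (pderiv j (ρ i) * h i) + ρ i * pderiv j (h i) := by
      refine IsSymbol.add ?_ ?_
      · have := ((hsρ.pderiv j).mul hr hh).const_mul hr ((q : ℝ) + 1)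
        convert this using 1; ring
      · have := hsρ.mul hr (hh.pderiv j)
        convert this using 1; ring
    obtain ⟨g1, hg1, e1⟩ := ih (s + 1) _ γ (by omega) hb
      (fun i => (((hP i).smul_right _).smul_right _).add (((hP i).pderiv j).smul_right _))
      (by omega)
    obtain ⟨g2, hg2, e2⟩ := ih s h (γ + Pi.single j 1) hs hh hP (by rw [order_add_single]; omega)
    rw [order_add_single] at hg2 ⊢
    refine ⟨fun i => g1 i + g2 i, ?_, fun i => ?_⟩
    · refine IsErr.add ?_ ?_
      · convert hg1 using 1; ring
      · convert hg2 using 1; ring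
    have c0 : ContDiff ℝ ∞ (ρ i ^ (q + 1)) := (hsρ.1 i).pow _
    have c : ContDiff ℝ ∞ (ρ i ^ (q + 1) * h i) := c0.mul (hh.1 i)
    have cg := contDiff_mderiv γ (hf i)
    have e : pderiv j (ρ i ^ (q + 1) * h i) = ρ i ^ q *
        ((fun _ => (q : ℝ) + 1) * (pderiv j (ρ i) * h i) + ρ i * pderiv j (h i)) := by
      rw [pderiv_mul j c0 (hh.1 i), pderiv_pow j (hsρ.1 i)]
      ext y; simp; ring
    have c1 : ContDiff ℝ ∞ (pderiv j (ρ i ^ (q + 1) * h i) • mderiv γ (f i)) :=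
      (contDiff_pderiv j c).smul cg
    have c2 : ContDiff ℝ ∞ ((ρ i ^ (q + 1) * h i) • pderiv j (mderiv γ (f i))) :=
      c.smul (contDiff_pderiv j cg)
    have e1' := e1 i
    have e2' := e2 i
    rw [show 2 * m - (s + 1) = q by omega] at e1'
    rw [hq, mderiv_add_single _ _ (hf i)] at e2'
    rw [hq, mderiv_add_single' _ _ (show ContDiff ℝ ∞ ((ρ i ^ (q + 1) * h i) • mderiv γ (f i)) from
      c.smul cg), pderiv_smul j c cg, mderiv_add _ c1 c2, e2', e, e1', smul_add]

/-- The derivative `∂^ξ (ρ^{2m} f)` is `ρ^m` times the sum of `ρ^m ∂^ξ f` and an error term. -/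
lemma exists_isErr_mderiv_sq (hρ : ∀ i x, 0 ≤ ρ i x) (hr : ∀ i, 0 ≤ r i) (hsρ : IsSymbol r 0 ρ)
    (hP : ∀ i j, VanishOff (P i) (pderiv j (ρ i))) (hf : ∀ i, ContDiff ℝ ∞ (f i)) (ξ : MIndex d)
    (hξ : order ξ ≤ m) :
    ∃ g : ι → E d → F, IsErr m r ρ f P (order ξ) g ∧
      ∀ i, mderiv ξ (ρ i ^ (2 * m) • f i) = ρ i ^ m • (ρ i ^ m • mderiv ξ (f i) + g i) := by
  have key : ∀ ξ γ : MIndex d, order γ + order ξ ≤ m →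
      ∃ g : ι → E d → F, IsErr m r ρ f P (order γ + order ξ) g ∧
      ∀ i, mderiv ξ (ρ i ^ (2 * m) • mderiv γ (f i)) =
        ρ i ^ m • (ρ i ^ m • mderiv (γ + ξ) (f i) + g i) := by
    intro ξ
    induction ξ using mindex_induction with
    | h0 =>
      intro γ _
      refine ⟨_, isErr_zero _, fun i => ?_⟩
      rw [mderiv_zero, two_mul, pow_add, ← smul_smul, add_zero, add_zero]
    | hs ξ j ih =>
      intro γ hle
      rw [order_add_single] at hle
      obtain ⟨q, hq⟩ : ∃ q, 2 * m = q + 1 := ⟨2 * m - 1, by omega⟩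
      obtain ⟨g1, hg1, e1⟩ := exists_isErr_factor (m := m) (P := P) hρ hr hsρ hf ξ 1 _ γ le_rfl
        ((hsρ.pderiv j).const_mul hr ((q : ℝ) + 1)) (fun i => (hP i j).smul_right _) (by omega)
      obtain ⟨g2, hg2, e2⟩ := ih (γ + Pi.single j 1) (by rw [order_add_single]; omega)
      rw [order_add_single] at hg2 ⊢
      refine ⟨fun i => g1 i + g2 i, ?_, fun i => ?_⟩
      · refine IsErr.add ?_ ?_
        · convert hg1 using 1; ring
        · convert hg2 using 1; ring
      have c0 : ContDiff ℝ ∞ (ρ i ^ (2 * m)) := (hsρ.1 i).pow _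
      have cg := contDiff_mderiv γ (hf i)
      have c1 : ContDiff ℝ ∞ (pderiv j (ρ i ^ (2 * m)) • mderiv γ (f i)) :=
        (contDiff_pderiv j c0).smul cg
      have c2 : ContDiff ℝ ∞ (ρ i ^ (2 * m) • pderiv j (mderiv γ (f i))) :=
        c0.smul (contDiff_pderiv j cg)
      have e : pderiv j (ρ i ^ (2 * m)) =
          ρ i ^ (2 * m - 1) * ((fun _ => (q : ℝ) + 1) * pderiv j (ρ i)) := by
        rw [hq, pderiv_pow j (hsρ.1 i)]
        ext y; simp; ring
      have e2' := e2 i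
      rw [mderiv_add_single _ _ (hf i), add_assoc, add_comm (Pi.single j 1) ξ] at e2'
      rw [mderiv_add_single' _ _ (show ContDiff ℝ ∞ (ρ i ^ (2 * m) • mderiv γ (f i)) from
        c0.smul cg), pderiv_smul j c0 cg, mderiv_add _ c1 c2, e2', e, e1 i]
      simp only [smul_add]
      abel
  simpa using key ξ 0 (by simpa using hξ)

end Symbols

/-! ### Sobolev and Hölder inequalities -/

section Sobolev

/-- The Sobolev exponent `p` in `ℝ^D` with `1 / p = 1 / 2 - k / D`. -/
noncomputable def sobExp (D k : ℕ) : ℝ≥0 := Real.toNNReal (1 / (1 / 2 - (k : ℝ) / D))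

/-- The sum of the `L^2` norms of the derivatives of order `k`. -/
noncomputable def gradNorm {d : ℕ} {F : Type*} [NormedAddCommGroup F] [NormedSpace ℝ F] (k : ℕ)
    (f : E d → F) : ℝ≥0∞ :=
  ∑ γ ∈ indicesEQ d k, eLpNorm (mderiv γ f) 2 volume

lemma sobExp_inv {D k : ℕ} (h : (k : ℝ) < D / 2) :
    ((sobExp D k : ℝ≥0) : ℝ)⁻¹ = 1 / 2 - (k : ℝ) / D := by
  have hk : (0 : ℝ) ≤ k := Nat.cast_nonneg k
  have hD : (0 : ℝ) < D := by linarith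
  have : (0 : ℝ) < 1 / 2 - (k : ℝ) / D := by
    rw [sub_pos, div_lt_iff₀ hD]; linarith
  rw [sobExp, Real.coe_toNNReal _ (by positivity)]
  simp

lemma sobExp_pos {D k : ℕ} (h : (k : ℝ) < D / 2) : 2 ≤ sobExp D k := by
  have hk : (0 : ℝ) ≤ k := Nat.cast_nonneg k
  have hD : (0 : ℝ) < D := by linarith
  have h1 : (0 : ℝ) < 1 / 2 - (k : ℝ) / D := by
    rw [sub_pos, div_lt_iff₀ hD]; linarith
  have h2 : 1 / 2 - (k : ℝ) / D ≤ 1 / 2 := by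
    have : 0 ≤ (k : ℝ) / D := by positivity
    linarith
  rw [sobExp, ← NNReal.coe_le_coe, Real.coe_toNNReal _ (by positivity), le_div_iff₀ h1]
  push_cast
  linarith

lemma sobExp_zero (D : ℕ) : sobExp D 0 = 2 := by
  simp [sobExp]

lemma sobExp_inv_ennreal {D k : ℕ} (h : (k : ℝ) < D / 2) :
    ((sobExp D k : ℝ≥0) : ℝ≥0∞)⁻¹ = ENNReal.ofReal (1 / 2 - (k : ℝ) / D) := by
  have h2 := sobExp_pos h
  have h0 : sobExp D k ≠ 0 := (lt_of_lt_of_le (by norm_num) h2).ne'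
  rw [← ENNReal.coe_inv h0, ← sobExp_inv h, ← NNReal.coe_inv, ENNReal.ofReal_coe_nnreal]

lemma critExp_eq {d m k : ℕ} (hk : k ≤ m) : critExp d m k = (sobExp d (m - k) : ℝ≥0∞) := by
  rw [critExp, sobExp, Nat.cast_sub hk]; rfl

variable {d : ℕ} {F : Type*} [NormedAddCommGroup F] [NormedSpace ℝ F]

lemma eLpNorm_fderiv_le_sum {f : E d → F} (hf : ContDiff ℝ ∞ f) {p : ℝ≥0∞} (hp : 1 ≤ p)
    (μ : Measure (E d)) :
    eLpNorm (fderiv ℝ f) p μ ≤ ∑ i, eLpNorm (pderiv i f) p μ := by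
  have h1 : eLpNorm (fderiv ℝ f) p μ ≤ eLpNorm (∑ i, fun x => ‖pderiv i f x‖) p μ := by
    refine eLpNorm_mono_real fun x => ?_
    rw [Finset.sum_apply]
    exact norm_fderiv_le_sum f x
  refine h1.trans ((eLpNorm_sum_le (fun i _ => ?_) hp).trans (le_of_eq ?_))
  · exact (contDiff_pderiv i hf).continuous.norm.aestronglyMeasurable
  · exact Finset.sum_congr rfl fun i _ => eLpNorm_norm _

lemma gradNorm_pderiv_le {f : E d → F} (hf : ContDiff ℝ ∞ f) (k : ℕ) (i : Fin d) :
    gradNorm k (pderiv i f) ≤ gradNorm (k + 1) f := by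
  unfold gradNorm
  have : ∀ γ : MIndex d, eLpNorm (mderiv γ (pderiv i f)) 2 volume =
      eLpNorm (mderiv (γ + Pi.single i 1) f) 2 volume := fun γ => by
    rw [mderiv_add_single' _ _ hf]
  simp only [this]
  rw [← Finset.sum_image (f := fun γ => eLpNorm (mderiv γ f) 2 volume) (s := indicesEQ d k)
    (g := fun γ => γ + Pi.single i 1) (fun a _ b _ h => add_right_cancel h)]
  refine Finset.sum_le_sum_of_subset fun γ hγ => ?_
  obtain ⟨γ', h1, rfl⟩ := Finset.mem_image.1 hγ
  rw [mem_indicesEQ] at h1 ⊢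
  rw [order_add_single, h1]

lemma gradNorm_mderiv_le {f : E d → F} (hf : ContDiff ℝ ∞ f) (k : ℕ) (α : MIndex d) :
    gradNorm k (mderiv α f) ≤ gradNorm (k + order α) f := by
  induction α using mindex_induction generalizing k with
  | h0 => simp
  | hs α i ih =>
    rw [mderiv_add_single _ _ hf, order_add_single]
    refine (gradNorm_pderiv_le (contDiff_mderiv α hf) k i).trans ((ih (k + 1)).trans (le_of_eq ?_))
    congr 1; ring

/-- The Sobolev inequality for `k` derivatives in `L^2`, by iteration of the
Gagliardo–Nirenberg–Sobolev inequality. -/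
lemma exists_sobolev [FiniteDimensional ℝ F] (k : ℕ) (hk : (k : ℝ) < d / 2) :
    ∃ C : ℝ≥0, ∀ f : E d → F, ContDiff ℝ ∞ f → HasCompactSupport f →
      eLpNorm f (sobExp d k) volume ≤ C * gradNorm k f := by
  induction k with
  | zero =>
    refine ⟨1, fun f _ _ => ?_⟩
    have : indicesEQ d 0 = {0} := by
      ext γ; rw [mem_indicesEQ, order_eq_zero, Finset.mem_singleton]
    simp [gradNorm, this, sobExp_zero]
  | succ k ih =>
    push_cast at hk
    have hk' : (k : ℝ) < d / 2 := by linarith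
    obtain ⟨C, hC⟩ := ih hk'
    have hd : (0 : ℝ) < d := by have : (0 : ℝ) ≤ k := Nat.cast_nonneg k; linarith
    refine ⟨SNormLESNormFDerivOfEqConst F (volume : Measure (E d)) (sobExp d k) * (d * C),
      fun f hf hc => ?_⟩
    have h1 : (1 : ℝ≥0) ≤ sobExp d k := le_trans (by norm_num) (sobExp_pos hk')
    have h2 := eLpNorm_le_eLpNorm_fderiv_of_eq (F := F) (volume : Measure (E d))
      (hf.of_le (by exact_mod_cast le_top)) hc (p := sobExp d k) (p' := sobExp d (k + 1)) h1
      (by simp; exact_mod_cast hd)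
      (by
        have e1 := sobExp_inv (D := d) (k := k + 1) (by push_cast; linarith)
        have e2 := sobExp_inv hk'
        rw [e1, NNReal.coe_inv, e2]
        simp; ring)
    refine h2.trans ?_
    push_cast
    rw [mul_assoc]
    gcongr
    refine (eLpNorm_fderiv_le_sum hf (by exact_mod_cast h1) _).trans ?_
    calc ∑ i, eLpNorm (pderiv i f) (sobExp d k) volume
        ≤ ∑ _i : Fin d, C * gradNorm (k + 1) f := by
          refine Finset.sum_le_sum fun i _ => ?_
          refine (hC _ (contDiff_pderiv i hf) (hasCompactSupport_pderiv i hc)).trans ?_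
          gcongr
          exact gradNorm_pderiv_le hf k i
      _ = _ := by simp [mul_assoc]

/-- Hölder's inequality for three factors. -/
lemma lintegral_mul_mul_le {X F₁ F₂ F₃ : Type*} [MeasurableSpace X] {μ : Measure X}
    [NormedAddCommGroup F₁] [NormedAddCommGroup F₂] [NormedAddCommGroup F₃]
    {f : X → F₁} {a : X → F₂} {g : X → F₃} (hf : AEStronglyMeasurable f μ)
    (ha : AEStronglyMeasurable a μ) (hg : AEStronglyMeasurable g μ) {p q p' : ℝ≥0∞}
    (h : p⁻¹ + q⁻¹ + p'⁻¹ = 1) :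
    ∫⁻ x, ‖f x‖ₑ * ‖a x‖ₑ * ‖g x‖ₑ ∂μ ≤ eLpNorm f p μ * eLpNorm a q μ * eLpNorm g p' μ := by
  have i1 : ENNReal.HolderTriple p q (p⁻¹ + q⁻¹)⁻¹ := ⟨by rw [inv_inv]⟩
  have i2 : ENNReal.HolderTriple (p⁻¹ + q⁻¹)⁻¹ p' 1 := ⟨by rw [inv_inv, h, inv_one]⟩
  have h1 := eLpNorm_le_eLpNorm_mul_eLpNorm_of_nnnorm (p := p) (q := q) (r := (p⁻¹ + q⁻¹)⁻¹)
    hf.norm ha.norm (fun a b : ℝ => a * b) 1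
    (Filter.Eventually.of_forall fun x => by simp)
  have h2 := eLpNorm_le_eLpNorm_mul_eLpNorm_of_nnnorm (p := (p⁻¹ + q⁻¹)⁻¹) (q := p') (r := 1)
    (hf.norm.mul ha.norm) hg.norm (fun a b : ℝ => a * b) 1
    (Filter.Eventually.of_forall fun x => by simp)
  simp only [ENNReal.coe_one, one_mul, eLpNorm_norm] at h1 h2
  rw [eLpNorm_one_eq_lintegral_enorm] at h2
  calc ∫⁻ x, ‖f x‖ₑ * ‖a x‖ₑ * ‖g x‖ₑ ∂μ
      = ∫⁻ x, ‖(‖f x‖ * ‖a x‖) * ‖g x‖‖ₑ ∂μ := by simp [enorm_mul]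
    _ ≤ _ := h2
    _ ≤ _ := by gcongr; exact h1

/-- The Sobolev exponents of `m - |α|` and `m - |β|` derivatives and the exponent of `A_{αβ}` are
Hölder conjugate. The dimension `D` in the exponents may differ from that of the multiindices: it is
`d` for the Lebesgue bound and `d - 1` for the Bochner bound. -/
lemma holder_exponents {d D m : ℕ} {α β : MIndex d} (hD : 1 ≤ D) (hα : order α ≤ m)
    (hβ : order β ≤ m) (hα' : (m : ℝ) - D / 2 < order α) (hβ' : (m : ℝ) - D / 2 < order β) :
    ((sobExp D (m - order α) : ℝ≥0) : ℝ≥0∞)⁻¹ + (coeffExp D m α β)⁻¹ +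
      ((sobExp D (m - order β) : ℝ≥0) : ℝ≥0∞)⁻¹ = 1 := by
  have hD' : (0 : ℝ) < D := by exact_mod_cast hD
  have c1 : ((m - order α : ℕ) : ℝ) = m - order α := Nat.cast_sub hα
  have c2 : ((m - order β : ℕ) : ℝ) = m - order β := Nat.cast_sub hβ
  have l1 : ((m - order α : ℕ) : ℝ) < D / 2 := by rw [c1]; linarith
  have l2 : ((m - order β : ℕ) : ℝ) < D / 2 := by rw [c2]; linarith
  have e3 : (coeffExp D m α β)⁻¹ = ENNReal.ofReal
      (((m - order α : ℕ) : ℝ) / D + ((m - order β : ℕ) : ℝ) / D) := by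
    rw [coeffExp, ENNReal.inv_div (Or.inl (ENNReal.natCast_ne_top _))
        (Or.inr (by exact_mod_cast (by omega))),
      ← add_div, ENNReal.ofReal_div_of_pos hD', ← Nat.cast_add, ENNReal.ofReal_natCast,
      ENNReal.ofReal_natCast, show 2 * m - order α - order β = m - order α + (m - order β) by omega]
  have p1 : 0 ≤ 1 / 2 - ((m - order α : ℕ) : ℝ) / D := by
    rw [sub_nonneg, div_le_iff₀ hD']; linarith
  have p2 : 0 ≤ 1 / 2 - ((m - order β : ℕ) : ℝ) / D := by
    rw [sub_nonneg, div_le_iff₀ hD']; linarith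
  rw [sobExp_inv_ennreal l1, sobExp_inv_ennreal l2, e3, ← ENNReal.ofReal_add p1 (by positivity),
    ← ENNReal.ofReal_add (by positivity) p2]
  simp only [ENNReal.ofReal_eq_one]
  ring

end Sobolev

/-! ### Restriction to hyperplanes -/

section Slices

variable {n : ℕ} {F : Type*} [NormedAddCommGroup F]

/-- The restriction of `f` to the hyperplane where the last coordinate is `t`. -/
def slice {n : ℕ} {F : Type*} (f : E (n + 1) → F) (t : ℝ) (x : E n) : F :=
  f (Fin.insertNth (α := fun _ => ℝ) (Fin.last n) t x)

lemma hasCompactSupport_slice {f : E (n + 1) → F} (hf : HasCompactSupport f) (t : ℝ) :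
    HasCompactSupport (slice f t) := by
  obtain ⟨r, hr⟩ := hf.isCompact.isBounded.subset_closedBall 0
  refine HasCompactSupport.of_support_subset_isCompact (isCompact_closedBall (0 : E n) r)
    fun x hx => ?_
  have h1 := hr (subset_tsupport f hx)
  rw [mem_closedBall_zero_iff] at h1 ⊢
  rw [pi_norm_le_iff_of_nonneg ((norm_nonneg _).trans h1)]
  intro i
  have h2 := norm_le_pi_norm (Fin.insertNth (α := fun _ => ℝ) (Fin.last n) t x : E (n + 1))
    (Fin.castSucc i)
  simp only [Fin.insertNth_last', Fin.snoc_castSucc] at h2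
  refine h2.trans ?_
  simpa using h1

lemma volume_preserving_slice :
    MeasurePreserving (fun z : ℝ × E n =>
      (Fin.insertNth (α := fun _ => ℝ) (Fin.last n) z.1 z.2 : E (n + 1)))
      (volume.prod volume) volume := by
  have := (volume_preserving_piFinSuccAbove (fun _ : Fin (n + 1) => ℝ) (Fin.last n)).symm
  exact this

lemma lintegral_eq_slice {G : E (n + 1) → ℝ≥0∞} (hG : AEMeasurable G volume) :
    ∫⁻ z, G z = ∫⁻ t, ∫⁻ x, slice G t x := by
  rw [← volume_preserving_slice.lintegral_comp_emb ?_ G, lintegral_prod]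
  · rfl
  · exact hG.comp_quasiMeasurePreserving volume_preserving_slice.quasiMeasurePreserving
  · exact (MeasurableEquiv.piFinSuccAbove (fun _ : Fin (n + 1) => ℝ)
      (Fin.last n)).symm.measurableEmbedding

lemma aestronglyMeasurable_slice {F : Type*} [TopologicalSpace F] {G : E (n + 1) → F}
    (hG : AEStronglyMeasurable G volume) :
    ∀ᵐ t, AEStronglyMeasurable (slice G t) (volume : Measure (E n)) :=
  (hG.comp_measurePreserving volume_preserving_slice).prodMk_left

lemma eLpNorm_two_eq {X F : Type*} [MeasurableSpace X] [NormedAddCommGroup F] (μ : Measure X)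
    (f : X → F) : eLpNorm f 2 μ = (∫⁻ x, ‖f x‖ₑ ^ (2 : ℝ) ∂μ) ^ (1 / (2 : ℝ)) := by
  rw [eLpNorm_eq_lintegral_rpow_enorm_toReal (by norm_num) (by norm_num)]; simp

lemma measurable_eLpNorm_slice {h : E (n + 1) → F} (hh : Continuous h) :
    Measurable fun t => eLpNorm (slice h t) 2 volume := by
  have m0 : Measurable fun z : ℝ × E n => ‖slice h z.1 z.2‖ₑ ^ (2 : ℝ) :=
    Measurable.pow_const (hh.enorm.measurable.comp volume_preserving_slice.measurable) _
  have m1 : Measurable fun t => ∫⁻ x, ‖slice h t x‖ₑ ^ (2 : ℝ) := m0.lintegral_prod_right'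
  simp only [eLpNorm_two_eq]
  exact m1.pow_const _

lemma lintegral_eLpNorm_slice {h : E (n + 1) → F} (hh : Continuous h) :
    (∫⁻ t, eLpNorm (slice h t) 2 volume ^ (2 : ℝ)) ^ (1 / (2 : ℝ)) = eLpNorm h 2 volume := by
  simp only [eLpNorm_two_eq]
  congr 1
  rw [lintegral_eq_slice (by exact (hh.enorm.measurable.pow_const _).aemeasurable)]
  refine lintegral_congr fun t => ?_
  rw [← ENNReal.rpow_mul]
  simp only [one_div, ne_eq, OfNat.ofNat_ne_zero, not_false_eq_true, inv_mul_cancel₀,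
    ENNReal.rpow_one]
  rfl

/-- The Cauchy–Schwarz inequality in the last variable, for the `L^2` norms over slices. -/
lemma lintegral_slice_mul_le {f g : E (n + 1) → F} (hf : Continuous f) (hg : Continuous g) :
    ∫⁻ t, eLpNorm (slice f t) 2 volume * eLpNorm (slice g t) 2 volume ≤
      eLpNorm f 2 volume * eLpNorm g 2 volume := by
  have := ENNReal.lintegral_mul_le_Lp_mul_Lq volume Real.HolderConjugate.two_two
    (measurable_eLpNorm_slice hf).aemeasurable (measurable_eLpNorm_slice hg).aemeasurable
  rwa [lintegral_eLpNorm_slice hf, lintegral_eLpNorm_slice hg] at this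

variable [NormedSpace ℝ F]

/-- The linear part of the parametrization of the hyperplane where the last coordinate is `t`. -/
noncomputable def sliceLin (n : ℕ) : E n →L[ℝ] E (n + 1) :=
  ∑ i, (ContinuousLinearMap.proj i : E n →L[ℝ] ℝ).smulRight
    (Pi.single (Fin.castSucc i) 1 : E (n + 1))

lemma sliceLin_single (i : Fin n) :
    sliceLin n (Pi.single i 1) = Pi.single (Fin.castSucc i) 1 := by
  simp [sliceLin, Pi.single_apply]

lemma slice_map_eq (t : ℝ) (x : E n) :
    (Fin.insertNth (α := fun _ => ℝ) (Fin.last n) t x : E (n + 1)) =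
      sliceLin n x + (Fin.insertNth (α := fun _ => ℝ) (Fin.last n) t 0 : E (n + 1)) := by
  ext j
  refine Fin.lastCases ?_ (fun j => ?_) j
  · simp [sliceLin, Finset.sum_apply]
  · simp [sliceLin, Finset.sum_apply, Pi.single_apply]

lemma hasFDerivAt_slice_map (t : ℝ) (x : E n) :
    HasFDerivAt (fun x : E n => (Fin.insertNth (α := fun _ => ℝ) (Fin.last n) t x : E (n + 1)))
      (sliceLin n) x := by
  have : (fun x : E n => (Fin.insertNth (α := fun _ => ℝ) (Fin.last n) t x : E (n + 1))) =
      fun x => sliceLin n x + (Fin.insertNth (α := fun _ => ℝ) (Fin.last n) t 0 : E (n + 1)) :=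
    funext fun x => slice_map_eq t x
  rw [this]
  exact (sliceLin n).hasFDerivAt.add_const _

lemma contDiff_slice {f : E (n + 1) → F} (hf : ContDiff ℝ ∞ f) (t : ℝ) :
    ContDiff ℝ ∞ (slice f t) := by
  have : slice f t = fun x => f (sliceLin n x +
      (Fin.insertNth (α := fun _ => ℝ) (Fin.last n) t 0 : E (n + 1))) :=
    funext fun x => by rw [← slice_map_eq]; rfl
  rw [this]
  exact hf.comp ((sliceLin n).contDiff.add contDiff_const)

lemma pderiv_slice {f : E (n + 1) → F} (hf : ContDiff ℝ ∞ f) (t : ℝ) (i : Fin n) :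
    pderiv i (slice f t) = slice (pderiv (Fin.castSucc i) f) t := by
  ext x
  have h := (smooth_differentiableAt hf
    (Fin.insertNth (α := fun _ => ℝ) (Fin.last n) t x)).hasFDerivAt.comp x
    (hasFDerivAt_slice_map t x)
  have e : fderiv ℝ (slice f t) x = _ := h.fderiv
  rw [pderiv, e, ContinuousLinearMap.comp_apply, sliceLin_single]
  rfl

/-- Derivatives of a slice are slices of a derivative of the same order, so the Sobolev inequality
in the hyperplanes involves only derivatives of `f` itself. -/
lemma exists_mderiv_slice {f : E (n + 1) → F} (hf : ContDiff ℝ ∞ f) (γ : MIndex n) :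
    ∃ γ' : MIndex (n + 1), order γ' = order γ ∧
      ∀ t, mderiv γ (slice f t) = slice (mderiv γ' f) t := by
  induction γ using mindex_induction with
  | h0 => exact ⟨0, by simp, fun t => by simp⟩
  | hs γ i ih =>
    obtain ⟨γ', h1, h2⟩ := ih
    refine ⟨γ' + Pi.single (Fin.castSucc i) 1, by simp [order_add_single, h1], fun t => ?_⟩
    rw [mderiv_add_single _ _ (contDiff_slice hf t), h2, mderiv_add_single _ _ hf,
      pderiv_slice (contDiff_mderiv γ' hf)]

end Slices

/-! ### Boundedness of the form -/

section FormBound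

variable {F : Type*} [NormedAddCommGroup F] [NormedSpace ℝ F] [FiniteDimensional ℝ F] {N : ℕ}

/-- The Sobolev inequality with one constant for all numbers `k ≤ m` of derivatives. -/
lemma exists_sobolev_uniform (F : Type*) [NormedAddCommGroup F] [NormedSpace ℝ F]
    [FiniteDimensional ℝ F] (d m : ℕ) :
    ∃ C : ℝ≥0, ∀ k ≤ m, (k : ℝ) < d / 2 → ∀ f : E d → F, ContDiff ℝ ∞ f → HasCompactSupport f →
      eLpNorm f (sobExp d k) volume ≤ C * gradNorm k f := by
  have : ∀ k : ℕ, ∃ C : ℝ≥0, (k : ℝ) < d / 2 → ∀ f : E d → F, ContDiff ℝ ∞ f →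
      HasCompactSupport f → eLpNorm f (sobExp d k) volume ≤ C * gradNorm k f := fun k => by
    by_cases hk : (k : ℝ) < d / 2
    · obtain ⟨C, hC⟩ := exists_sobolev (F := F) k hk
      exact ⟨C, fun _ => hC⟩
    · exact ⟨0, fun h => absurd h hk⟩
  choose C hC using this
  refine ⟨∑ k ∈ Finset.range (m + 1), C k, fun k hk hkd f hf hc => (hC k hkd f hf hc).trans ?_⟩
  gcongr
  exact Finset.single_le_sum (fun _ _ => zero_le) (Finset.mem_range.2 (by omega))

/-- The form bound under the Lebesgue condition: Hölder's inequality and the Sobolev inequality in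
the whole space. -/
lemma exists_lebesgue_bound (d m : ℕ) (hd : 1 ≤ d) (Lam : ℝ) :
    ∃ C : ℝ≥0, ∀ A : Coeff d N,
      (∀ j k, ∀ α ∈ indicesLE d m, ∀ β ∈ indicesLE d m, AEMeasurable (A j k α β) volume) →
      LebesgueBound m A Lam → ∀ j k, ∀ α ∈ indicesLE d m, ∀ β ∈ indicesLE d m,
      ∀ f g : E d → F, ContDiff ℝ ∞ f → HasCompactSupport f → ContDiff ℝ ∞ g →
      HasCompactSupport g → ∫⁻ x, ‖f x‖ₑ * ‖A j k α β x‖ₑ * ‖g x‖ₑ ≤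
        C * (gradNorm (m - order α) f * gradNorm (m - order β) g) := by
  obtain ⟨C, hC⟩ := exists_sobolev_uniform F d m
  refine ⟨C * Lam.toNNReal * C, fun A hA hB j k α hα β hβ f g hf hfc hg hgc => ?_⟩
  have hb := hB j k α hα β hβ
  have ma := hA j k α hα β hβ
  rw [mem_indicesLE] at hα hβ
  split_ifs at hb with hc
  · have l1 : ((m - order α : ℕ) : ℝ) < d / 2 := by rw [Nat.cast_sub hα]; linarith
    have l2 : ((m - order β : ℕ) : ℝ) < d / 2 := by rw [Nat.cast_sub hβ]; linarith
    have := lintegral_mul_mul_le (μ := volume) hf.continuous.aestronglyMeasurable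
      ma.aestronglyMeasurable hg.continuous.aestronglyMeasurable
      (holder_exponents hd hα hβ hc.1 hc.2)
    refine this.trans ?_
    calc _ ≤ (C * gradNorm (m - order α) f) * ENNReal.ofReal Lam *
          (C * gradNorm (m - order β) g) := by
          gcongr
          · exact hC _ (Nat.sub_le _ _) l1 f hf hfc
          · exact hC _ (Nat.sub_le _ _) l2 g hg hgc
      _ = _ := by rw [ENNReal.ofReal]; push_cast; ring
  · have : ∫⁻ x, ‖f x‖ₑ * ‖A j k α β x‖ₑ * ‖g x‖ₑ = ∫⁻ _x : E d, 0 := by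
      refine lintegral_congr_ae ?_
      filter_upwards [hb] with x hx
      simp [hx]
    rw [this]; simp

/-- The form bound under the Bochner condition: Hölder's inequality and the Sobolev inequality in
each hyperplane `t = const`, then the Cauchy–Schwarz inequality in `t`. -/
lemma exists_bochner_bound (n m : ℕ) (hn : 1 ≤ n) (Lam : ℝ) :
    ∃ C : ℝ≥0, ∀ A : Coeff (n + 1) N,
      (∀ j k, ∀ α ∈ indicesLE (n + 1) m, ∀ β ∈ indicesLE (n + 1) m,
        AEMeasurable (A j k α β) volume) →
      BochnerBound m A Lam → ∀ j k, ∀ α ∈ indicesLE (n + 1) m, ∀ β ∈ indicesLE (n + 1) m,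
      ∀ f g : E (n + 1) → F, ContDiff ℝ ∞ f → HasCompactSupport f → ContDiff ℝ ∞ g →
      HasCompactSupport g → ∫⁻ x, ‖f x‖ₑ * ‖A j k α β x‖ₑ * ‖g x‖ₑ ≤
        C * (gradNorm (m - order α) f * gradNorm (m - order β) g) := by
  obtain ⟨C, hC⟩ := exists_sobolev_uniform F n m
  set K : ℝ≥0 := ∑ k ∈ Finset.range (m + 1), ((indicesEQ n k).card : ℝ≥0) with hK
  have hKle : ∀ k ≤ m, ((indicesEQ n k).card : ℝ≥0∞) ≤ K := fun k hk => by
    have : ((indicesEQ n k).card : ℝ≥0) ≤ K :=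
      Finset.single_le_sum (f := fun k => ((indicesEQ n k).card : ℝ≥0)) (fun _ _ => zero_le)
        (Finset.mem_range.2 (by omega))
    exact_mod_cast this
  refine ⟨C * Lam.toNNReal * C * (K * K), fun A hA hB j k α hα β hβ f g hf hfc hg hgc => ?_⟩
  have hb := hB j k α hα β hβ
  have ma := hA j k α hα β hβ
  rw [mem_indicesLE] at hα hβ
  split_ifs at hb with hc
  · have l1 : ((m - order α : ℕ) : ℝ) < n / 2 := by rw [Nat.cast_sub hα]; linarith
    have l2 : ((m - order β : ℕ) : ℝ) < n / 2 := by rw [Nat.cast_sub hβ]; linarith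
    have hme : AEMeasurable (fun x => ‖f x‖ₑ * ‖A j k α β x‖ₑ * ‖g x‖ₑ) volume :=
      (hf.continuous.enorm.measurable.aemeasurable.mul ma.enorm).mul
        hg.continuous.enorm.measurable.aemeasurable
    have hfib : ∀ᵐ t : ℝ, ∫⁻ x, slice (fun x => ‖f x‖ₑ * ‖A j k α β x‖ₑ * ‖g x‖ₑ) t x ≤
        (C * Lam.toNNReal * C : ℝ≥0) *
          (gradNorm (m - order α) (slice f t) * gradNorm (m - order β) (slice g t)) := by
      filter_upwards [hb, aestronglyMeasurable_slice ma.aestronglyMeasurable] with t ht mt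
      have := lintegral_mul_mul_le (μ := volume)
        (contDiff_slice hf t).continuous.aestronglyMeasurable mt
        (contDiff_slice hg t).continuous.aestronglyMeasurable
        (p := sobExp n (m - order α)) (q := coeffExp n m α β) (p' := sobExp n (m - order β)) ?_
      · refine this.trans ?_
        calc _ ≤ (C * gradNorm (m - order α) (slice f t)) * ENNReal.ofReal Lam *
              (C * gradNorm (m - order β) (slice g t)) := by
              gcongr
              · exact hC _ (Nat.sub_le _ _) l1 _ (contDiff_slice hf t)
                  (hasCompactSupport_slice hfc t)
              · exact ht
              · exact hC _ (Nat.sub_le _ _) l2 _ (contDiff_slice hg t)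
                  (hasCompactSupport_slice hgc t)
          _ = _ := by rw [ENNReal.ofReal]; push_cast; ring
      · exact holder_exponents hn hα hβ hc.1 hc.2
    have hterm : ∀ (γ γ' : MIndex n), order γ = m - order α → order γ' = m - order β →
        ∫⁻ t, eLpNorm (mderiv γ (slice f t)) 2 volume * eLpNorm (mderiv γ' (slice g t)) 2 volume ≤
          gradNorm (m - order α) f * gradNorm (m - order β) g := by
      intro γ γ' hγ hγ'
      obtain ⟨ζ, h1, h2⟩ := exists_mderiv_slice hf γ
      obtain ⟨ζ', h1', h2'⟩ := exists_mderiv_slice hg γ'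
      simp only [h2, h2']
      refine (lintegral_slice_mul_le (contDiff_mderiv ζ hf).continuous
        (contDiff_mderiv ζ' hg).continuous).trans ?_
      gcongr
      · exact Finset.single_le_sum (f := fun γ => eLpNorm (mderiv γ f) 2 volume)
          (fun _ _ => zero_le) (mem_indicesEQ.2 (h1.trans hγ))
      · exact Finset.single_le_sum (f := fun γ => eLpNorm (mderiv γ g) 2 volume)
          (fun _ _ => zero_le) (mem_indicesEQ.2 (h1'.trans hγ'))
    rw [lintegral_eq_slice hme]
    refine (lintegral_mono_ae hfib).trans ?_
    rw [lintegral_const_mul' _ _ ENNReal.coe_ne_top]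
    push_cast
    simp only [mul_assoc]
    gcongr
    unfold gradNorm
    simp only [Finset.sum_mul_sum]
    have hm : ∀ γ γ' : MIndex n, Measurable fun t =>
        eLpNorm (mderiv γ (slice f t)) 2 volume * eLpNorm (mderiv γ' (slice g t)) 2 volume := by
      intro γ γ'
      obtain ⟨ζ, -, h2⟩ := exists_mderiv_slice hf γ
      obtain ⟨ζ', -, h2'⟩ := exists_mderiv_slice hg γ'
      simp only [h2, h2']
      exact (measurable_eLpNorm_slice (contDiff_mderiv ζ hf).continuous).mul
        (measurable_eLpNorm_slice (contDiff_mderiv ζ' hg).continuous)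
    rw [lintegral_finsetSum _ fun γ _ => Finset.measurable_sum _ fun γ' _ => hm γ γ']
    have hm' : ∀ γ : MIndex n, ∫⁻ t, ∑ γ' ∈ indicesEQ n (m - order β),
        eLpNorm (mderiv γ (slice f t)) 2 volume * eLpNorm (mderiv γ' (slice g t)) 2 volume =
        ∑ γ' ∈ indicesEQ n (m - order β), ∫⁻ t,
          eLpNorm (mderiv γ (slice f t)) 2 volume * eLpNorm (mderiv γ' (slice g t)) 2 volume :=
      fun γ => lintegral_finsetSum _ fun γ' _ => hm γ γ'
    simp only [hm']
    calc _ ≤ ∑ γ ∈ indicesEQ n (m - order α), ∑ γ' ∈ indicesEQ n (m - order β),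
          gradNorm (m - order α) f * gradNorm (m - order β) g :=
          Finset.sum_le_sum fun γ hγ => Finset.sum_le_sum fun γ' hγ' =>
            hterm γ γ' (mem_indicesEQ.1 hγ) (mem_indicesEQ.1 hγ')
      _ = ((indicesEQ n (m - order α)).card : ℝ≥0∞) * (((indicesEQ n (m - order β)).card : ℝ≥0∞) *
          (gradNorm (m - order α) f * gradNorm (m - order β) g)) := by
          simp [Finset.sum_const, nsmul_eq_mul]
      _ ≤ K * (K * (gradNorm (m - order α) f * gradNorm (m - order β) g)) := by
          gcongr
          · exact hKle _ (Nat.sub_le _ _)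
          · exact hKle _ (Nat.sub_le _ _)
      _ = _ := by simp only [gradNorm, Finset.sum_mul_sum]
  · have : ∫⁻ x, ‖f x‖ₑ * ‖A j k α β x‖ₑ * ‖g x‖ₑ = ∫⁻ _x : E (n + 1), 0 := by
      refine lintegral_congr_ae ?_
      filter_upwards [hb] with x hx
      simp [hx]
    rw [this]; simp

/-- The bound for the sesquilinear form that the coefficients define, under either of the two
conditions on the coefficients: a product of `f`, `g` and a coefficient `A_{αβ}` is integrable, with
`L^2` norms of `m - |α|` derivatives of `f` and `m - |β|` derivatives of `g` on the right. -/
lemma exists_form_bound (F : Type*) [NormedAddCommGroup F] [NormedSpace ℝ F]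
    [FiniteDimensional ℝ F] (n m N : ℕ) (hn : 1 ≤ n) (Lam : ℝ) :
    ∃ C : ℝ≥0, ∀ A : Coeff (n + 1) N,
      (∀ j k, ∀ α ∈ indicesLE (n + 1) m, ∀ β ∈ indicesLE (n + 1) m,
        AEMeasurable (A j k α β) volume) →
      (LebesgueBound m A Lam ∨ BochnerBound m A Lam) → ∀ j k, ∀ α ∈ indicesLE (n + 1) m,
      ∀ β ∈ indicesLE (n + 1) m, ∀ f g : E (n + 1) → F, ContDiff ℝ ∞ f → HasCompactSupport f →
      ContDiff ℝ ∞ g → HasCompactSupport g → ∫⁻ x, ‖f x‖ₑ * ‖A j k α β x‖ₑ * ‖g x‖ₑ ≤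
        C * (gradNorm (m - order α) f * gradNorm (m - order β) g) := by
  obtain ⟨C, hC⟩ := exists_lebesgue_bound (F := F) (N := N) (n + 1) m (by omega) Lam
  obtain ⟨D, hD⟩ := exists_bochner_bound (F := F) (N := N) n m hn Lam
  refine ⟨C + D, fun A hA hB j k α hα β hβ f g hf hfc hg hgc => ?_⟩
  push_cast
  rw [add_mul]
  rcases hB with hB | hB
  · exact (hC A hA hB j k α hα β hβ f g hf hfc hg hgc).trans le_self_add
  · exact (hD A hA hB j k α hα β hβ f g hf hfc hg hgc).trans le_add_self

end FormBound

/-! ### Weighted interpolation of intermediate derivatives -/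

section Interpolation

variable {d : ℕ} {F : Type*} [NormedAddCommGroup F]

/-- For a jet `w` (a function `w γ` for each multiindex, to be thought of as `∂^γ u`), the scaled
and weighted integral `r^{2(m - k)} ∫_S ρ^{2k} |∇^k u|^2`. -/
noncomputable def wInt (m : ℕ) (r : ℝ) (ρ : E d → ℝ) (S : Set (E d)) (w : MIndex d → E d → F)
    (k : ℕ) : ℝ :=
  ∑ γ ∈ indicesEQ d k, r ^ (2 * (m - k)) * ∫ x in S, ρ x ^ (2 * k) * ‖w γ x‖ ^ 2

lemma wInt_nonneg (m : ℕ) {r : ℝ} (hr : 0 ≤ r) (ρ : E d → ℝ) (S : Set (E d))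
    (w : MIndex d → E d → F) (k : ℕ) : 0 ≤ wInt m r ρ S w k := by
  refine Finset.sum_nonneg fun γ _ => mul_nonneg (by positivity) (integral_nonneg fun x => ?_)
  have : 0 ≤ ρ x ^ (2 * k) := by rw [pow_mul]; positivity
  positivity

variable [NormedSpace ℝ F]

lemma fderiv_bilin (B : F →L[ℝ] F →L[ℝ] ℝ) {v w : E d → F} (hv : ContDiff ℝ ∞ v)
    (hw : ContDiff ℝ ∞ w) :
    ContDiff ℝ ∞ (fun x => B (v x) (w x)) ∧ ∀ i x, pderiv i (fun x => B (v x) (w x)) x =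
      B (pderiv i v x) (w x) + B (v x) (pderiv i w x) := by
  refine ⟨B.isBoundedBilinearMap.contDiff.comp (hv.prodMk hw), fun i x => ?_⟩
  have h1 : HasFDerivAt (fun x => B (v x)) (B ∘L fderiv ℝ v x) x :=
    B.hasFDerivAt.comp x (smooth_differentiableAt hv x).hasFDerivAt
  have h2 := h1.clm_apply (smooth_differentiableAt hw x).hasFDerivAt
  rw [pderiv, h2.fderiv]
  simp [pderiv, add_comm]

/-- One step of the weighted interpolation: integrate `∂_i (ρ^{2k} ⟨v, ∂_i v⟩)`. The bilinear form
`B` stands for the real inner product. -/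
lemma weighted_step (B : F →L[ℝ] F →L[ℝ] ℝ) (hB : ∀ v, B v v = ‖v‖ ^ 2)
    (hB' : ∀ v w, |B v w| ≤ ‖v‖ * ‖w‖) {r C₀ ε : ℝ} (hr : 0 < r) (hC₀ : 0 ≤ C₀) (hε : 0 < ε)
    {ρ : E d → ℝ} (hρ : ContDiff ℝ ∞ ρ) (hρ0 : ∀ x, 0 ≤ ρ x) {i : Fin d}
    (hρ1 : ∀ x, |pderiv i ρ x| ≤ C₀ * r) {S : Set (E d)} (hS : MeasurableSet S)
    (hρS : ∀ x, x ∉ S → ρ x = 0) {v : E d → F} (hv : ContDiff ℝ ∞ v) (hvc : HasCompactSupport v)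
    (k : ℕ) :
    r ^ 2 * ∫ x in S, ρ x ^ (2 * (k + 1)) * ‖pderiv i v x‖ ^ 2 ≤
      ε * (∫ x in S, ρ x ^ (2 * (k + 2)) * ‖pderiv i (pderiv i v) x‖ ^ 2) +
        (4 * (k + 1) ^ 2 * C₀ ^ 2 + ε⁻¹) * (r ^ 4 * ∫ x in S, ρ x ^ (2 * k) * ‖v x‖ ^ 2) := by
  have hv1 := contDiff_pderiv i hv
  have hv2 := contDiff_pderiv i hv1
  have hv1c := hasCompactSupport_pderiv i hvc
  have hv2c := hasCompactSupport_pderiv i hv1c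
  obtain ⟨hb1, hb2⟩ := fderiv_bilin B hv hv1
  set b : E d → ℝ := fun x => B (v x) (pderiv i v x) with hb
  set G : E d → ℝ := ρ ^ (2 * k + 1 + 1) * b with hG
  have hρp : ContDiff ℝ ∞ (ρ ^ (2 * k + 1 + 1)) := hρ.pow _
  have hGs : ContDiff ℝ ∞ G := hρp.mul hb1
  have hbc : HasCompactSupport b := by
    refine hvc.mono fun x hx => ?_
    contrapose! hx
    simp only [Function.mem_support, not_not] at hx
    simp [hb, hx]
  have hGc : HasCompactSupport G := hbc.mul_left
  have hGi : ∀ x, pderiv i G x = (2 * k + 2) * ρ x ^ (2 * k + 1) * pderiv i ρ x * b x +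
      ρ x ^ (2 * k + 2) * (‖pderiv i v x‖ ^ 2 + B (v x) (pderiv i (pderiv i v) x)) := fun x => by
    rw [hG, pderiv_mul i hρp hb1, pderiv_pow i hρ]
    simp only [Pi.add_apply, Pi.mul_apply, Pi.smul_apply, smul_eq_mul, Pi.pow_apply, hb2, hB]
    push_cast
    ring
  set K : ℝ := 4 * (k + 1) ^ 2 * C₀ ^ 2 + ε⁻¹ with hK
  have hK0 : 0 ≤ K := by positivity
  have cint : ∀ (p : ℕ) (w : E d → F), ContDiff ℝ ∞ w → HasCompactSupport w →
      Integrable fun x => ρ x ^ p * ‖w x‖ ^ 2 := fun p w hw hwc => by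
    refine Continuous.integrable_of_hasCompactSupport
      ((hρ.continuous.pow p).mul (hw.continuous.norm.pow 2)) ?_
    refine HasCompactSupport.mul_left ?_
    exact hwc.comp_left (g := fun y => ‖y‖ ^ 2) (by simp)
  -- the pointwise inequality
  have hpt : ∀ x, r ^ 2 * (S.indicator (fun x => ρ x ^ (2 * (k + 1)) * ‖pderiv i v x‖ ^ 2) x) ≤
      2 * r ^ 2 * pderiv i G x +
        (ε * S.indicator (fun x => ρ x ^ (2 * (k + 2)) * ‖pderiv i (pderiv i v) x‖ ^ 2) x +
        K * (r ^ 4 * S.indicator (fun x => ρ x ^ (2 * k) * ‖v x‖ ^ 2) x)) := by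
    intro x
    by_cases hx : x ∈ S
    · simp only [indicator_of_mem hx, hGi]
      set p := ρ x
      have hp : 0 ≤ p := hρ0 x
      set V := ‖v x‖
      set V1 := ‖pderiv i v x‖
      set V2 := ‖pderiv i (pderiv i v) x‖
      have hV : 0 ≤ V := norm_nonneg _
      have hV1 : 0 ≤ V1 := norm_nonneg _
      have hV2 : 0 ≤ V2 := norm_nonneg _
      have t1 : -(2 * (k + 1) * C₀ * (r * p ^ k * V) * (p ^ (k + 1) * V1)) ≤
          (2 * k + 2) * p ^ (2 * k + 1) * pderiv i ρ x * b x := by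
        have h1 : |pderiv i ρ x * b x| ≤ (C₀ * r) * (V * V1) := by
          rw [abs_mul]
          exact mul_le_mul (hρ1 x) (hB' _ _) (abs_nonneg _) (by positivity)
        have h2 := (abs_le.1 h1).1
        have h3 : 0 ≤ (2 * (k : ℝ) + 2) * p ^ (2 * k + 1) := by positivity
        have h4 := mul_le_mul_of_nonneg_left h2 h3
        calc _ = (2 * (k : ℝ) + 2) * p ^ (2 * k + 1) * -(C₀ * r * (V * V1)) := by ring
          _ ≤ _ := by rw [mul_assoc _ (pderiv i ρ x)]; exact h4
      have t2 : -(r * p ^ k * V * (p ^ (k + 2) * V2 / r)) ≤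
          p ^ (2 * k + 2) * B (v x) (pderiv i (pderiv i v) x) := by
        have h2 := (abs_le.1 (hB' (v x) (pderiv i (pderiv i v) x))).1
        have h3 : 0 ≤ p ^ (2 * k + 2) := by positivity
        calc _ = p ^ (2 * k + 2) * -(V * V2) := by field_simp; ring
          _ ≤ _ := mul_le_mul_of_nonneg_left h2 h3
      set X := r * p ^ k * V with hX
      set Y := p ^ (k + 1) * V1 with hY
      set W := p ^ (k + 2) * V2 / r with hW
      have q1 : 2 * (k + 1) * C₀ * X * Y ≤ Y ^ 2 / 2 + 2 * (k + 1) ^ 2 * C₀ ^ 2 * X ^ 2 := by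
        nlinarith [sq_nonneg (Y - 2 * (k + 1) * C₀ * X)]
      have q2 : X * W ≤ ε / 2 * W ^ 2 + ε⁻¹ / 2 * X ^ 2 := by
        have : 0 ≤ ε⁻¹ / 2 * (ε * W - X) ^ 2 := by positivity
        have e : ε⁻¹ / 2 * (ε * W - X) ^ 2 = ε / 2 * W ^ 2 + ε⁻¹ / 2 * X ^ 2 - X * W := by
          field_simp; ring
        linarith
      have eY : p ^ (2 * (k + 1)) * V1 ^ 2 = Y ^ 2 := by rw [hY]; ring
      have eY' : p ^ (2 * k + 2) * V1 ^ 2 = Y ^ 2 := by rw [hY]; ring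
      have eX : r ^ 4 * (p ^ (2 * k) * V ^ 2) = r ^ 2 * X ^ 2 := by rw [hX]; ring
      have eW : p ^ (2 * (k + 2)) * V2 ^ 2 = r ^ 2 * W ^ 2 := by rw [hW]; field_simp; ring
      rw [eY, eX, eW, mul_add (p ^ (2 * k + 2)), eY']
      have main : Y ^ 2 ≤ 2 * ((2 * k + 2) * p ^ (2 * k + 1) * pderiv i ρ x * b x +
          (Y ^ 2 + p ^ (2 * k + 2) * B (v x) (pderiv i (pderiv i v) x))) +
          (ε * W ^ 2 + K * X ^ 2) := by
        rw [hK]; linarith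
      have := mul_le_mul_of_nonneg_left main (sq_nonneg r)
      linarith
    · simp only [indicator_of_notMem hx, hGi, hρS x hx]
      simp
  have hi0 := (integral_pderiv_eq_zero i hGs hGc)
  have iG : Integrable (pderiv i G) :=
    (contDiff_pderiv i hGs).continuous.integrable_of_hasCompactSupport
    (hasCompactSupport_pderiv i hGc)
  have i1 := (cint (2 * (k + 1)) _ hv1 hv1c).indicator hS
  have i2 := (cint (2 * (k + 2)) _ hv2 hv2c).indicator hS
  have i3 := (cint (2 * k) _ hv hvc).indicator hS
  have j2 := i2.const_mul ε
  have j3 := (i3.const_mul (r ^ 4)).const_mul K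
  have j23 : Integrable (fun x =>
      ε * S.indicator (fun x => ρ x ^ (2 * (k + 2)) * ‖pderiv i (pderiv i v) x‖ ^ 2) x +
        K * (r ^ 4 * S.indicator (fun x => ρ x ^ (2 * k) * ‖v x‖ ^ 2) x)) := j2.add j3
  have j1 := iG.const_mul (2 * r ^ 2)
  have := integral_mono (i1.const_mul (r ^ 2)) (j1.add j23) hpt
  rw [integral_add' j1 j23, integral_add j2 j3] at this
  simp only [integral_const_mul, hi0, integral_indicator hS, mul_zero, zero_add] at this
  exact this

/-- Convexity of `k ↦ J k`, in the form of interpolation between consecutive indices, gives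
interpolation between `0` and `m`. -/
lemma exists_interpolation_const (m : ℕ) (K : ℝ → ℝ) (hK : ∀ ε, 0 < ε → 0 ≤ K ε) (ε : ℝ)
    (hε : 0 < ε) : ∃ C : ℝ, 0 ≤ C ∧ ∀ J : ℕ → ℝ, (∀ k, 0 ≤ J k) →
      (∀ ε, 0 < ε → ∀ k, k + 2 ≤ m → J (k + 1) ≤ ε * J (k + 2) + K ε * J k) →
      ∀ k, k < m → J k ≤ ε * J m + C * J 0 := by
  have h1 : ∀ k : ℕ, ∀ ε : ℝ, 0 < ε → ∃ C : ℝ, 0 ≤ C ∧ ∀ J : ℕ → ℝ, (∀ k, 0 ≤ J k) →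
      (∀ ε, 0 < ε → ∀ k, k + 2 ≤ m → J (k + 1) ≤ ε * J (k + 2) + K ε * J k) →
      k < m → J k ≤ ε * J (k + 1) + C * J 0 := by
    intro k
    induction k with
    | zero =>
      intro ε hε
      refine ⟨1, zero_le_one, fun J hJ _ _ => ?_⟩
      have := mul_nonneg hε.le (hJ 1)
      simpa using this
    | succ k ih =>
      intro ε hε
      have hKn := hK (ε / 2) (by positivity)
      obtain ⟨C, hC, h⟩ := ih (1 / (2 * (K (ε / 2) + 1))) (by positivity)
      refine ⟨2 * K (ε / 2) * C, by positivity, fun J hJ hJs hk => ?_⟩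
      have e1 := h J hJ hJs (by omega)
      have e2 := hJs (ε / 2) (by positivity) k (by omega)
      have e3 : K (ε / 2) * J k ≤ 1 / 2 * J (k + 1) + K (ε / 2) * C * J 0 := by
        have := mul_le_mul_of_nonneg_left e1 hKn
        have h4 : K (ε / 2) * (1 / (2 * (K (ε / 2) + 1)) * J (k + 1)) ≤ 1 / 2 * J (k + 1) := by
          rw [← mul_assoc]
          refine mul_le_mul_of_nonneg_right ?_ (hJ _)
          rw [mul_one_div, div_le_div_iff₀ (by positivity) (by norm_num)]
          linarith
        linarith
      have : J (k + 1 + 1) = J (k + 2) := rfl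
      rw [this]
      linarith
  -- compose the consecutive interpolations downwards from `m`
  have h2 : ∀ j : ℕ, ∀ ε : ℝ, 0 < ε → ∃ C : ℝ, 0 ≤ C ∧ ∀ J : ℕ → ℝ, (∀ k, 0 ≤ J k) →
      (∀ ε, 0 < ε → ∀ k, k + 2 ≤ m → J (k + 1) ≤ ε * J (k + 2) + K ε * J k) →
      j < m → J (m - (j + 1)) ≤ ε * J m + C * J 0 := by
    intro j
    induction j with
    | zero =>
      intro ε hε
      obtain ⟨C, hC, h⟩ := h1 (m - 1) ε hε
      refine ⟨C, hC, fun J hJ hJs hj => ?_⟩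
      have := h J hJ hJs (by omega)
      rwa [show m - 1 + 1 = m by omega] at this
    | succ j ih =>
      intro ε hε
      obtain ⟨C, hC, h⟩ := ih ε hε
      obtain ⟨D, hD, h'⟩ := h1 (m - (j + 2)) 1 one_pos
      refine ⟨C + D, by positivity, fun J hJ hJs hj => ?_⟩
      have e1 := h J hJ hJs (by omega)
      have e2 := h' J hJ hJs (by omega)
      rw [show m - (j + 2) + 1 = m - (j + 1) by omega] at e2
      rw [show m - (j + 1 + 1) = m - (j + 2) by omega]
      linarith
  choose C hC h using fun j => h2 j ε hε
  refine ⟨∑ j ∈ Finset.range m, C j, Finset.sum_nonneg fun j _ => hC j, fun J hJ hJs k hk => ?_⟩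
  have e := h (m - (k + 1)) J hJ hJs (by omega)
  rw [show m - (m - (k + 1) + 1) = k by omega] at e
  refine e.trans ?_
  gcongr
  · exact hJ 0
  · exact Finset.single_le_sum (f := C) (fun j _ => hC j) (Finset.mem_range.2 (by omega))

/-- Weighted interpolation between the function and its derivatives of order `m`. -/
lemma exists_weighted_interpolation (d m : ℕ) {C₀ ε : ℝ} (hC₀ : 0 ≤ C₀) (hε : 0 < ε)
    (B : F →L[ℝ] F →L[ℝ] ℝ) (hB : ∀ v, B v v = ‖v‖ ^ 2) (hB' : ∀ v w, |B v w| ≤ ‖v‖ * ‖w‖) :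
    ∃ C : ℝ, 0 ≤ C ∧ ∀ (r : ℝ) (ρ : E d → ℝ) (S : Set (E d)) (f : E d → F), 0 < r →
      ContDiff ℝ ∞ ρ → (∀ x, 0 ≤ ρ x) → (∀ i x, |pderiv i ρ x| ≤ C₀ * r) → MeasurableSet S →
      (∀ x, x ∉ S → ρ x = 0) → ContDiff ℝ ∞ f → HasCompactSupport f → ∀ k, k < m →
      wInt m r ρ S (fun γ => mderiv γ f) k ≤
        ε * wInt m r ρ S (fun γ => mderiv γ f) m + C * wInt m r ρ S (fun γ => mderiv γ f) 0 := by
  -- the number of multiindices bounds the number of terms in each step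
  obtain ⟨M, hM⟩ : ∃ M : ℝ, M = 1 + ∑ k ∈ Finset.range (m + 1), ((indicesEQ d k).card : ℝ) :=
    ⟨_, rfl⟩
  have hM1 : 1 ≤ M := by
    have : 0 ≤ ∑ k ∈ Finset.range (m + 1), ((indicesEQ d k).card : ℝ) :=
      Finset.sum_nonneg fun _ _ => Nat.cast_nonneg _
    linarith
  have hMk : ∀ k ≤ m, ((indicesEQ d k).card : ℝ) ≤ M := fun k hk => by
    have := Finset.single_le_sum (f := fun k => ((indicesEQ d k).card : ℝ))
      (fun _ _ => Nat.cast_nonneg _) (Finset.mem_range.2 (show k < m + 1 by omega))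
    linarith
  have hM0 : 0 < M := by linarith
  obtain ⟨C, hC, h⟩ := exists_interpolation_const m
    (fun ε => M * (4 * m ^ 2 * C₀ ^ 2 + (ε / M)⁻¹)) (fun ε hε => by positivity) ε hε
  refine ⟨C, hC, fun r ρ S f hr hρ hρ0 hρ1 hS hρS hf hfc k hk => ?_⟩
  refine h _ (fun k => wInt_nonneg m hr.le ρ S _ k) (fun ε hε k hk => ?_) k hk
  set J := wInt m r ρ S (fun γ => mderiv γ f) with hJ
  have hterm : ∀ γ ∈ indicesEQ d (k + 1),
      r ^ (2 * (m - (k + 1))) * ∫ x in S, ρ x ^ (2 * (k + 1)) * ‖mderiv γ f x‖ ^ 2 ≤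
        ε / M * J (k + 2) + (4 * m ^ 2 * C₀ ^ 2 + (ε / M)⁻¹) * J k := by
    intro γ hγ
    obtain ⟨γ', i, rfl, hγ'⟩ := exists_eq_add_single (mem_indicesEQ.1 hγ)
    have hs := weighted_step B hB hB' hr hC₀ (show 0 < ε / M by positivity) hρ hρ0 (hρ1 i) hS hρS
      (contDiff_mderiv γ' hf) (hasCompactSupport_mderiv γ' hfc) k
    have hle : ∀ (j : ℕ) (ζ : MIndex d), ζ ∈ indicesEQ d j →
        r ^ (2 * (m - j)) * ∫ x in S, ρ x ^ (2 * j) * ‖mderiv ζ f x‖ ^ 2 ≤ J j := by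
      intro j ζ hζ
      refine Finset.single_le_sum (f := fun γ => r ^ (2 * (m - j)) *
        ∫ x in S, ρ x ^ (2 * j) * ‖mderiv γ f x‖ ^ 2) (fun γ _ => ?_) hζ
      refine mul_nonneg (by positivity) (integral_nonneg fun x => ?_)
      have := hρ0 x
      positivity
    have h2 := hle (k + 2) (γ' + Pi.single i 1 + Pi.single i 1)
      (by rw [mem_indicesEQ, order_add_single, order_add_single, hγ'])
    have h0 := hle k γ' (mem_indicesEQ.2 hγ')
    rw [mderiv_add_single _ _ hf, mderiv_add_single _ _ hf] at h2
    rw [mderiv_add_single _ _ hf]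
    obtain ⟨q, hq⟩ : ∃ q, m = k + 2 + q := ⟨m - (k + 2), by omega⟩
    have q1 : m - (k + 1) = q + 1 := by omega
    have q2 : m - (k + 2) = q := by omega
    have q0 : m - k = q + 2 := by omega
    rw [q1]
    rw [q2] at h2
    rw [q0] at h0
    have hmk : (4 * ((k : ℝ) + 1) ^ 2 * C₀ ^ 2 + (ε / M)⁻¹) ≤
        (4 * (m : ℝ) ^ 2 * C₀ ^ 2 + (ε / M)⁻¹) := by
      have : (k : ℝ) + 1 ≤ m := by exact_mod_cast (by omega : k + 1 ≤ m)
      gcongr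
    calc _ = r ^ (2 * q) * (r ^ 2 * ∫ x in S,
          ρ x ^ (2 * (k + 1)) * ‖pderiv i (mderiv γ' f) x‖ ^ 2) := by ring
      _ ≤ _ := mul_le_mul_of_nonneg_left hs (by positivity)
      _ = ε / M * (r ^ (2 * q) * ∫ x in S,
            ρ x ^ (2 * (k + 2)) * ‖pderiv i (pderiv i (mderiv γ' f)) x‖ ^ 2) +
          (4 * (k + 1) ^ 2 * C₀ ^ 2 + (ε / M)⁻¹) *
            (r ^ (2 * (q + 2)) * ∫ x in S, ρ x ^ (2 * k) * ‖mderiv γ' f x‖ ^ 2) := by ring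
      _ ≤ _ := by
        gcongr
        exact mul_nonneg (by positivity) (integral_nonneg fun x => by
          have := hρ0 x
          positivity)
  calc J (k + 1) ≤ ∑ _γ ∈ indicesEQ d (k + 1),
        (ε / M * J (k + 2) + (4 * m ^ 2 * C₀ ^ 2 + (ε / M)⁻¹) * J k) := Finset.sum_le_sum hterm
    _ = (indicesEQ d (k + 1)).card *
        (ε / M * J (k + 2) + (4 * m ^ 2 * C₀ ^ 2 + (ε / M)⁻¹) * J k) := by
        rw [Finset.sum_const, nsmul_eq_mul]
    _ ≤ M * (ε / M * J (k + 2) + (4 * m ^ 2 * C₀ ^ 2 + (ε / M)⁻¹) * J k) := by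
        have hJk : 0 ≤ J k := wInt_nonneg m hr.le ρ S _ k
        have hJk2 : 0 ≤ J (k + 2) := wInt_nonneg m hr.le ρ S _ _
        refine mul_le_mul_of_nonneg_right (hMk _ (by omega)) (by positivity)
    _ = _ := by field_simp

end Interpolation

/-! ### The form on jets of smooth functions -/

section Forms

variable {d N : ℕ}

/-- The sesquilinear form with coefficients `A`, as a function of two jets: the sum of the integrals
of `conj (F_α)_j A^{jk}_{αβ} (G_β)_k`. -/
noncomputable def jetForm (m : ℕ) (A : Coeff d N) (F G : MIndex d → E d → V N) : ℂ :=
  ∑ j, ∑ k, ∑ α ∈ indicesLE d m, ∑ β ∈ indicesLE d m,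
    ∫ x, conj (F α x j) * (A j k α β x * G β x k)

/-- The norm of jets for which the forms in question are bounded: `L^2` norms of derivatives of
order `m - |α|` of the component with index `α`. -/
noncomputable def jetNorm (m : ℕ) (F : MIndex d → E d → V N) : ℝ :=
  ∑ α ∈ indicesLE d m, (gradNorm (m - order α) (F α)).toReal

/-- All components of the jet are smooth and compactly supported. -/
def IsTestJet (F : MIndex d → E d → V N) : Prop :=
  ∀ α, ContDiff ℝ ∞ (F α) ∧ HasCompactSupport (F α)

lemma gradNorm_ne_top {F : Type*} [NormedAddCommGroup F] [NormedSpace ℝ F] {f : E d → F}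
    (hf : ContDiff ℝ ∞ f) (hc : HasCompactSupport f) (k : ℕ) : gradNorm k f ≠ ⊤ := by
  refine (ENNReal.sum_lt_top.2 fun γ _ => ?_).ne
  exact ((contDiff_mderiv γ hf).continuous.memLp_of_hasCompactSupport
    (hasCompactSupport_mderiv γ hc)).2

/-- The form defined by `A` is bounded by the constant `C` with respect to derivatives in `L^2`. -/
def FormBound (m : ℕ) (A : Coeff d N) (C : ℝ≥0) : Prop :=
  (∀ j k, ∀ α ∈ indicesLE d m, ∀ β ∈ indicesLE d m, AEMeasurable (A j k α β) volume) ∧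
  ∀ j k, ∀ α ∈ indicesLE d m, ∀ β ∈ indicesLE d m, ∀ f g : E d → V N, ContDiff ℝ ∞ f →
    HasCompactSupport f → ContDiff ℝ ∞ g → HasCompactSupport g →
    ∫⁻ x, ‖f x‖ₑ * ‖A j k α β x‖ₑ * ‖g x‖ₑ ≤
      C * (gradNorm (m - order α) f * gradNorm (m - order β) g)

lemma enorm_apply_le (v : V N) (j : Fin N) : ‖v j‖ₑ ≤ ‖v‖ₑ := by
  rw [enorm_le_iff_norm_le]
  exact PiLp.norm_apply_le v j

lemma enorm_form_le (v w : V N) (a : ℂ) (j k : Fin N) :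
    ‖conj (v j) * (a * w k)‖ₑ ≤ ‖v‖ₑ * ‖a‖ₑ * ‖w‖ₑ := by
  rw [enorm_mul, enorm_mul, ← mul_assoc, RCLike.enorm_conj]
  gcongr
  · exact enorm_apply_le v j
  · exact enorm_apply_le w k

lemma aestronglyMeasurable_form {μ : Measure (E d)} {f g : E d → V N} {a : E d → ℂ}
    (hf : AEStronglyMeasurable f μ) (ha : AEMeasurable a μ) (hg : AEStronglyMeasurable g μ)
    (j k : Fin N) : AEStronglyMeasurable (fun x => conj (f x j) * (a x * g x k)) μ := by
  have h1 : AEStronglyMeasurable (fun x => f x j) μ :=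
    (EuclideanSpace.proj (𝕜 := ℂ) j).continuous.comp_aestronglyMeasurable hf
  have h2 : AEStronglyMeasurable (fun x => g x k) μ :=
    (EuclideanSpace.proj (𝕜 := ℂ) k).continuous.comp_aestronglyMeasurable hg
  exact (Complex.continuous_conj.comp_aestronglyMeasurable h1).mul
    (ha.aestronglyMeasurable.mul h2)

variable {m : ℕ} {A : Coeff d N} {C : ℝ≥0}

lemma FormBound.integrable (hA : FormBound m A C) {α β : MIndex d} (hα : α ∈ indicesLE d m)
    (hβ : β ∈ indicesLE d m) {f g : E d → V N} (hf : ContDiff ℝ ∞ f) (hfc : HasCompactSupport f)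
    (hg : ContDiff ℝ ∞ g) (hgc : HasCompactSupport g) (j k : Fin N) :
    Integrable (fun x => conj (f x j) * (A j k α β x * g x k)) volume ∧
      ‖∫ x, conj (f x j) * (A j k α β x * g x k)‖ ≤
        C * ((gradNorm (m - order α) f).toReal * (gradNorm (m - order β) g).toReal) := by
  have hb := hA.2 j k α hα β hβ f g hf hfc hg hgc
  have hle : ∫⁻ x, ‖conj (f x j) * (A j k α β x * g x k)‖ₑ ≤
      C * (gradNorm (m - order α) f * gradNorm (m - order β) g) :=
    (lintegral_mono fun x => enorm_form_le _ _ _ j k).trans hb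
  have hfin : (C : ℝ≥0∞) * (gradNorm (m - order α) f * gradNorm (m - order β) g) ≠ ⊤ :=
    ENNReal.mul_ne_top ENNReal.coe_ne_top
      (ENNReal.mul_ne_top (gradNorm_ne_top hf hfc _) (gradNorm_ne_top hg hgc _))
  refine ⟨⟨aestronglyMeasurable_form hf.continuous.aestronglyMeasurable (hA.1 j k α hα β hβ)
    hg.continuous.aestronglyMeasurable j k, hle.trans_lt hfin.lt_top⟩, ?_⟩
  refine (norm_integral_le_lintegral_norm _).trans ?_
  simp only [ofReal_norm]
  refine (ENNReal.toReal_mono hfin hle).trans (le_of_eq ?_)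
  simp

lemma norm_jetForm_le (hA : FormBound m A C) {F G : MIndex d → E d → V N} (hF : IsTestJet F)
    (hG : IsTestJet G) : ‖jetForm m A F G‖ ≤ N * N * C * (jetNorm m F * jetNorm m G) := by
  have h1 : ∀ j k, ‖∑ α ∈ indicesLE d m, ∑ β ∈ indicesLE d m,
      ∫ x, conj (F α x j) * (A j k α β x * G β x k)‖ ≤ C * (jetNorm m F * jetNorm m G) := by
    intro j k
    unfold jetNorm
    rw [Finset.sum_mul_sum, Finset.mul_sum]
    refine (norm_sum_le _ _).trans (Finset.sum_le_sum fun α hα => ?_)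
    rw [Finset.mul_sum]
    refine (norm_sum_le _ _).trans (Finset.sum_le_sum fun β hβ => ?_)
    exact (hA.integrable hα hβ (hF α).1 (hF α).2 (hG β).1 (hG β).2 j k).2
  refine (norm_sum_le _ _).trans ?_
  refine (Finset.sum_le_sum fun j _ => (norm_sum_le _ _).trans
    (Finset.sum_le_sum fun k _ => h1 j k)).trans (le_of_eq ?_)
  simp [mul_assoc]

lemma jetForm_add_left (hA : FormBound m A C) {F F' G : MIndex d → E d → V N} (hF : IsTestJet F)
    (hF' : IsTestJet F') (hG : IsTestJet G) :
    jetForm m A (F + F') G = jetForm m A F G + jetForm m A F' G := by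
  unfold jetForm
  simp only [← Finset.sum_add_distrib]
  refine Finset.sum_congr rfl fun j _ => Finset.sum_congr rfl fun k _ =>
    Finset.sum_congr rfl fun α hα => Finset.sum_congr rfl fun β hβ => ?_
  rw [← integral_add (hA.integrable hα hβ (hF α).1 (hF α).2 (hG β).1 (hG β).2 j k).1
    (hA.integrable hα hβ (hF' α).1 (hF' α).2 (hG β).1 (hG β).2 j k).1]
  refine integral_congr_ae (Filter.Eventually.of_forall fun x => ?_)
  simp [add_mul]

lemma jetForm_sub_right (hA : FormBound m A C) {F G G' : MIndex d → E d → V N} (hF : IsTestJet F)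
    (hG : IsTestJet G) (hG' : IsTestJet G') :
    jetForm m A F (G - G') = jetForm m A F G - jetForm m A F G' := by
  unfold jetForm
  simp only [← Finset.sum_sub_distrib]
  refine Finset.sum_congr rfl fun j _ => Finset.sum_congr rfl fun k _ =>
    Finset.sum_congr rfl fun α hα => Finset.sum_congr rfl fun β hβ => ?_
  rw [← integral_sub (hA.integrable hα hβ (hF α).1 (hF α).2 (hG β).1 (hG β).2 j k).1
    (hA.integrable hα hβ (hF α).1 (hF α).2 (hG' β).1 (hG' β).2 j k).1]
  refine integral_congr_ae (Filter.Eventually.of_forall fun x => ?_)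
  simp [mul_sub]

lemma isTestJet_mderiv {f : E d → V N} (hf : ContDiff ℝ ∞ f) (hc : HasCompactSupport f) :
    IsTestJet fun α => mderiv α f :=
  fun α => ⟨contDiff_mderiv α hf, hasCompactSupport_mderiv α hc⟩

lemma jetNorm_mderiv_le {f : E d → V N} (hf : ContDiff ℝ ∞ f) (hc : HasCompactSupport f) :
    jetNorm m (fun α => mderiv α f) ≤ (indicesLE d m).card * (gradNorm m f).toReal := by
  refine (Finset.sum_le_sum fun α hα => ?_).trans (le_of_eq (by
    rw [Finset.sum_const, nsmul_eq_mul]))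
  refine ENNReal.toReal_mono (gradNorm_ne_top hf hc m) ((gradNorm_mderiv_le hf _ α).trans ?_)
  rw [Nat.sub_add_cancel (mem_indicesLE.1 hα)]

end Forms

/-! ### Cutoff functions and lower order terms -/

section Cutoffs

lemma hasCompactSupport_smul {d : ℕ} {F : Type*} [NormedAddCommGroup F] [NormedSpace ℝ F]
    (a : E d → ℝ) {g : E d → F} (hg : HasCompactSupport g) :
    HasCompactSupport fun x => a x • g x := by
  refine hg.mono fun x hx => ?_
  contrapose! hx
  simp only [Function.mem_support, not_not] at hx ⊢
  simp [hx]

variable {d N : ℕ}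

/-- `ρ` is a smooth cutoff function with values in `[0, 1]` whose derivatives of order `k` are
bounded by `K k * r ^ k`; here `1 / r` is the length scale on which `ρ` varies. -/
structure IsCutoff (K : ℕ → ℝ) (r : ℝ) (ρ : E d → ℝ) : Prop where
  smooth : ContDiff ℝ ∞ ρ
  compact : HasCompactSupport ρ
  nonneg : ∀ x, 0 ≤ ρ x
  le_one : ∀ x, ρ x ≤ 1
  bound : ∀ ξ x, |mderiv ξ ρ x| ≤ K (order ξ) * r ^ order ξ

/-- A cutoff, a set that supports its gradient, and a smooth function. The type of all these data
serves as the index set of the families in `IsSymbol` and `IsErr`, so that the constants there are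
uniform. -/
structure CutoffDatum (d N : ℕ) (K : ℕ → ℝ) where
  r : ℝ
  ρ : E d → ℝ
  P : Set (E d)
  f : E d → V N
  hr : 0 < r
  hρ : IsCutoff K r ρ
  hP : ∀ j, VanishOff P (pderiv j ρ)
  hf : ContDiff ℝ ∞ f
  hfc : HasCompactSupport f

variable {K : ℕ → ℝ}

/-- The lower order terms `∑_{k < m} r^{2(m-k)} ∫_P ρ^{2k} |∇^k f|^2` on the right-hand side. -/
noncomputable def lowerOrder {d : ℕ} {F : Type*} [NormedAddCommGroup F] (m : ℕ) (r : ℝ)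
    (ρ : E d → ℝ) (P : Set (E d)) (w : MIndex d → E d → F) : ℝ :=
  ∑ k ∈ Finset.range m, wInt m r ρ P w k

lemma lowerOrder_nonneg {F : Type*} [NormedAddCommGroup F] (m : ℕ) {r : ℝ} (hr : 0 ≤ r)
    (ρ : E d → ℝ) (P : Set (E d)) (w : MIndex d → E d → F) : 0 ≤ lowerOrder m r ρ P w :=
  Finset.sum_nonneg fun k _ => wInt_nonneg m hr ρ P w k

lemma eLpNorm_two_eq_sqrt {X F : Type*} [MeasurableSpace X] [NormedAddCommGroup F] {μ : Measure X}
    {f : X → F} (hf : MemLp f 2 μ) : eLpNorm f 2 μ = ENNReal.ofReal √(∫ x, ‖f x‖ ^ 2 ∂μ) := by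
  rw [hf.eLpNorm_eq_integral_rpow_norm (by norm_num) (by norm_num)]
  simp [Real.sqrt_eq_rpow]

lemma eLpNorm_weighted_le_sqrt {m : ℕ} (D : CutoffDatum d N K) {γ : MIndex d} {k : ℕ}
    (hγ : order γ = k) (S : Set (E d)) :
    ENNReal.ofReal (D.r ^ (m - k)) *
      eLpNorm (fun x => D.ρ x ^ k • mderiv γ D.f x) 2 (volume.restrict S) ≤
      ENNReal.ofReal √(wInt m D.r D.ρ S (fun γ => mderiv γ D.f) k) := by
  have hc : Continuous fun x => D.ρ x ^ k • mderiv γ D.f x :=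
    (D.hρ.smooth.continuous.pow k).smul (contDiff_mderiv γ D.hf).continuous
  have hcs : HasCompactSupport fun x => D.ρ x ^ k • mderiv γ D.f x :=
    hasCompactSupport_smul _ (hasCompactSupport_mderiv γ D.hfc)
  have hr := D.hr
  rw [eLpNorm_two_eq_sqrt ((hc.memLp_of_hasCompactSupport hcs).restrict S),
    ← ENNReal.ofReal_mul (by positivity)]
  refine ENNReal.ofReal_le_ofReal ?_
  rw [← Real.sqrt_sq (show 0 ≤ D.r ^ (m - k) by positivity), ← Real.sqrt_mul (by positivity)]
  refine Real.sqrt_le_sqrt ?_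
  have e : ∀ x, ‖D.ρ x ^ k • mderiv γ D.f x‖ ^ 2 = D.ρ x ^ (2 * k) * ‖mderiv γ D.f x‖ ^ 2 := by
    intro x
    rw [norm_smul, Real.norm_eq_abs, mul_pow, sq_abs]
    ring
  simp only [e]
  rw [← pow_mul, mul_comm (m - k) 2]
  refine Finset.single_le_sum (f := fun γ => D.r ^ (2 * (m - k)) * ∫ x in S,
    D.ρ x ^ (2 * k) * ‖mderiv γ D.f x‖ ^ 2) (fun γ _ => ?_) (mem_indicesEQ.2 hγ)
  refine mul_nonneg (by positivity) (integral_nonneg fun x => ?_)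
  have := D.hρ.nonneg x
  positivity

/-- Error terms are bounded in `L^2` by the lower order terms. -/
lemma IsErr.exists_gradNorm_le {m k : ℕ} {g : CutoffDatum d N K → E d → V N}
    (hg : IsErr m (fun D : CutoffDatum d N K => D.r) (fun D => D.ρ) (fun D => D.f) (fun D => D.P)
      k g) (hk : k ≤ m) :
    ∃ C : ℝ, 0 ≤ C ∧ ∀ D : CutoffDatum d N K, gradNorm (m - k) (g D) ≤
      ENNReal.ofReal (C * √(lowerOrder m D.r D.ρ D.P fun γ => mderiv γ D.f)) := by
  have h1 : ∀ ξ : MIndex d, ∃ C : ℝ, 0 ≤ C ∧ (ξ ∈ indicesEQ d (m - k) → ∀ D : CutoffDatum d N K,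
      eLpNorm (mderiv ξ (g D)) 2 volume ≤
        ENNReal.ofReal (C * √(lowerOrder m D.r D.ρ D.P fun γ => mderiv γ D.f))) := by
    intro ξ
    by_cases hξ : ξ ∈ indicesEQ d (m - k)
    swap
    · exact ⟨0, le_rfl, fun h => absurd h hξ⟩
    have hξ' := mem_indicesEQ.1 hξ
    have hkm : k + order ξ = m := by omega
    obtain ⟨C, hC, hb⟩ := hg.2.2 ξ hkm.le
    set I := (indicesLE d m).filter (fun γ => order γ < m) with hI
    refine ⟨C * I.card, mul_nonneg hC (Nat.cast_nonneg _), fun _ D => ?_⟩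
    set Z := lowerOrder m D.r D.ρ D.P fun γ => mderiv γ D.f with hZ
    have hv := (hg.2.1 D).mderiv (hg.1 D) ξ
    have e0 : eLpNorm (mderiv ξ (g D)) 2 volume =
        eLpNorm (mderiv ξ (g D)) 2 (volume.restrict D.P) := by
      refine (eLpNorm_restrict_eq_of_support_subset fun x hx => ?_).symm
      by_contra hxP
      exact hx (hv.eq_zero hxP)
    have e1 : eLpNorm (mderiv ξ (g D)) 2 (volume.restrict D.P) ≤
        eLpNorm (C • ∑ γ ∈ I, fun x => D.r ^ (m - order γ) *
          ‖D.ρ x ^ order γ • mderiv γ D.f x‖) 2 (volume.restrict D.P) := by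
      refine eLpNorm_mono_real fun x => (hb D x).trans (le_of_eq ?_)
      simp only [Pi.smul_apply, Finset.sum_apply, smul_eq_mul]
      congr 1
      rw [hkm]
      refine Finset.sum_congr rfl fun γ _ => ?_
      have := D.hρ.nonneg x
      rw [norm_smul, Real.norm_of_nonneg (by positivity), Nat.sub_self, zero_add, mul_assoc]
    have hterm : ∀ γ ∈ I, eLpNorm (fun x => D.r ^ (m - order γ) *
        ‖D.ρ x ^ order γ • mderiv γ D.f x‖) 2 (volume.restrict D.P) ≤ ENNReal.ofReal √Z := by
      intro γ hγ
      have hr := D.hr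
      have h2 := eLpNorm_const_smul (D.r ^ (m - order γ))
        (fun x => ‖D.ρ x ^ order γ • mderiv γ D.f x‖) 2 (volume.restrict D.P)
      rw [eLpNorm_norm, Real.enorm_of_nonneg (by positivity)] at h2
      have h3 := h2.le.trans (eLpNorm_weighted_le_sqrt (m := m) D (γ := γ) rfl D.P)
      refine h3.trans (ENNReal.ofReal_le_ofReal (Real.sqrt_le_sqrt ?_))
      exact Finset.single_le_sum (f := fun k => wInt m D.r D.ρ D.P (fun γ => mderiv γ D.f) k)
        (fun k _ => wInt_nonneg m hr.le _ _ _ k)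
        (Finset.mem_range.2 (Finset.mem_filter.1 hγ).2)
    have hmeas : ∀ γ ∈ I, AEStronglyMeasurable (fun x => D.r ^ (m - order γ) *
        ‖D.ρ x ^ order γ • mderiv γ D.f x‖) (volume.restrict D.P) := fun γ _ =>
      (continuous_const.mul ((D.hρ.smooth.continuous.pow _).smul
        (contDiff_mderiv γ D.hf).continuous).norm).aestronglyMeasurable
    rw [e0]
    refine e1.trans ?_
    rw [eLpNorm_const_smul, Real.enorm_of_nonneg hC, mul_assoc, ENNReal.ofReal_mul hC]
    gcongr
    refine (eLpNorm_sum_le hmeas (by norm_num)).trans ((Finset.sum_le_sum hterm).trans ?_)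
    rw [Finset.sum_const, nsmul_eq_mul, ENNReal.ofReal_mul (Nat.cast_nonneg _),
      ENNReal.ofReal_natCast]
  choose C hC h using h1
  refine ⟨∑ ξ ∈ indicesEQ d (m - k), C ξ, Finset.sum_nonneg fun ξ _ => hC ξ, fun D => ?_⟩
  rw [Finset.sum_mul, ENNReal.ofReal_sum_of_nonneg fun ξ _ =>
    mul_nonneg (hC ξ) (Real.sqrt_nonneg _)]
  exact Finset.sum_le_sum fun ξ hξ => h ξ hξ D

end Cutoffs

/-! ### The Caccioppoli inequality for smooth functions -/

section SmoothCaccioppoli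

variable {d N m : ℕ} {K : ℕ → ℝ}

lemma IsErr.hasCompactSupport {k : ℕ} {g : CutoffDatum d N K → E d → V N}
    (hg : IsErr m (fun D : CutoffDatum d N K => D.r) (fun D => D.ρ) (fun D => D.f) (fun D => D.P)
      k g) (hk : k ≤ m) (D : CutoffDatum d N K) : HasCompactSupport (g D) := by
  refine HasCompactSupport.of_support_subset_isCompact D.hfc fun x hx => ?_
  by_contra hn
  obtain ⟨C, -, hb⟩ := hg.2.2 0 (by simpa using hk)
  have h0 : wsum m D.r D.ρ D.f (k + order (0 : MIndex d)) x = 0 := by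
    refine Finset.sum_eq_zero fun γ _ => ?_
    rw [mderiv_eq_zero_of_eventually γ (notMem_tsupport_iff_eventuallyEq.1 hn) D.hf]
    simp
  have := hb D x
  rw [h0, mul_zero, mderiv_zero] at this
  exact hx (norm_le_zero_iff.1 this)

lemma isSymbol_cutoff : IsSymbol (fun D : CutoffDatum d N K => D.r) 0 fun D => D.ρ := by
  refine ⟨fun D => D.hρ.smooth, fun ξ => ⟨|K (order ξ)|, abs_nonneg _, fun D x => ?_⟩⟩
  refine (D.hρ.bound ξ x).trans ?_
  rw [zero_add]
  have := D.hr
  gcongr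
  exact le_abs_self _

/-- The commutator of multiplication by `ρ^m` with `∂^β`. -/
noncomputable def commJet (m : ℕ) (D : CutoffDatum d N K) : MIndex d → E d → V N :=
  fun β => mderiv β (D.ρ ^ m • D.f) - D.ρ ^ m • mderiv β D.f

lemma CutoffDatum.contDiff_pow_smul (D : CutoffDatum d N K) (p : ℕ) :
    ContDiff ℝ ∞ (D.ρ ^ p • D.f) :=
  ContDiff.smul (show ContDiff ℝ ∞ (D.ρ ^ p) from D.hρ.smooth.pow p) D.hf

lemma CutoffDatum.hasCompactSupport_pow_smul (D : CutoffDatum d N K) (p : ℕ) :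
    HasCompactSupport (D.ρ ^ p • D.f) :=
  hasCompactSupport_smul _ D.hfc

lemma isTestJet_commJet (D : CutoffDatum d N K) : IsTestJet (commJet m D) := by
  refine fun β => ⟨?_, ?_⟩
  · exact (contDiff_mderiv β (D.contDiff_pow_smul m)).sub
      (ContDiff.smul (show ContDiff ℝ ∞ (D.ρ ^ m) from D.hρ.smooth.pow m) (contDiff_mderiv β D.hf))
  · exact (hasCompactSupport_mderiv β (D.hasCompactSupport_pow_smul m)).sub
      (hasCompactSupport_smul _ (hasCompactSupport_mderiv β D.hfc))

/-- The lower order terms of a datum. -/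
noncomputable def CutoffDatum.low (m : ℕ) (D : CutoffDatum d N K) : ℝ :=
  lowerOrder m D.r D.ρ D.P fun γ => mderiv γ D.f

/-- The commutator jet is bounded by the lower order terms, in the norms that the form bound needs.
-/
lemma exists_commJet_bound (m : ℕ) :
    ∃ C : ℝ, 0 ≤ C ∧ ∀ D : CutoffDatum d N K, ∀ β ∈ indicesLE d m,
      (gradNorm (m - order β) (commJet m D β)).toReal ≤ C * √(D.low m) := by
  have h1 : ∀ β : MIndex d, ∃ C : ℝ, 0 ≤ C ∧ (β ∈ indicesLE d m → ∀ D : CutoffDatum d N K,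
      (gradNorm (m - order β) (commJet m D β)).toReal ≤ C * √(D.low m)) := by
    intro β
    by_cases hβ : β ∈ indicesLE d m
    swap
    · exact ⟨0, le_rfl, fun h => absurd h hβ⟩
    have hβ' := mem_indicesLE.1 hβ
    have he := isErr_commutator (m := m) (P := fun D : CutoffDatum d N K => D.P)
      (f := fun D : CutoffDatum d N K => D.f) (fun D => D.hρ.nonneg) (fun D => D.hr.le)
      isSymbol_cutoff (fun D => D.hP) (fun D => D.hf) β hβ'
    obtain ⟨C, hC, h⟩ := he.exists_gradNorm_le hβ'
    exact ⟨C, hC, fun _ D => ENNReal.toReal_le_of_le_ofReal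
      (mul_nonneg hC (Real.sqrt_nonneg _)) (h D)⟩
  choose C hC h using h1
  refine ⟨∑ β ∈ indicesLE d m, C β, Finset.sum_nonneg fun β _ => hC β, fun D β hβ =>
    (h β hβ D).trans ?_⟩
  gcongr
  exact Finset.single_le_sum (f := C) (fun β _ => hC β) hβ

/-- The jet of the test function `ρ^{2m} f` is `ρ^m` times a jet that differs from `ρ^m ∂^α f` by
lower order terms. The common factor `ρ^m` can be moved to the other argument of the form. -/
lemma exists_factorJet (m : ℕ) :
    ∃ (G : CutoffDatum d N K → MIndex d → E d → V N) (C : ℝ), 0 ≤ C ∧ ∀ D : CutoffDatum d N K,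
      IsTestJet (G D) ∧ ∀ α ∈ indicesLE d m,
        mderiv α (D.ρ ^ (2 * m) • D.f) = D.ρ ^ m • (D.ρ ^ m • mderiv α D.f + G D α) ∧
        (gradNorm (m - order α) (G D α)).toReal ≤ C * √(D.low m) := by
  have h1 : ∀ α : MIndex d, ∃ (g : CutoffDatum d N K → E d → V N) (C : ℝ), 0 ≤ C ∧
      ∀ D : CutoffDatum d N K, (ContDiff ℝ ∞ (g D) ∧ HasCompactSupport (g D)) ∧
        (α ∈ indicesLE d m →
        mderiv α (D.ρ ^ (2 * m) • D.f) = D.ρ ^ m • (D.ρ ^ m • mderiv α D.f + g D) ∧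
        (gradNorm (m - order α) (g D)).toReal ≤ C * √(D.low m)) := by
    intro α
    by_cases hα : α ∈ indicesLE d m
    swap
    · exact ⟨fun _ => 0, 0, le_rfl, fun D => ⟨⟨contDiff_const, HasCompactSupport.zero⟩,
        fun h => absurd h hα⟩⟩
    have hα' := mem_indicesLE.1 hα
    obtain ⟨g, hg, he⟩ := exists_isErr_mderiv_sq (m := m) (P := fun D : CutoffDatum d N K => D.P)
      (f := fun D : CutoffDatum d N K => D.f) (fun D => D.hρ.nonneg) (fun D => D.hr.le)
      isSymbol_cutoff (fun D => D.hP) (fun D => D.hf) α hα'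
    obtain ⟨C, hC, h⟩ := hg.exists_gradNorm_le hα'
    exact ⟨g, C, hC, fun D => ⟨⟨hg.1 D, hg.hasCompactSupport hα' D⟩, fun _ => ⟨he D,
      ENNReal.toReal_le_of_le_ofReal (mul_nonneg hC (Real.sqrt_nonneg _)) (h D)⟩⟩⟩
  choose g C hC h using h1
  refine ⟨fun D α => g α D, ∑ α ∈ indicesLE d m, C α, Finset.sum_nonneg fun β _ => hC β,
    fun D => ⟨fun α => (h α D).1, fun α hα => ⟨((h α D).2 hα).1, ((h α D).2 hα).2.trans ?_⟩⟩⟩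
  gcongr
  exact Finset.single_le_sum (f := C) (fun β _ => hC β) hα

lemma gradNorm_zero (f : E d → V N) : gradNorm 0 f = eLpNorm f 2 volume := by
  have : indicesEQ d 0 = {0} := by
    ext γ; rw [mem_indicesEQ, order_eq_zero, Finset.mem_singleton]
  simp [gradNorm, this]

lemma jetNorm_le_of_forall {F : MIndex d → E d → V N} {c : ℝ}
    (h : ∀ α ∈ indicesLE d m, (gradNorm (m - order α) (F α)).toReal ≤ c) :
    jetNorm m F ≤ (indicesLE d m).card * c := by
  refine (Finset.sum_le_sum h).trans (le_of_eq ?_)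
  rw [Finset.sum_const, nsmul_eq_mul]

lemma jetNorm_nonneg (F : MIndex d → E d → V N) : 0 ≤ jetNorm m F :=
  Finset.sum_nonneg fun _ _ => ENNReal.toReal_nonneg

lemma IsTestJet.sub {F G : MIndex d → E d → V N} (hF : IsTestJet F) (hG : IsTestJet G) :
    IsTestJet (F - G) :=
  fun α => ⟨(hF α).1.sub (hG α).1, (hF α).2.sub (hG α).2⟩

lemma jetNorm_sub_le {F G : MIndex d → E d → V N} (hF : IsTestJet F) (hG : IsTestJet G) :
    jetNorm m (F - G) ≤ jetNorm m F + jetNorm m G := by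
  unfold jetNorm
  rw [← Finset.sum_add_distrib]
  refine Finset.sum_le_sum fun α _ => ?_
  have h1 := gradNorm_ne_top (hF α).1 (hF α).2 (m - order α)
  have h2 := gradNorm_ne_top (hG α).1 (hG α).2 (m - order α)
  rw [← ENNReal.toReal_add h1 h2]
  refine ENNReal.toReal_mono (ENNReal.add_ne_top.2 ⟨h1, h2⟩) ?_
  unfold gradNorm
  rw [← Finset.sum_add_distrib]
  refine Finset.sum_le_sum fun γ _ => ?_
  rw [Pi.sub_apply, mderiv_sub _ (hF α).1 (hG α).1]
  exact eLpNorm_sub_le (contDiff_mderiv γ (hF α).1).continuous.aestronglyMeasurable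
    (contDiff_mderiv γ (hG α).1).continuous.aestronglyMeasurable (by norm_num)

lemma integral_norm_sq_eq {f : E d → V N} (hf : Continuous f) (hc : HasCompactSupport f) :
    ∫ x, ‖f x‖ ^ 2 = (eLpNorm f 2 volume).toReal ^ 2 := by
  rw [eLpNorm_two_eq_sqrt (hf.memLp_of_hasCompactSupport hc),
    ENNReal.toReal_ofReal (Real.sqrt_nonneg _),
    Real.sq_sqrt (integral_nonneg fun x => by positivity)]

lemma gradNorm_toReal_sq_le {f : E d → V N} (hf : ContDiff ℝ ∞ f) (hc : HasCompactSupport f)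
    (k : ℕ) : (gradNorm k f).toReal ^ 2 ≤
      (indicesEQ d k).card * ∑ γ ∈ indicesEQ d k, ∫ x, ‖mderiv γ f x‖ ^ 2 := by
  have h : ∀ γ ∈ indicesEQ d k, eLpNorm (mderiv γ f) 2 volume ≠ ⊤ := fun γ _ =>
    ((contDiff_mderiv γ hf).continuous.memLp_of_hasCompactSupport
      (hasCompactSupport_mderiv γ hc)).2.ne
  rw [gradNorm, ENNReal.toReal_sum h]
  refine sq_sum_le_card_mul_sum_sq.trans (le_of_eq ?_)
  congr 1
  exact Finset.sum_congr rfl fun γ _ => (integral_norm_sq_eq (contDiff_mderiv γ hf).continuous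
    (hasCompactSupport_mderiv γ hc)).symm

/-- The derivatives of order `m` of the test function `ρ^{2m} f` are bounded by the weighted
derivatives of `f`. This bounds the norm of the test function, hence the action of the functional.
-/
lemma exists_gradNorm_test_le (m : ℕ) :
    ∃ C : ℝ, 0 ≤ C ∧ ∀ D : CutoffDatum d N K,
      gradNorm m (D.ρ ^ (2 * m) • D.f) ≤ ENNReal.ofReal
        (C * (√(wInt m D.r D.ρ univ (fun γ => mderiv γ D.f) m) + √(D.low m))) := by
  obtain ⟨G, C, hC, h⟩ := exists_factorJet (d := d) (N := N) (K := K) m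
  refine ⟨(indicesEQ d m).card * (1 + C), by positivity, fun D => ?_⟩
  set X := √(wInt m D.r D.ρ univ (fun γ => mderiv γ D.f) m) with hX
  set z := √(D.low m) with hz
  have hX0 : 0 ≤ X := Real.sqrt_nonneg _
  have hz0 : 0 ≤ z := Real.sqrt_nonneg _
  have hterm : ∀ α ∈ indicesEQ d m, eLpNorm (mderiv α (D.ρ ^ (2 * m) • D.f)) 2 volume ≤
      ENNReal.ofReal ((1 + C) * (X + z)) := by
    intro α hα
    have hα' : α ∈ indicesLE d m := mem_indicesLE.2 (mem_indicesEQ.1 hα).le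
    obtain ⟨h1, h2⟩ := (h D).2 α hα'
    obtain ⟨h3, h4⟩ := (h D).1 α
    have c1 : Continuous fun x => D.ρ x ^ m • mderiv α D.f x :=
      (D.hρ.smooth.continuous.pow m).smul (contDiff_mderiv α D.hf).continuous
    rw [mem_indicesEQ.1 hα, Nat.sub_self, gradNorm_zero] at h2
    have e1 : eLpNorm (mderiv α (D.ρ ^ (2 * m) • D.f)) 2 volume ≤
        eLpNorm ((fun x => D.ρ x ^ m • mderiv α D.f x) + G D α) 2 volume := by
      refine eLpNorm_mono fun x => ?_
      rw [h1]
      simp only [Pi.smul_apply', Pi.pow_apply, Pi.add_apply]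
      rw [norm_smul, Real.norm_of_nonneg (pow_nonneg (D.hρ.nonneg x) m)]
      exact mul_le_of_le_one_left (norm_nonneg _) (pow_le_one₀ (D.hρ.nonneg x) (D.hρ.le_one x))
    have e2 := eLpNorm_weighted_le_sqrt (m := m) D (mem_indicesEQ.1 hα) univ
    simp only [Nat.sub_self, pow_zero, ENNReal.ofReal_one, one_mul, Measure.restrict_univ] at e2
    have e3 : eLpNorm (G D α) 2 volume ≤ ENNReal.ofReal (C * z) :=
      (ENNReal.le_ofReal_iff_toReal_le (h3.continuous.memLp_of_hasCompactSupport h4).2.ne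
        (by positivity)).2 h2
    refine e1.trans ((eLpNorm_add_le c1.aestronglyMeasurable h3.continuous.aestronglyMeasurable
      (by norm_num)).trans ((add_le_add e2 e3).trans ?_))
    rw [← ENNReal.ofReal_add hX0 (by positivity)]
    refine ENNReal.ofReal_le_ofReal ?_
    nlinarith [mul_nonneg hC hX0]
  refine (Finset.sum_le_sum hterm).trans (le_of_eq ?_)
  rw [Finset.sum_const, nsmul_eq_mul, mul_assoc, ENNReal.ofReal_mul (Nat.cast_nonneg _),
    ENNReal.ofReal_natCast]

/-- The form on `ρ^m f` differs from the form on the pair `ρ^{2m} f`, `f` only by products in which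
at least one factor is of lower order. -/
lemma exists_form_commutator (d N m : ℕ) (K : ℕ → ℝ) (CA : ℝ≥0) :
    ∃ C : ℝ, 0 ≤ C ∧ ∀ (D : CutoffDatum d N K) (A : Coeff d N), FormBound m A CA →
      ‖jetForm m A (fun α => mderiv α (D.ρ ^ m • D.f)) (fun α => mderiv α (D.ρ ^ m • D.f))‖ ≤
      ‖jetForm m A (fun α => mderiv α (D.ρ ^ (2 * m) • D.f)) (fun α => mderiv α D.f)‖ +
        C * ((gradNorm m (D.ρ ^ m • D.f)).toReal * √(D.low m) + D.low m) := by
  obtain ⟨C₁, hC₁, h₁⟩ := exists_commJet_bound (d := d) (N := N) (K := K) m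
  obtain ⟨G, C₂, hC₂, h₂⟩ := exists_factorJet (d := d) (N := N) (K := K) m
  set c : ℝ := ((indicesLE d m).card : ℝ) with hc
  have hc0 : 0 ≤ c := Nat.cast_nonneg _
  refine ⟨N * N * CA * (c * (c * C₁) + c * (C₁ + C₂) * c + c * (C₁ + C₂) * (c * C₁)),
    by positivity, fun D A hA => ?_⟩
  set z := √(D.low m) with hz
  have hz0 : 0 ≤ z := Real.sqrt_nonneg _
  have hzz : z * z = D.low m := Real.mul_self_sqrt (lowerOrder_nonneg m D.hr.le _ _ _)
  set y := (gradNorm m (D.ρ ^ m • D.f)).toReal with hy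
  have hy0 : 0 ≤ y := ENNReal.toReal_nonneg
  set W : MIndex d → E d → V N := fun α => mderiv α (D.ρ ^ m • D.f) with hW
  have tW : IsTestJet W := isTestJet_mderiv (D.contDiff_pow_smul m) (D.hasCompactSupport_pow_smul m)
  have tE : IsTestJet (commJet m D) := isTestJet_commJet D
  have tG : IsTestJet (G D) := (h₂ D).1
  have tH : IsTestJet (G D - commJet m D) := tG.sub tE
  have nW : jetNorm m W ≤ c * y :=
    jetNorm_mderiv_le (D.contDiff_pow_smul m) (D.hasCompactSupport_pow_smul m)
  have nE : jetNorm m (commJet m D) ≤ c * (C₁ * z) := jetNorm_le_of_forall (h₁ D)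
  have nG : jetNorm m (G D) ≤ c * (C₂ * z) :=
    jetNorm_le_of_forall fun α hα => ((h₂ D).2 α hα).2
  have nH : jetNorm m (G D - commJet m D) ≤ c * (C₁ + C₂) * z :=
    (jetNorm_sub_le tG tE).trans (by linarith)
  -- the factor `ρ^m` of the derivatives of the test function is moved to the other argument
  have key : jetForm m A (fun α => mderiv α (D.ρ ^ (2 * m) • D.f)) (fun α => mderiv α D.f) =
      jetForm m A (W + (G D - commJet m D)) (W - commJet m D) := by
    unfold jetForm
    refine Finset.sum_congr rfl fun j _ => Finset.sum_congr rfl fun k _ =>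
      Finset.sum_congr rfl fun α hα => Finset.sum_congr rfl fun β _ => ?_
    refine integral_congr_ae (Filter.Eventually.of_forall fun x => ?_)
    simp only [((h₂ D).2 α hα).1, hW, commJet, Pi.add_apply, Pi.sub_apply, Pi.smul_apply',
      Pi.pow_apply, PiLp.smul_apply, PiLp.add_apply, PiLp.sub_apply, Complex.real_smul, map_mul,
      map_add, map_sub, Complex.conj_ofReal]
    ring
  have tWE : IsTestJet (W - commJet m D) := tW.sub tE
  rw [key, jetForm_add_left hA tW tH tWE, jetForm_sub_right hA tW tW tE,
    jetForm_sub_right hA tH tW tE]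
  have e1 := norm_jetForm_le hA tW tE
  have e2 := norm_jetForm_le hA tH tW
  have e3 := norm_jetForm_le hA tH tE
  have hN : 0 ≤ (N : ℝ) * N * CA := by positivity
  have b1 : jetNorm m W * jetNorm m (commJet m D) ≤ (c * y) * (c * (C₁ * z)) :=
    mul_le_mul nW nE (jetNorm_nonneg _) (by positivity)
  have b2 : jetNorm m (G D - commJet m D) * jetNorm m W ≤ (c * (C₁ + C₂) * z) * (c * y) :=
    mul_le_mul nH nW (jetNorm_nonneg _) (by positivity)
  have b3 : jetNorm m (G D - commJet m D) * jetNorm m (commJet m D) ≤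
      (c * (C₁ + C₂) * z) * (c * (C₁ * z)) :=
    mul_le_mul nH nE (jetNorm_nonneg _) (by positivity)
  have e1' := e1.trans (mul_le_mul_of_nonneg_left b1 hN)
  have e2' := e2.trans (mul_le_mul_of_nonneg_left b2 hN)
  have e3' := e3.trans (mul_le_mul_of_nonneg_left b3 hN)
  set a0 := jetForm m A W W
  set a1 := jetForm m A W (commJet m D)
  set a2 := jetForm m A (G D - commJet m D) W
  set a3 := jetForm m A (G D - commJet m D) (commJet m D)
  have tri : ‖a0‖ ≤ ‖a0 - a1 + (a2 - a3)‖ + (‖a1‖ + ‖a2‖ + ‖a3‖) := by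
    have : a0 = (a0 - a1 + (a2 - a3)) + (a1 - a2 + a3) := by ring
    calc ‖a0‖ = ‖(a0 - a1 + (a2 - a3)) + (a1 - a2 + a3)‖ := by rw [← this]
      _ ≤ _ := (norm_add_le _ _).trans (by
        gcongr
        exact (norm_add_le _ _).trans (by gcongr; exact norm_sub_le _ _))
  refine tri.trans ?_
  gcongr
  rw [← hzz]
  have p1 : 0 ≤ (N : ℝ) * N * CA * (c * (c * C₁) + c * (C₁ + C₂) * c) * (z * z) := by positivity
  have p2 : 0 ≤ (N : ℝ) * N * CA * (c * (C₁ + C₂) * (c * C₁)) * (y * z) := by positivity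
  linarith

/-- Young's inequality, with the square of `y` absorbed into the coercive term `lam * W`. -/
lemma young_absorb {lam c W y z C : ℝ} (hlam : 0 < lam) (hc : 0 ≤ c) (hW : 0 ≤ W)
    (hy : y ^ 2 ≤ c * W) : C * (y * z) ≤ lam / 2 * W + C ^ 2 * c / (2 * lam) * z ^ 2 := by
  rcases hc.eq_or_lt with h0 | h0
  · have : y = 0 := by
      have : y ^ 2 ≤ 0 := by rw [← h0] at hy; simpa using hy
      exact pow_eq_zero_iff (two_ne_zero) |>.1 (le_antisymm this (sq_nonneg y))
    rw [this, zero_mul, mul_zero]; positivity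
  · have h3 : lam / (2 * c) * y ^ 2 ≤ lam / 2 * W := by
      calc _ ≤ lam / (2 * c) * (c * W) := by gcongr
        _ = _ := by field_simp
    have e : lam / (2 * c) * y ^ 2 + C ^ 2 * c / (2 * lam) * z ^ 2 - C * (y * z) =
        1 / (2 * c * lam) * (lam * y - C * c * z) ^ 2 := by
      field_simp; ring
    have e' : 0 ≤ 1 / (2 * c * lam) * (lam * y - C * c * z) ^ 2 := by positivity
    linarith

/-- Up to lower order terms, `ρ^m ∇^m f` is bounded by `∇^m (ρ^m f)`. -/
lemma exists_principal_le (d N m : ℕ) (K : ℕ → ℝ) :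
    ∃ C : ℝ, 0 ≤ C ∧ ∀ D : CutoffDatum d N K,
      wInt m D.r D.ρ univ (fun γ => mderiv γ D.f) m ≤
        2 * (∑ α ∈ indicesEQ d m, ∫ x, ‖mderiv α (D.ρ ^ m • D.f) x‖ ^ 2) + C * D.low m := by
  obtain ⟨C₁, hC₁, h₁⟩ := exists_commJet_bound (d := d) (N := N) (K := K) m
  set c : ℝ := ((indicesEQ d m).card : ℝ) with hc
  have hc0 : 0 ≤ c := Nat.cast_nonneg _
  refine ⟨2 * c * C₁ ^ 2, by positivity, fun D => ?_⟩
  set Z := D.low m with hZ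
  have hZ0 : 0 ≤ Z := lowerOrder_nonneg m D.hr.le _ _ _
  set w := D.ρ ^ m • D.f with hw
  have hws : ContDiff ℝ ∞ w := D.contDiff_pow_smul m
  have hwc : HasCompactSupport w := D.hasCompactSupport_pow_smul m
  have hterm : ∀ α ∈ indicesEQ d m, ∫ x, D.ρ x ^ (2 * m) * ‖mderiv α D.f x‖ ^ 2 ≤
      2 * (∫ x, ‖mderiv α w x‖ ^ 2) + 2 * (C₁ ^ 2 * Z) := by
    intro α hα
    have hα' := mem_indicesEQ.1 hα
    have hE := h₁ D α (mem_indicesLE.2 hα'.le)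
    obtain ⟨hEs, hEc⟩ := isTestJet_commJet (m := m) D α
    rw [hα', Nat.sub_self, gradNorm_zero] at hE
    have hE2 : ∫ x, ‖commJet m D α x‖ ^ 2 ≤ C₁ ^ 2 * Z := by
      rw [integral_norm_sq_eq hEs.continuous hEc, ← Real.sq_sqrt hZ0, ← mul_pow]
      exact pow_le_pow_left₀ ENNReal.toReal_nonneg hE 2
    have i1 : Integrable fun x => ‖mderiv α w x‖ ^ 2 :=
      ((contDiff_mderiv α hws).continuous.memLp_of_hasCompactSupport
        (hasCompactSupport_mderiv α hwc)).integrable_norm_pow (by norm_num)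
    have i2 : Integrable fun x => ‖commJet m D α x‖ ^ 2 :=
      (hEs.continuous.memLp_of_hasCompactSupport hEc).integrable_norm_pow (by norm_num)
    calc ∫ x, D.ρ x ^ (2 * m) * ‖mderiv α D.f x‖ ^ 2
        ≤ ∫ x, (2 * ‖mderiv α w x‖ ^ 2 + 2 * ‖commJet m D α x‖ ^ 2) := by
          refine integral_mono_of_nonneg (Filter.Eventually.of_forall fun x => ?_)
            ((i1.const_mul 2).add (i2.const_mul 2)) (Filter.Eventually.of_forall fun x => ?_)
          · have := D.hρ.nonneg x
            simp only [Pi.zero_apply]; positivity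
          · have e : D.ρ x ^ m • mderiv α D.f x = mderiv α w x - commJet m D α x := by
              simp [commJet, hw]
            have e2 : D.ρ x ^ (2 * m) * ‖mderiv α D.f x‖ ^ 2 =
                ‖D.ρ x ^ m • mderiv α D.f x‖ ^ 2 := by
              rw [norm_smul, Real.norm_eq_abs, mul_pow, sq_abs]; ring
            have e3 := norm_sub_le (mderiv α w x) (commJet m D α x)
            simp only [e2, e]
            nlinarith [sq_nonneg (‖mderiv α w x‖ - ‖commJet m D α x‖),
              norm_nonneg (mderiv α w x - commJet m D α x)]
      _ = 2 * (∫ x, ‖mderiv α w x‖ ^ 2) + 2 * ∫ x, ‖commJet m D α x‖ ^ 2 := by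
          rw [integral_add (i1.const_mul 2) (i2.const_mul 2), integral_const_mul,
            integral_const_mul]
      _ ≤ _ := by linarith
  simp only [wInt, Nat.sub_self, mul_zero, pow_zero, one_mul, Measure.restrict_univ]
  refine (Finset.sum_le_sum hterm).trans (le_of_eq ?_)
  rw [Finset.sum_add_distrib, ← Finset.mul_sum, Finset.sum_const, nsmul_eq_mul]
  ring

/-- The Caccioppoli inequality for smooth functions, with the form applied to the test function
`ρ^{2m} f` on the right-hand side. -/
lemma exists_smooth_caccioppoli (d N m : ℕ) (K : ℕ → ℝ) (CA : ℝ≥0) {lam : ℝ} (hlam : 0 < lam) :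
    ∃ C : ℝ, 0 ≤ C ∧ ∀ (D : CutoffDatum d N K) (A : Coeff d N) (δ : ℝ), 0 ≤ δ → FormBound m A CA →
      WeakGarding m A lam δ →
      wInt m D.r D.ρ univ (fun γ => mderiv γ D.f) m ≤ C * (δ * (∫ x, ‖D.ρ x ^ m • D.f x‖ ^ 2) +
        ‖jetForm m A (fun α => mderiv α (D.ρ ^ (2 * m) • D.f)) (fun α => mderiv α D.f)‖ +
        D.low m) := by
  obtain ⟨C₁, hC₁, h₁⟩ := exists_principal_le d N m K
  obtain ⟨C₂, hC₂, h₂⟩ := exists_form_commutator d N m K CA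
  set c : ℝ := ((indicesEQ d m).card : ℝ) with hc
  have hc0 : 0 ≤ c := Nat.cast_nonneg _
  set Q : ℝ := 1 + C₂ + C₂ ^ 2 * c / (2 * lam) with hQ
  have hQ1 : 1 ≤ Q := by
    have : 0 ≤ C₂ ^ 2 * c / (2 * lam) := by positivity
    linarith
  have hCnn : 0 ≤ 4 / lam * Q + C₁ := by
    have : 0 ≤ Q := by linarith
    positivity
  refine ⟨4 / lam * Q + C₁, hCnn, fun D A δ hδ hA hG => ?_⟩
  set Z := D.low m with hZ
  have hZ0 : 0 ≤ Z := lowerOrder_nonneg m D.hr.le _ _ _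
  set a := ‖jetForm m A (fun α => mderiv α (D.ρ ^ (2 * m) • D.f)) (fun α => mderiv α D.f)‖ with ha
  have ha0 : 0 ≤ a := norm_nonneg _
  set w := D.ρ ^ m • D.f with hw
  have hws : ContDiff ℝ ∞ w := D.contDiff_pow_smul m
  have hwc : HasCompactSupport w := D.hasCompactSupport_pow_smul m
  set I := ∫ x, ‖D.ρ x ^ m • D.f x‖ ^ 2 with hI
  set W := ∑ α ∈ indicesEQ d m, ∫ x, ‖mderiv α w x‖ ^ 2 with hW
  have hW0 : 0 ≤ W := Finset.sum_nonneg fun α _ => integral_nonneg fun x => by positivity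
  set y := (gradNorm m w).toReal with hy
  have hy2 : y ^ 2 ≤ c * W := gradNorm_toReal_sq_le hws hwc m
  have hg : lam * W - δ * I ≤ a + C₂ * (y * √Z + Z) :=
    ((hG w hws hwc).trans (Complex.re_le_norm _)).trans (h₂ D A hA)
  have hyz : C₂ * (y * √Z) ≤ lam / 2 * W + C₂ ^ 2 * c / (2 * lam) * Z := by
    have := young_absorb (z := √Z) (C := C₂) hlam hc0 hW0 hy2
    rwa [Real.sq_sqrt hZ0] at this
  have hδI : lam * W ≤ 2 * (δ * I + a + (C₂ + C₂ ^ 2 * c / (2 * lam)) * Z) := by linarith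
  have hsum0 : 0 ≤ δ * I + a + (C₂ + C₂ ^ 2 * c / (2 * lam)) * Z := by
    have := mul_nonneg hlam.le hW0
    linarith
  have hW2 : W ≤ 2 / lam * (δ * I + a + (C₂ + C₂ ^ 2 * c / (2 * lam)) * Z) := by
    rw [div_mul_eq_mul_div, le_div_iff₀ hlam, mul_comm]; exact hδI
  have hI0 : 0 ≤ δ * I := mul_nonneg hδ (integral_nonneg fun x => by positivity)
  have hfin : δ * I + a + (C₂ + C₂ ^ 2 * c / (2 * lam)) * Z ≤ Q * (δ * I + a + Z) := by
    have h5 : 0 ≤ (Q - 1) * (δ * I + a) := mul_nonneg (by linarith) (by linarith)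
    have h6 : (C₂ + C₂ ^ 2 * c / (2 * lam)) * Z = (Q - 1) * Z := by rw [hQ]; ring
    rw [h6]
    linarith
  have h7 : 2 / lam * (δ * I + a + (C₂ + C₂ ^ 2 * c / (2 * lam)) * Z) ≤
      2 / lam * (Q * (δ * I + a + Z)) := mul_le_mul_of_nonneg_left hfin (by positivity)
  have h8 : 0 ≤ C₁ * (δ * I + a) := mul_nonneg (by positivity) (by linarith)
  calc _ ≤ 2 * W + C₁ * Z := h₁ D
    _ ≤ 2 * (2 / lam * (Q * (δ * I + a + Z))) + C₁ * (δ * I + a + Z) := by linarith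
    _ = _ := by ring

end SmoothCaccioppoli

/-! ### Basic properties of weak derivatives -/

section WeakDerivativeBasics

variable {d N : ℕ} {Ω Ω' : Set (E d)} {α β : MIndex d} {u v w : E d → V N}

/-- An integral over `Ω` against a function supported in `Ω` is an integral over the whole space. -/
lemma setIntegral_smul_eq {η : E d → ℝ} (hη : tsupport η ⊆ Ω) (u : E d → V N) :
    ∫ x in Ω, η x • u x = ∫ x, η x • u x := by
  refine setIntegral_eq_integral_of_forall_compl_eq_zero fun x hx => ?_
  rw [image_eq_zero_of_notMem_tsupport fun h => hx (hη h), zero_smul]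

lemma IsWeakDeriv.mono (h : IsWeakDeriv α Ω u v) (hΩ : Ω' ⊆ Ω) : IsWeakDeriv α Ω' u v := by
  refine ⟨h.1.mono_set hΩ, h.2.1.mono_set hΩ, fun η hη hc hs => ?_⟩
  have := h.2.2 η hη hc (hs.trans hΩ)
  rw [setIntegral_smul_eq ((tsupport_mderiv α hη).trans hs), setIntegral_smul_eq hs]
  rwa [setIntegral_smul_eq ((tsupport_mderiv α hη).trans (hs.trans hΩ)),
    setIntegral_smul_eq (hs.trans hΩ)] at this

lemma integrable_smul_of_locallyIntegrableOn (hu : LocallyIntegrableOn u Ω) {η : E d → ℝ}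
    (hη : Continuous η) (hc : HasCompactSupport η) (hs : tsupport η ⊆ Ω) :
    Integrable fun x => η x • u x := by
  have h1 : IntegrableOn u (tsupport η) := hu.integrableOn_compact_subset hs hc
  have h2 : IntegrableOn (fun x => η x • u x) (tsupport η) :=
    h1.continuousOn_smul hη.continuousOn hc
  refine (integrableOn_iff_integrable_of_support_subset fun x hx => ?_).1 h2
  by_contra hn
  exact hx (by simp [image_eq_zero_of_notMem_tsupport hn])

lemma IsWeakDeriv.ae_eq (hΩ : IsOpen Ω) (h : IsWeakDeriv α Ω u v) (h' : IsWeakDeriv α Ω u w) :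
    v =ᵐ[volume.restrict Ω] w := by
  have h0 : ∀ᵐ x, x ∈ Ω → (v - w) x = 0 := by
    refine hΩ.ae_eq_zero_of_integral_contDiff_smul_eq_zero (h.2.1.sub h'.2.1) fun η hη hc hs => ?_
    have e := h.2.2 η hη hc hs
    have e' := h'.2.2 η hη hc hs
    rw [e] at e'
    have e2 := smul_right_injective (V N) (pow_ne_zero (order α) (neg_ne_zero.2 one_ne_zero)) e'
    rw [setIntegral_smul_eq hs, setIntegral_smul_eq hs] at e2
    simp only [Pi.sub_apply, smul_sub]
    rw [integral_sub (integrable_smul_of_locallyIntegrableOn h.2.1 hη.continuous hc hs)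
      (integrable_smul_of_locallyIntegrableOn h'.2.1 hη.continuous hc hs), e2, sub_self]
  rw [Filter.EventuallyEq, ae_restrict_iff' hΩ.measurableSet]
  filter_upwards [h0] with x hx hxΩ
  exact sub_eq_zero.1 (hx hxΩ)

lemma IsWeakDeriv.weakDeriv_ae_eq (hΩ : IsOpen Ω) (h : IsWeakDeriv α Ω u v) :
    weakDeriv α Ω u =ᵐ[volume.restrict Ω] v := by
  have hex : ∃ v, IsWeakDeriv α Ω u v := ⟨v, h⟩
  rw [weakDeriv, dif_pos hex]
  exact hex.choose_spec.ae_eq hΩ h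

lemma isWeakDeriv_weakDeriv (h : ∃ v, IsWeakDeriv α Ω u v) :
    IsWeakDeriv α Ω u (weakDeriv α Ω u) := by
  rw [weakDeriv, dif_pos h]
  exact h.choose_spec

lemma isWeakDeriv_zero (hu : LocallyIntegrableOn u Ω) : IsWeakDeriv 0 Ω u u :=
  ⟨hu, hu, fun η _ _ _ => by simp⟩

lemma locallyIntegrableOn_congr (hΩ : IsOpen Ω) (hu : LocallyIntegrableOn u Ω)
    (h : u =ᵐ[volume.restrict Ω] v) : LocallyIntegrableOn v Ω := by
  rw [locallyIntegrableOn_iff hΩ.isLocallyClosed] at hu ⊢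
  intro k hk hkc
  exact (hu k hk hkc).congr (ae_restrict_of_ae_restrict_of_subset hk h)

lemma IsWeakDeriv.congr (hΩ : IsOpen Ω) (h : IsWeakDeriv α Ω u v) {u' v' : E d → V N}
    (hu : u =ᵐ[volume.restrict Ω] u') (hv : v =ᵐ[volume.restrict Ω] v') :
    IsWeakDeriv α Ω u' v' := by
  refine ⟨locallyIntegrableOn_congr hΩ h.1 hu, locallyIntegrableOn_congr hΩ h.2.1 hv,
    fun η hη hc hs => ?_⟩
  have e := h.2.2 η hη hc hs
  rw [integral_congr_ae (hu.mono fun x hx => by simp only; rw [hx] :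
      (fun x => mderiv α η x • u x) =ᵐ[volume.restrict Ω] fun x => mderiv α η x • u' x),
    integral_congr_ae (hv.mono fun x hx => by simp only; rw [hx] :
      (fun x => η x • v x) =ᵐ[volume.restrict Ω] fun x => η x • v' x)] at e
  exact e

/-- Integration against a bounded function supported in `K` is continuous for convergence in
`L^p(K)`. -/
lemma tendsto_integral_smul {K : Set (E d)} (hK : IsCompact K) {p : ℝ≥0∞} (hp : 1 ≤ p)
    {f : ℕ → E d → V N} {g : E d → V N} {η : E d → ℝ} (hη : Continuous η)
    (hc : HasCompactSupport η) (hs : tsupport η ⊆ K) (hf : ∀ n, IntegrableOn (f n) K)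
    (hg : IntegrableOn g K)
    (h : Filter.Tendsto (fun n => eLpNorm (f n - g) p (volume.restrict K)) Filter.atTop (nhds 0)) :
    Filter.Tendsto (fun n => ∫ x, η x • f n x) Filter.atTop (nhds (∫ x, η x • g x)) := by
  have hfin : IsFiniteMeasure (volume.restrict K) := ⟨by simpa using hK.measure_lt_top⟩
  obtain ⟨C, hC⟩ : ∃ C, ∀ x, ‖η x‖ ≤ C := hη.bounded_above_of_compact_support hc
  have hC0 : 0 ≤ C := (norm_nonneg _).trans (hC 0)
  have hint : ∀ w : E d → V N, IntegrableOn w K → IntegrableOn (fun x => η x • w x) K :=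
    fun w hw => hw.continuousOn_smul hη.continuousOn hK
  -- on a finite measure space, convergence in `L^p` gives convergence in `L^1`
  have h1 : Filter.Tendsto (fun n => eLpNorm (f n - g) 1 (volume.restrict K)) Filter.atTop
      (nhds 0) := by
    have hb : ∀ n, eLpNorm (f n - g) 1 (volume.restrict K) ≤
        eLpNorm (f n - g) p (volume.restrict K) *
          (volume.restrict K) univ ^ (1 / (1 : ℝ≥0∞).toReal - 1 / p.toReal) := fun n =>
      eLpNorm_le_eLpNorm_mul_rpow_measure_univ hp ((hf n).sub hg).aestronglyMeasurable
    have ht : Filter.Tendsto (fun n => eLpNorm (f n - g) p (volume.restrict K) *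
        (volume.restrict K) univ ^ (1 / (1 : ℝ≥0∞).toReal - 1 / p.toReal)) Filter.atTop
        (nhds 0) := by
      have := ENNReal.Tendsto.mul_const
        (b := (volume.restrict K) univ ^ (1 / (1 : ℝ≥0∞).toReal - 1 / p.toReal)) h (Or.inr ?_)
      · simpa using this
      · refine ENNReal.rpow_ne_top_of_nonneg ?_ (measure_ne_top _ _)
        have : 1 / p.toReal ≤ 1 := by
          by_cases hpt : p = ⊤
          · simp [hpt]
          · have h1 : 1 ≤ p.toReal := by
              have := ENNReal.toReal_mono hpt hp
              simpa using this
            rw [div_le_one (by linarith)]; exact h1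
        simp only [ENNReal.toReal_one, div_one, sub_nonneg]
        exact this
    exact tendsto_of_tendsto_of_tendsto_of_le_of_le tendsto_const_nhds ht (fun n => zero_le) hb
  simp only [← setIntegral_smul_eq hs]
  refine tendsto_integral_of_L1' _ (hint g hg).aestronglyMeasurable
    (Filter.Eventually.of_forall fun n => hint _ (hf n)) ?_
  have hb : ∀ n, eLpNorm ((fun x => η x • f n x) - fun x => η x • g x) 1 (volume.restrict K) ≤
      ENNReal.ofReal C * eLpNorm (f n - g) 1 (volume.restrict K) := fun n => by
    refine eLpNorm_le_mul_eLpNorm_of_ae_le_mul (Filter.Eventually.of_forall fun x => ?_) 1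
    simp only [Pi.sub_apply, ← smul_sub, norm_smul]
    exact mul_le_mul_of_nonneg_right (hC x) (norm_nonneg _)
  have ht := ENNReal.Tendsto.const_mul (a := ENNReal.ofReal C) h1 (Or.inr ENNReal.ofReal_ne_top)
  rw [mul_zero] at ht
  exact tendsto_of_tendsto_of_tendsto_of_le_of_le tendsto_const_nhds ht (fun n => zero_le) hb

end WeakDerivativeBasics

/-! ### Continuity of translations -/

section Translations

variable {d : ℕ} {F : Type*} [NormedAddCommGroup F]

/-- Translations are continuous in `L^p`. -/
lemma tendsto_eLpNorm_translate {p : ℝ≥0∞} (hp1 : 1 ≤ p) (hp : p ≠ ⊤) {g : E d → F}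
    (hg : MemLp g p volume) :
    Filter.Tendsto (fun y : E d => eLpNorm (fun x => g (x - y) - g x) p volume) (nhds 0)
      (nhds 0) := by
  have : Fact (1 ≤ p) := ⟨hp1⟩
  let T : E d → C(E d, E d) := fun y => ⟨fun x => x - y, by fun_prop⟩
  have hT : Continuous T := ContinuousMap.continuous_of_continuous_uncurry _ (by
    change Continuous fun z : E d × E d => z.2 - z.1
    fun_prop)
  have hTm : ∀ y, MeasurePreserving (T y) volume volume := fun y =>
    measurePreserving_sub_right volume y
  have hc := (continuous_const (y := hg.toLp g)).compMeasurePreservingLp (μ := volume) hT hTm hp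
  have h0 := (hc.tendsto 0).edist (tendsto_const_nhds
    (x := Lp.compMeasurePreserving (T 0) (hTm 0) (hg.toLp g)))
  rw [edist_self] at h0
  refine h0.congr fun y => ?_
  rw [Lp.edist_def]
  refine eLpNorm_congr_ae ?_
  have a1 := Lp.coeFn_compMeasurePreserving (hg.toLp g) (hTm y)
  have a2 := Lp.coeFn_compMeasurePreserving (hg.toLp g) (hTm 0)
  have b1 := (hTm y).quasiMeasurePreserving.ae_eq_comp hg.coeFn_toLp
  have b2 := (hTm 0).quasiMeasurePreserving.ae_eq_comp hg.coeFn_toLp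
  filter_upwards [a1, a2, b1, b2] with x h1 h2 h3 h4
  rw [Pi.sub_apply, h1, h2, h3, h4]
  simp [T]

end Translations

/-! ### Mollification -/

section Mollification

variable {d N : ℕ}

/-- The convolution of a real kernel `η` with a vector valued function `g`. -/
noncomputable def mollify (η : E d → ℝ) (g : E d → V N) : E d → V N :=
  convolution η g (ContinuousLinearMap.lsmul ℝ ℝ) volume

variable {η : E d → ℝ} {g : E d → V N}

lemma contDiff_mollify (hη : ContDiff ℝ ∞ η) (hc : HasCompactSupport η)
    (hg : LocallyIntegrable g) : ContDiff ℝ ∞ (mollify η g) :=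
  hc.contDiff_convolution_left _ hη hg

lemma pderiv_mollify (i : Fin d) (hη : ContDiff ℝ ∞ η) (hc : HasCompactSupport η)
    (hg : LocallyIntegrable g) : pderiv i (mollify η g) = mollify (pderiv i η) g := by
  funext x
  have h1 : ContDiff ℝ 1 η := hη.of_le (by exact_mod_cast le_top)
  have h := hc.hasFDerivAt_convolution_left (ContinuousLinearMap.lsmul ℝ ℝ) h1 hg x
  have hex := (hc.fderiv ℝ).convolutionExists_left
    ((ContinuousLinearMap.lsmul ℝ ℝ : ℝ →L[ℝ] V N →L[ℝ] V N).precompL (E d))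
    (h1.continuous_fderiv one_ne_zero) hg x
  rw [pderiv, mollify, h.fderiv, convolution_def, ContinuousLinearMap.integral_apply hex]
  rfl

lemma mderiv_mollify (α : MIndex d) (hη : ContDiff ℝ ∞ η) (hc : HasCompactSupport η)
    (hg : LocallyIntegrable g) : mderiv α (mollify η g) = mollify (mderiv α η) g := by
  induction α using mindex_induction with
  | h0 => simp
  | hs α i ih =>
    rw [mderiv_add_single α i (contDiff_mollify hη hc hg), mderiv_add_single α i hη, ih,
      pderiv_mollify i (contDiff_mderiv α hη) (hasCompactSupport_mderiv α hc) hg]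

lemma mderiv_comp_sub (α : MIndex d) (hη : ContDiff ℝ ∞ η) (x : E d) :
    mderiv α (fun y => η (x - y)) = fun y => (-1 : ℝ) ^ order α * mderiv α η (x - y) := by
  induction α using mindex_induction with
  | h0 => simp
  | hs α i ih =>
    have hx : ContDiff ℝ ∞ fun y => η (x - y) := hη.comp (contDiff_const.sub contDiff_id)
    rw [mderiv_add_single α i hx, mderiv_add_single α i hη, ih]
    funext y
    have hd : HasFDerivAt (mderiv α η) (fderiv ℝ (mderiv α η) (x - y)) (x - y) :=
      ((contDiff_mderiv α hη).differentiable (by simp) _).hasFDerivAt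
    have h2 : HasFDerivAt (fun y : E d => x - y) (-(ContinuousLinearMap.id ℝ (E d))) y :=
      (hasFDerivAt_id y).const_sub x
    have h3 := (hd.comp y h2).const_mul ((-1 : ℝ) ^ order α)
    rw [order_add_single, pow_succ, pderiv]
    erw [h3.fderiv]
    simp [pderiv]

/-- On a compact set well inside `Ω`, weak derivatives commute with mollification. -/
lemma mderiv_mollify_indicator {Ω : Set (E d)} {α : MIndex d} {u v : E d → V N}
    (huv : IsWeakDeriv α Ω u v) {K' : Set (E d)} (hKΩ : K' ⊆ Ω)
    (hη : ContDiff ℝ ∞ η) (hc : HasCompactSupport η) (hu : LocallyIntegrable (K'.indicator u))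
    {x : E d} (hx : ∀ y, y ∉ K' → x - y ∉ tsupport η) :
    mderiv α (mollify η (K'.indicator u)) x = mollify η (K'.indicator v) x := by
  rw [mderiv_mollify α hη hc hu, mollify, mollify, convolution_lsmul_swap, convolution_lsmul_swap]
  have hx' : ContDiff ℝ ∞ fun y => η (x - y) := hη.comp (contDiff_const.sub contDiff_id)
  have hts : tsupport (fun y => η (x - y)) ⊆ (fun y => x - y) ⁻¹' tsupport η := by
    refine closure_minimal (fun y hy => subset_tsupport η hy)
      ((isClosed_tsupport η).preimage (by fun_prop))
  have hcs : HasCompactSupport fun y => η (x - y) :=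
    hc.comp_homeomorph (Homeomorph.subLeft x)
  have e := huv.2.2 _ hx' hcs fun y hy => hKΩ (by
    by_contra hn
    exact hx y hn (hts hy))
  have hs : tsupport (fun y => η (x - y)) ⊆ Ω := fun y hy => hKΩ (by
    by_contra hn
    exact hx y hn (hts hy))
  rw [setIntegral_smul_eq ((tsupport_mderiv α hx').trans hs), setIntegral_smul_eq hs,
    mderiv_comp_sub α hη x] at e
  simp only [mul_smul, integral_smul] at e
  have e2 := smul_right_injective (V N) (pow_ne_zero (order α) (neg_ne_zero.2 one_ne_zero)) e
  have hz : ∀ (ζ : E d → ℝ), tsupport ζ ⊆ tsupport η → ∀ w : E d → V N,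
      (fun y => ζ (x - y) • K'.indicator w y) = fun y => ζ (x - y) • w y := by
    intro ζ hζ w
    funext y
    by_cases hy : y ∈ K'
    · rw [indicator_of_mem hy]
    · have : ζ (x - y) = 0 := image_eq_zero_of_notMem_tsupport fun h => hx y hy (hζ h)
      rw [this, zero_smul, zero_smul]
  rw [hz _ (tsupport_mderiv α hη) u, hz _ subset_rfl v]
  exact e2

/-- If all translates of `g` by vectors in the support of the kernel are `ε`-close to `g` in `L^p`,
so is the average of these translates. -/
lemma eLpNorm_mollify_sub_le {p : ℝ≥0∞} (hp1 : 1 ≤ p) (hp : p ≠ ⊤) (hg : MemLp g p volume)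
    (hη : Continuous η) (h0 : ∀ x, 0 ≤ η x) (h1 : ∫ x, η x = 1)
    (hc : HasCompactSupport η) {ε : ℝ≥0∞}
    (hε : ∀ y ∈ tsupport η, eLpNorm (fun x => g (x - y) - g x) p volume ≤ ε) :
    eLpNorm (mollify η g - g) p volume ≤ ε := by
  have hint : Integrable η := hη.integrable_of_hasCompactSupport hc
  set q := p.toReal with hq
  have hq1 : 1 ≤ q := by simpa using ENNReal.toReal_mono hp hp1
  have hq0 : 0 < q := by linarith
  have hp0 : p ≠ 0 := by positivity
  have hL : ∀ f : E d → V N, ∫⁻ x, ‖f x‖ₑ ^ q = eLpNorm f p volume ^ q := fun f => by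
    rw [eLpNorm_eq_lintegral_rpow_enorm_toReal hp0 hp, ← ENNReal.rpow_mul, one_div,
      inv_mul_cancel₀ hq0.ne', ENNReal.rpow_one]
  -- the probability measure with density `η`
  let ν : Measure (E d) := volume.withDensity fun y => ENNReal.ofReal (η y)
  have hmeas : Measurable fun y => ENNReal.ofReal (η y) := hη.measurable.ennreal_ofReal
  have hνp : IsProbabilityMeasure ν := ⟨by
    rw [withDensity_apply _ MeasurableSet.univ, Measure.restrict_univ,
      ← ofReal_integral_eq_lintegral_ofReal hint (Filter.Eventually.of_forall h0), h1,
      ENNReal.ofReal_one]⟩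
  have hac : ν ≪ volume := withDensity_absolutelyContinuous _ _
  have hgm := hg.aestronglyMeasurable
  have hm2 : AEStronglyMeasurable (fun z : E d × E d => g (z.1 - z.2) - g z.1)
      (volume.prod ν) := by
    have a : AEStronglyMeasurable (fun z : E d × E d => g (z.1 - z.2)) (volume.prod volume) :=
      hgm.comp_quasiMeasurePreserving (quasiMeasurePreserving_sub volume volume)
    have b : AEStronglyMeasurable (fun z : E d × E d => g z.1) (volume.prod ν) :=
      hgm.comp_quasiMeasurePreserving Measure.quasiMeasurePreserving_fst
    exact (a.mono_ac (Measure.AbsolutelyContinuous.rfl.prod hac)).sub b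
  have hsec : ∀ x, AEStronglyMeasurable (fun y => g (x - y) - g x) ν := fun x => by
    have a : AEStronglyMeasurable (fun y => g (x - y)) volume :=
      hgm.comp_quasiMeasurePreserving (quasiMeasurePreserving_sub_left volume x)
    exact (a.mono_ac hac).sub aestronglyMeasurable_const
  have hgl : LocallyIntegrable g := hg.locallyIntegrable hp1
  have hpt : ∀ x, ‖mollify η g x - g x‖ₑ ^ q ≤ ∫⁻ y, ‖g (x - y) - g x‖ₑ ^ q ∂ν := by
    intro x
    have hex : Integrable fun y => η y • g (x - y) :=
      (hc.convolutionExists_left (ContinuousLinearMap.lsmul ℝ ℝ) hη hgl x)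
    have e1 : mollify η g x - g x = ∫ y, η y • (g (x - y) - g x) := by
      simp only [smul_sub]
      rw [integral_sub hex (hint.smul_const (g x)), integral_smul_const, h1, one_smul, mollify,
        convolution_def]
      rfl
    have e2 : ‖mollify η g x - g x‖ₑ ≤ ∫⁻ y, ‖g (x - y) - g x‖ₑ ∂ν := by
      rw [e1]
      refine (enorm_integral_le_lintegral_enorm _).trans (le_of_eq ?_)
      rw [lintegral_withDensity_eq_lintegral_mul_non_measurable₀ _ hmeas.aemeasurable
        (Filter.Eventually.of_forall fun y => ENNReal.ofReal_lt_top)]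
      refine lintegral_congr fun y => ?_
      rw [enorm_smul, Pi.mul_apply, Real.enorm_eq_ofReal (h0 y)]
    have e3 := eLpNorm'_le_eLpNorm'_of_exponent_le one_pos hq1 ν (hsec x)
    rw [eLpNorm'_eq_lintegral_enorm, eLpNorm'_eq_lintegral_enorm] at e3
    simp only [ENNReal.rpow_one, ne_eq, one_ne_zero, not_false_eq_true, div_self] at e3
    have e4 := ENNReal.rpow_le_rpow (e2.trans e3) hq0.le
    rwa [← ENNReal.rpow_mul, one_div, inv_mul_cancel₀ hq0.ne', ENNReal.rpow_one] at e4
  refine (ENNReal.rpow_le_rpow_iff hq0).1 ?_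
  rw [← hL]
  calc ∫⁻ x, ‖(mollify η g - g) x‖ₑ ^ q
      ≤ ∫⁻ x, ∫⁻ y, ‖g (x - y) - g x‖ₑ ^ q ∂ν :=
        lintegral_mono hpt
    _ = ∫⁻ y, (∫⁻ x, ‖g (x - y) - g x‖ₑ ^ q) ∂ν :=
        lintegral_lintegral_swap (hm2.enorm.pow_const q)
    _ ≤ ∫⁻ _, ε ^ q ∂ν := by
        refine lintegral_mono_ae ?_
        rw [ae_withDensity_iff hmeas]
        refine Filter.Eventually.of_forall fun y hy => ?_
        rw [hL (fun x => g (x - y) - g x)]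
        refine ENNReal.rpow_le_rpow (hε y (subset_tsupport η fun h => hy ?_)) hq0.le
        rw [h, ENNReal.ofReal_zero]
    _ = ε ^ q := by simp

/-- Approximation by smooth functions: the mollifications of `u` near a compact subset `K` of `Ω`
converge on `K` together with every weak derivative of `u` that is locally in some `L^p`. The
sequence depends neither on the derivative nor on `p`. -/
lemma exists_smooth_approx {Ω K : Set (E d)} (hΩ : IsOpen Ω) (hK : IsCompact K) (hKΩ : K ⊆ Ω)
    {u : E d → V N} (hu : LocallyIntegrableOn u Ω) :
    ∃ f : ℕ → E d → V N, (∀ n, ContDiff ℝ ∞ (f n)) ∧ (∀ n, HasCompactSupport (f n)) ∧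
      ∀ α v p, 1 ≤ p → p ≠ ⊤ → IsWeakDeriv α Ω u v →
        (∀ K' ⊆ Ω, IsCompact K' → MemLp v p (volume.restrict K')) →
        Filter.Tendsto (fun n => eLpNorm (mderiv α (f n) - v) p (volume.restrict K))
          Filter.atTop (nhds 0) := by
  obtain ⟨r, hr, hrΩ⟩ := hK.exists_cthickening_subset_open hΩ hKΩ
  set K' := Metric.cthickening r K with hK'
  have hK'c : IsCompact K' := hK.cthickening
  have hK'm : MeasurableSet K' := hK'c.measurableSet
  let b : ℕ → ContDiffBump (0 : E d) := fun n =>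
    ⟨r / (n + 2) / 2, r / (n + 2), by positivity, by
      have : 0 < r / ((n : ℝ) + 2) := by positivity
      linarith⟩
  let η : ℕ → E d → ℝ := fun n => (b n).normed volume
  have hηs : ∀ n, ContDiff ℝ ∞ (η n) := fun n => (b n).contDiff_normed
  have hηc : ∀ n, HasCompactSupport (η n) := fun n => (b n).hasCompactSupport_normed
  have hηt : ∀ n, tsupport (η n) = Metric.closedBall 0 (r / (n + 2)) := fun n =>
    (b n).tsupport_normed_eq
  have hui : Integrable (K'.indicator u) :=
    (integrable_indicator_iff hK'm).2 (hu.integrableOn_compact_subset hrΩ hK'c)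
  refine ⟨fun n => mollify (η n) (K'.indicator u),
    fun n => contDiff_mollify (hηs n) (hηc n) hui.locallyIntegrable, fun n => ?_, ?_⟩
  · refine (hηc n).convolution _ ?_
    exact HasCompactSupport.intro hK'c fun x hx => indicator_of_notMem hx _
  intro α v p hp1 hp huv hv
  have hg : MemLp (K'.indicator v) p volume :=
    (memLp_indicator_iff_restrict hK'm).2 (hv K' hrΩ hK'c)
  have ht := tendsto_eLpNorm_translate hp1 hp hg
  rw [ENNReal.tendsto_nhds_zero] at ht ⊢
  intro ε hε
  obtain ⟨s, hs, hsε⟩ := Metric.eventually_nhds_iff.1 (ht ε hε)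
  obtain ⟨n₀, hn₀⟩ := exists_nat_gt (r / s)
  filter_upwards [Filter.eventually_ge_atTop n₀] with n hn
  have hrn : r / ((n : ℝ) + 2) ≤ r :=
    div_le_self hr.le (by have : (0 : ℝ) ≤ n := Nat.cast_nonneg n
                          linarith)
  have hrs : r / ((n : ℝ) + 2) < s := by
    have h1 : (n₀ : ℝ) ≤ n := by exact_mod_cast hn
    rw [div_lt_iff₀ (by positivity)]
    rw [div_lt_iff₀ hs] at hn₀
    nlinarith
  refine le_trans ?_ (eLpNorm_mollify_sub_le hp1 hp hg (hηs n).continuous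
    (fun x => (b n).nonneg_normed x) (b n).integral_normed (hηc n) (ε := ε) fun y hy => ?_)
  · refine le_trans (le_of_eq (eLpNorm_congr_ae ?_)) (eLpNorm_restrict_le _ _ _ K)
    refine (ae_restrict_iff' hK.measurableSet).2 (Filter.Eventually.of_forall fun x hx => ?_)
    have hxK' : x ∈ K' := Metric.self_subset_cthickening K hx
    rw [Pi.sub_apply, Pi.sub_apply, indicator_of_mem hxK',
      mderiv_mollify_indicator huv hrΩ (hηs n) (hηc n) hui.locallyIntegrable fun y hy h => hy ?_]
    rw [hηt, mem_closedBall_zero_iff] at h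
    refine Metric.mem_cthickening_of_dist_le y x r K hx ?_
    rw [dist_comm, dist_eq_norm]
    exact h.trans hrn
  · rw [hηt, mem_closedBall_zero_iff] at hy
    exact hsε (by rw [dist_zero_right]; exact hy.trans_lt hrs)

end Mollification

/-! ### A Poincaré inequality -/

section Poincare

variable {d : ℕ} {F : Type*} [NormedAddCommGroup F] [NormedSpace ℝ F]

lemma lintegral_sq_le {X : Type*} [MeasurableSpace X] (μ : Measure X) {f : X → ℝ≥0∞}
    (hf : AEMeasurable f μ) : (∫⁻ x, f x ∂μ) ^ 2 ≤ μ univ * ∫⁻ x, f x ^ 2 ∂μ := by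
  have h := ENNReal.lintegral_mul_le_Lp_mul_Lq μ Real.HolderConjugate.two_two
    (f := fun _ => 1) (g := f) aemeasurable_const hf
  simp only [Pi.mul_apply, one_mul, ENNReal.one_rpow, lintegral_one] at h
  have h2 := ENNReal.rpow_le_rpow h (z := 2) (by norm_num)
  rw [ENNReal.mul_rpow_of_nonneg _ _ (by norm_num), ← ENNReal.rpow_mul, ← ENNReal.rpow_mul] at h2
  norm_num at h2
  exact h2

/-- In a convex set, contraction by a factor `t ≥ 1/2` towards a point of the set increases
integrals of nonnegative functions at most by the factor `2^d`. -/
lemma lintegral_contraction_le {K : Set (E d)} (hK : MeasurableSet K) (hKc : Convex ℝ K)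
    {G : E d → ℝ≥0∞} (hG : Measurable G) {t : ℝ} (ht : 1 / 2 ≤ t) (ht1 : t ≤ 1) {y : E d}
    (hy : y ∈ K) :
    ∫⁻ x in K, G (t • x + (1 - t) • y) ≤ 2 ^ d * ∫⁻ x in K, G x := by
  have ht0 : 0 < t := by linarith
  have hGK : Measurable (K.indicator G) := hG.indicator hK
  calc ∫⁻ x in K, G (t • x + (1 - t) • y)
      ≤ ∫⁻ x, K.indicator G (t • x + (1 - t) • y) := by
        rw [← lintegral_indicator hK]
        refine lintegral_mono fun x => ?_
        by_cases hx : x ∈ K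
        · rw [indicator_of_mem hx, indicator_of_mem]
          exact hKc hx hy ht0.le (by linarith) (by ring)
        · rw [indicator_of_notMem hx]; exact zero_le
    _ = ∫⁻ z, K.indicator G (z + (1 - t) • y) ∂(Measure.map (t • ·) volume) := by
        have hm : Measurable fun z => K.indicator G (z + (1 - t) • y) :=
          hGK.comp (measurable_id.add_const _)
        rw [lintegral_map hm (measurable_const_smul t)]
    _ = ENNReal.ofReal |(t ^ d)⁻¹| * ∫⁻ z, K.indicator G (z + (1 - t) • y) := by
        rw [Measure.map_addHaar_smul _ ht0.ne', lintegral_smul_measure]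
        simp
    _ = ENNReal.ofReal |(t ^ d)⁻¹| * ∫⁻ x in K, G x := by
        rw [lintegral_add_right_eq_self (K.indicator G), lintegral_indicator hK]
    _ ≤ 2 ^ d * ∫⁻ x in K, G x := by
        gcongr
        rw [abs_of_pos (by positivity), ← inv_pow]
        rw [ENNReal.ofReal_pow (by positivity)]
        gcongr
        rw [← ENNReal.ofReal_ofNat]
        refine ENNReal.ofReal_le_ofReal ?_
        rw [inv_le_comm₀ ht0 (by norm_num)]
        simpa using ht

/-- Averages of `G` over the points that divide the segments between `x` and `y` in a fixed ratio:
one of the two contraction factors `t` and `1 - t` is at least `1/2`. -/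
lemma lintegral_segment_le {K : Set (E d)} (hK : MeasurableSet K) (hKc : Convex ℝ K)
    {G : E d → ℝ≥0∞} (hG : Measurable G) {t : ℝ} (ht0 : 0 ≤ t) (ht1 : t ≤ 1) :
    ∫⁻ x in K, ∫⁻ y in K, G (t • x + (1 - t) • y) ≤ volume K * (2 ^ d * ∫⁻ x in K, G x) := by
  have hm : Measurable fun z : E d × E d => G (t • z.1 + (1 - t) • z.2) :=
    hG.comp (by fun_prop)
  by_cases ht : 1 / 2 ≤ t
  · rw [lintegral_lintegral_swap hm.aemeasurable]
    calc ∫⁻ y in K, ∫⁻ x in K, G (t • x + (1 - t) • y)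
        ≤ ∫⁻ _ in K, 2 ^ d * ∫⁻ x in K, G x :=
          setLIntegral_mono' hK fun y hy => lintegral_contraction_le hK hKc hG ht ht1 hy
      _ = _ := by rw [lintegral_const, Measure.restrict_apply_univ, mul_comm]
  · calc ∫⁻ x in K, ∫⁻ y in K, G (t • x + (1 - t) • y)
        ≤ ∫⁻ _ in K, 2 ^ d * ∫⁻ x in K, G x :=
          setLIntegral_mono' hK fun x hx => by
            have := lintegral_contraction_le hK hKc hG (t := 1 - t) (by linarith) (by linarith) hx
            simpa [add_comm] using this
      _ = _ := by rw [lintegral_const, Measure.restrict_apply_univ, mul_comm]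

lemma enorm_sub_le_lintegral_segment [CompleteSpace F] {h : E d → F} (hh : ContDiff ℝ ∞ h)
    (x y : E d) :
    ‖h x - h y‖ₑ ≤
      ∫⁻ t in Icc (0 : ℝ) 1, ‖fderiv ℝ h (t • x + (1 - t) • y)‖ₑ * ‖x - y‖ₑ := by
  have hd : ∀ t : ℝ, HasDerivAt (fun t : ℝ => h (t • x + (1 - t) • y))
      (fderiv ℝ h (t • x + (1 - t) • y) (x - y)) t := fun t => by
    have h1 : HasDerivAt (fun t : ℝ => t • x + (1 - t) • y) (x - y) t := by
      have a := (hasDerivAt_id t).smul_const x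
      have b := ((hasDerivAt_id t).const_sub 1).smul_const y
      have := a.add b
      simp only [one_smul, neg_smul, ← sub_eq_add_neg] at this
      exact this
    exact ((hh.differentiable (by simp) _).hasFDerivAt).comp_hasDerivAt t h1
  have hcont : Continuous fun t : ℝ => fderiv ℝ h (t • x + (1 - t) • y) (x - y) :=
    ((hh.continuous_fderiv (by simp)).comp (by fun_prop)).clm_apply continuous_const
  have e := intervalIntegral.integral_eq_sub_of_hasDerivAt (a := 0) (b := 1)
    (fun t _ => hd t) (hcont.intervalIntegrable 0 1)
  simp only [one_smul, sub_self, zero_smul, add_zero, sub_zero, zero_add] at e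
  rw [← e, intervalIntegral.integral_of_le zero_le_one, ← integral_Icc_eq_integral_Ioc]
  refine (enorm_integral_le_lintegral_enorm _).trans (lintegral_mono fun t => ?_)
  exact ContinuousLinearMap.le_opENorm _ _

/-- A Poincaré inequality on convex compact sets: a function is controlled in `L^2` by its gradient
and its integral against a fixed weight. -/
lemma exists_poincare [CompleteSpace F] {K : Set (E d)} (hK : IsCompact K) (hKc : Convex ℝ K)
    {η : E d → ℝ} (hη : Continuous η) (hηK : tsupport η ⊆ K) (h1 : ∫ x, η x = 1) :
    ∃ C : ℝ≥0, ∀ h : E d → F, ContDiff ℝ ∞ h →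
      eLpNorm h 2 (volume.restrict K) ≤
        C * ((∑ i, eLpNorm (pderiv i h) 2 (volume.restrict K)) + ‖∫ x, η x • h x‖ₑ) := by
  have hKm := hK.measurableSet
  have hc : HasCompactSupport η := hK.of_isClosed_subset (isClosed_tsupport η) hηK
  have hint : Integrable η := hη.integrable_of_hasCompactSupport hc
  obtain ⟨M, hM⟩ : ∃ C, ∀ x, ‖η x‖ ≤ C := hη.bounded_above_of_compact_support hc
  obtain ⟨D, hD⟩ : ∃ D : ℝ, ∀ x ∈ K, ∀ y ∈ K, ‖x - y‖ ≤ D := by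
    obtain ⟨D, hD⟩ := (Metric.isBounded_iff.1 hK.isBounded)
    exact ⟨D, fun x hx y hy => by simpa [dist_eq_norm] using hD hx hy⟩
  have hv : volume K ≠ ⊤ := hK.measure_lt_top.ne
  set a : ℝ≥0∞ := (ENNReal.ofReal M * ENNReal.ofReal D) ^ 2 * volume K * (volume K * 2 ^ d)
  have ha : a ≠ ⊤ := by
    refine ENNReal.mul_ne_top (ENNReal.mul_ne_top (by finiteness) hv)
      (ENNReal.mul_ne_top hv (by finiteness))
  set b : ℝ≥0∞ := a ^ (1 / 2 : ℝ) + volume K ^ (1 / 2 : ℝ)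
  have hb : b ≠ ⊤ := by
    refine ENNReal.add_ne_top.2 ⟨ENNReal.rpow_ne_top_of_nonneg (by norm_num) ha,
      ENNReal.rpow_ne_top_of_nonneg (by norm_num) hv⟩
  refine ⟨b.toNNReal, fun h hh => ?_⟩
  rw [ENNReal.coe_toNNReal hb]
  set e : F := ∫ x, η x • h x with he
  set g : E d → ℝ≥0∞ := fun x => ‖fderiv ℝ h x‖ₑ with hg
  have hgc : Continuous fun x => fderiv ℝ h x := hh.continuous_fderiv (by simp)
  have hgm : Measurable g := hgc.enorm.measurable
  have hpt : ∀ x ∈ K, ‖h x - e‖ₑ ^ 2 ≤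
      (ENNReal.ofReal M * ENNReal.ofReal D) ^ 2 * volume K *
        ∫⁻ t in Icc (0 : ℝ) 1, ∫⁻ y in K, g (t • x + (1 - t) • y) ^ 2 := by
    intro x hx
    have hgm2 : Measurable fun z : E d × ℝ => g (z.2 • x + (1 - z.2) • z.1) :=
      hgm.comp (by fun_prop)
    have e1 : h x - e = ∫ y in K, η y • (h x - h y) := by
      rw [setIntegral_eq_integral_of_forall_compl_eq_zero fun y hy => by
        rw [image_eq_zero_of_notMem_tsupport fun hn => hy (hηK hn), zero_smul]]
      simp only [smul_sub]
      rw [integral_sub (hint.smul_const _), integral_smul_const, h1, one_smul]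
      exact (hη.smul hh.continuous).integrable_of_hasCompactSupport hc.smul_right
    have e2 : ‖h x - e‖ₑ ≤ ENNReal.ofReal M * ENNReal.ofReal D *
        ∫⁻ z, g (z.2 • x + (1 - z.2) • z.1)
          ∂((volume.restrict K).prod (volume.restrict (Icc (0 : ℝ) 1))) := by
      rw [e1, lintegral_prod _ hgm2.aemeasurable,
        ← lintegral_const_mul _ hgm2.lintegral_prod_right']
      refine (enorm_integral_le_lintegral_enorm _).trans (setLIntegral_mono' hKm fun y hy => ?_)
      rw [enorm_smul, mul_assoc]
      refine mul_le_mul' ?_ ?_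
      · rw [← ofReal_norm]; exact ENNReal.ofReal_le_ofReal (hM y)
      · refine (enorm_sub_le_lintegral_segment hh x y).trans ?_
        rw [lintegral_mul_const _ (by exact hgm.comp (by fun_prop)), mul_comm]
        gcongr
        rw [← ofReal_norm]; exact ENNReal.ofReal_le_ofReal (hD x hx y hy)
    calc ‖h x - e‖ₑ ^ 2 ≤ (ENNReal.ofReal M * ENNReal.ofReal D *
        ∫⁻ z, g (z.2 • x + (1 - z.2) • z.1)
          ∂((volume.restrict K).prod (volume.restrict (Icc (0 : ℝ) 1)))) ^ 2 := by gcongr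
      _ ≤ (ENNReal.ofReal M * ENNReal.ofReal D) ^ 2 * (volume K *
          ∫⁻ z, g (z.2 • x + (1 - z.2) • z.1) ^ 2
            ∂((volume.restrict K).prod (volume.restrict (Icc (0 : ℝ) 1)))) := by
          rw [mul_pow]
          gcongr
          refine (lintegral_sq_le _ hgm2.aemeasurable).trans (le_of_eq ?_)
          rw [← univ_prod_univ, Measure.prod_prod]
          simp
      _ = _ := by
          rw [lintegral_prod_symm _ (hgm2.pow_const 2).aemeasurable, mul_assoc]
  have hI : ∫⁻ x in K, ‖h x - e‖ₑ ^ 2 ≤ a * ∫⁻ x in K, g x ^ 2 := by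
    have hgm3 : Measurable fun z : (E d × ℝ) × E d =>
        g (z.1.2 • z.1.1 + (1 - z.1.2) • z.2) ^ 2 := (hgm.comp (by fun_prop)).pow_const 2
    have hm4 : Measurable fun z : E d × ℝ =>
        ∫⁻ y in K, g (z.2 • z.1 + (1 - z.2) • y) ^ 2 := hgm3.lintegral_prod_right'
    calc ∫⁻ x in K, ‖h x - e‖ₑ ^ 2
        ≤ ∫⁻ x in K, (ENNReal.ofReal M * ENNReal.ofReal D) ^ 2 * volume K *
          ∫⁻ t in Icc (0 : ℝ) 1, ∫⁻ y in K, g (t • x + (1 - t) • y) ^ 2 :=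
          setLIntegral_mono' hKm hpt
      _ = (ENNReal.ofReal M * ENNReal.ofReal D) ^ 2 * volume K *
          ∫⁻ t in Icc (0 : ℝ) 1, ∫⁻ x in K, ∫⁻ y in K, g (t • x + (1 - t) • y) ^ 2 := by
          rw [lintegral_const_mul _ hm4.lintegral_prod_right', lintegral_lintegral_swap]
          exact hm4.aemeasurable
      _ ≤ (ENNReal.ofReal M * ENNReal.ofReal D) ^ 2 * volume K *
          ∫⁻ t in Icc (0 : ℝ) 1, volume K * (2 ^ d * ∫⁻ x in K, g x ^ 2) := by
          refine mul_le_mul' le_rfl (setLIntegral_mono' measurableSet_Icc fun t ht => ?_)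
          exact lintegral_segment_le hKm hKc (hgm.pow_const 2) ht.1 ht.2
      _ = _ := by
          rw [lintegral_const]
          simp only [Measure.restrict_apply_univ, Real.volume_Icc, sub_zero, ENNReal.ofReal_one,
            mul_one, a]
          ring
  have hN : ∀ {G : Type _} [NormedAddCommGroup G] (w : E d → G),
      eLpNorm w 2 (volume.restrict K) = (∫⁻ x in K, ‖w x‖ₑ ^ 2) ^ (1 / 2 : ℝ) := fun w => by
    rw [eLpNorm_eq_lintegral_rpow_enorm_toReal (by norm_num) (by norm_num)]
    norm_num
  have hI2 : eLpNorm (fun x => h x - e) 2 (volume.restrict K) ≤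
      a ^ (1 / 2 : ℝ) * ∑ i, eLpNorm (pderiv i h) 2 (volume.restrict K) := by
    have s1 : eLpNorm (fun x => h x - e) 2 (volume.restrict K) ≤
        a ^ (1 / 2 : ℝ) * eLpNorm (fun x => fderiv ℝ h x) 2 (volume.restrict K) := by
      rw [hN, hN, ← ENNReal.mul_rpow_of_nonneg _ _ (by norm_num)]
      exact ENNReal.rpow_le_rpow hI (by norm_num)
    refine s1.trans ?_
    gcongr
    calc eLpNorm (fun x => fderiv ℝ h x) 2 (volume.restrict K)
        ≤ eLpNorm (∑ i, fun x => ‖pderiv i h x‖) 2 (volume.restrict K) := by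
          refine eLpNorm_mono_real fun x => ?_
          rw [Finset.sum_apply]
          exact norm_fderiv_le_sum h x
      _ ≤ ∑ i, eLpNorm (fun x => ‖pderiv i h x‖) 2 (volume.restrict K) :=
          eLpNorm_sum_le (fun i _ => (contDiff_pderiv i hh).continuous.norm.aestronglyMeasurable)
            (by norm_num)
      _ = _ := by simp only [eLpNorm_norm]
  have hsplit : h = (fun x => h x - e) + fun _ => e := by funext x; simp
  calc eLpNorm h 2 (volume.restrict K)
      ≤ eLpNorm (fun x => h x - e) 2 (volume.restrict K) +
        eLpNorm (fun _ : E d => e) 2 (volume.restrict K) := by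
        conv_lhs => rw [hsplit]
        exact eLpNorm_add_le ((hh.continuous.sub continuous_const).aestronglyMeasurable)
          aestronglyMeasurable_const (by norm_num)
    _ ≤ a ^ (1 / 2 : ℝ) * (∑ i, eLpNorm (pderiv i h) 2 (volume.restrict K)) +
        volume K ^ (1 / 2 : ℝ) * ‖e‖ₑ := by
        gcongr
        rw [eLpNorm_const' _ (by norm_num) (by norm_num), Measure.restrict_apply_univ, mul_comm]
        norm_num
    _ ≤ b * (∑ i, eLpNorm (pderiv i h) 2 (volume.restrict K)) + b * ‖e‖ₑ := by
        gcongr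
        · exact le_self_add
        · exact le_add_self
    _ = _ := by rw [mul_add]

end Poincare

/-! ### Existence of intermediate weak derivatives -/

section ExistenceOfWeakDerivatives

variable {d N : ℕ}

/-- `v` belongs to `L^p` on every compact subset of `Ω`. -/
def MemLpLoc (p : ℝ≥0∞) (Ω : Set (E d)) (v : E d → V N) : Prop :=
  ∀ K ⊆ Ω, IsCompact K → MemLp v p (volume.restrict K)

lemma memLpLoc_one {Ω : Set (E d)} {u : E d → V N} (hu : LocallyIntegrableOn u Ω) :
    MemLpLoc 1 Ω u := fun _ hK hKc =>
  memLp_one_iff_integrable.2 (hu.integrableOn_compact_subset hK hKc)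

/-- Completeness of `L^2` for sequences of functions, with the Cauchy condition given by a null
sequence `b`. -/
lemma cauchySeq_eLpNorm_complete {X F : Type*} [MeasurableSpace X] [NormedAddCommGroup F]
    [CompleteSpace F] {μ : Measure X} {g : ℕ → X → F} (hg : ∀ n, MemLp (g n) 2 μ) {b : ℕ → ℝ≥0∞}
    (hb : Filter.Tendsto b Filter.atTop (nhds 0))
    (h : ∀ n k, eLpNorm (g n - g k) 2 μ ≤ b n + b k) :
    ∃ w, MemLp w 2 μ ∧ Filter.Tendsto (fun n => eLpNorm (g n - w) 2 μ) Filter.atTop (nhds 0) := by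
  have hc : CauchySeq fun n => (hg n).toLp := by
    rw [EMetric.cauchySeq_iff]
    intro ε hε
    obtain ⟨n₀, hn₀⟩ := Filter.eventually_atTop.1
      ((ENNReal.tendsto_nhds_zero.1 hb) (ε / 3) (ENNReal.div_pos hε.ne' (by norm_num)))
    by_cases hεt : ε = ⊤
    · refine ⟨0, fun n _ k _ => ?_⟩
      rw [hεt]; exact edist_lt_top _ _
    refine ⟨n₀, fun n hn k hk => ?_⟩
    rw [Lp.edist_toLp_toLp]
    calc eLpNorm (g n - g k) 2 μ ≤ b n + b k := h n k
      _ ≤ ε / 3 + ε / 3 := add_le_add (hn₀ n hn) (hn₀ k hk)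
      _ < ε / 3 + ε / 3 + ε / 3 := ENNReal.lt_add_right (by finiteness)
          (ENNReal.div_pos hε.ne' (by norm_num)).ne'
      _ = ε := ENNReal.add_thirds ε
  obtain ⟨w, hw⟩ := cauchySeq_tendsto_of_complete hc
  refine ⟨w, Lp.memLp w, ?_⟩
  have := (Lp.tendsto_Lp_iff_tendsto_eLpNorm' _ w).1 hw
  refine this.congr fun n => eLpNorm_congr_ae ?_
  filter_upwards [(hg n).coeFn_toLp] with x hx
  rw [Pi.sub_apply, Pi.sub_apply, hx]

/-- If all derivatives `∂_i ∂^α u` are locally square integrable, then `∂^α u` exists and is square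
integrable on convex compact sets, by the Poincaré inequality. -/
lemma exists_isWeakDeriv_interior {Ω K : Set (E d)} (hΩ : IsOpen Ω) (hK : IsCompact K)
    (hKc : Convex ℝ K) (hKi : (interior K).Nonempty) (hKΩ : K ⊆ Ω) {u : E d → V N}
    (hu : LocallyIntegrableOn u Ω) {α : MIndex d}
    (h : ∀ i, ∃ v, IsWeakDeriv (α + Pi.single i 1) Ω u v ∧ MemLpLoc 2 Ω v) :
    ∃ v, IsWeakDeriv α (interior K) u v ∧ MemLp v 2 (volume.restrict K) := by
  choose v hv hvL using h
  obtain ⟨f, hf, hfc, hlim⟩ := exists_smooth_approx hΩ hK hKΩ hu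
  obtain ⟨x₀, hx₀⟩ := hKi
  obtain ⟨r, hr, hrK⟩ := Metric.isOpen_iff.1 isOpen_interior x₀ hx₀
  let b : ContDiffBump x₀ := ⟨r / 4, r / 2, by positivity, by linarith⟩
  set η : E d → ℝ := b.normed volume
  have hη : ContDiff ℝ ∞ η := b.contDiff_normed
  have hηK : tsupport η ⊆ K := by
    rw [b.tsupport_normed_eq]
    exact (Metric.closedBall_subset_ball (by change r / 2 < r; linarith)).trans
      (hrK.trans interior_subset)
  have hηc : HasCompactSupport η := hK.of_isClosed_subset (isClosed_tsupport η) hηK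
  obtain ⟨C, hC⟩ := exists_poincare (F := V N) hK hKc hη.continuous hηK b.integral_normed
  have huK : IntegrableOn u K := hu.integrableOn_compact_subset hKΩ hK
  have hfin : IsFiniteMeasure (volume.restrict K) := ⟨by simpa using hK.measure_lt_top⟩
  have hLp : ∀ {h : E d → V N} (p : ℝ≥0∞), ContDiff ℝ ∞ h → MemLp h p (volume.restrict K) :=
    fun p hh => by
      obtain ⟨M, hM⟩ := hK.exists_bound_of_continuousOn hh.continuous.continuousOn
      exact MemLp.of_bound hh.continuous.aestronglyMeasurable M
        ((ae_restrict_iff' hK.measurableSet).2 (Filter.Eventually.of_forall hM))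
  have h1 : Filter.Tendsto (fun n => eLpNorm (f n - u) 1 (volume.restrict K)) Filter.atTop
      (nhds 0) := by
    simpa using hlim 0 u 1 le_rfl (by simp) (isWeakDeriv_zero hu) (memLpLoc_one hu)
  -- integrals of `f n` against smooth weights converge
  have hpair : ∀ ζ : E d → ℝ, ContDiff ℝ ∞ ζ → tsupport ζ ⊆ K →
      Filter.Tendsto (fun n => ∫ x, ζ x • mderiv α (f n) x) Filter.atTop
        (nhds ((-1 : ℝ) ^ order α • ∫ x, mderiv α ζ x • u x)) := by
    intro ζ hζ hζK
    have hζc : HasCompactSupport ζ := hK.of_isClosed_subset (isClosed_tsupport ζ) hζK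
    have := (tendsto_integral_smul hK le_rfl (contDiff_mderiv α hζ).continuous
      (hasCompactSupport_mderiv α hζc) ((tsupport_mderiv α hζ).trans hζK)
      (fun n => memLp_one_iff_integrable.1 (hLp 1 (hf n))) huK h1).const_smul ((-1 : ℝ) ^ order α)
    refine this.congr fun n => ?_
    rw [integral_mderiv_smul α hζ hζc (hf n), smul_smul, ← mul_pow]
    simp
  set e := (-1 : ℝ) ^ order α • ∫ x, mderiv α η x • u x
  set B : ℕ → ℝ≥0∞ := fun n => C * ((∑ i, eLpNorm (mderiv (α + Pi.single i 1) (f n) - v i) 2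
    (volume.restrict K)) + edist (∫ x, η x • mderiv α (f n) x) e)
  have hB : Filter.Tendsto B Filter.atTop (nhds 0) := by
    have s1 : Filter.Tendsto (fun n => ∑ i, eLpNorm (mderiv (α + Pi.single i 1) (f n) - v i) 2
        (volume.restrict K)) Filter.atTop (nhds (∑ _i : Fin d, 0)) :=
      tendsto_finsetSum _ fun i _ => hlim _ _ 2 (by norm_num) (by norm_num) (hv i) (hvL i)
    have s2 : Filter.Tendsto (fun n => edist (∫ x, η x • mderiv α (f n) x) e) Filter.atTop
        (nhds 0) := by
      have := (hpair η hη hηK).edist (tendsto_const_nhds (x := e))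
      rwa [edist_self] at this
    have := ENNReal.Tendsto.const_mul (a := (C : ℝ≥0∞)) (s1.add s2) (Or.inr ENNReal.coe_ne_top)
    simpa using this
  obtain ⟨w, hw, hwl⟩ := cauchySeq_eLpNorm_complete (μ := volume.restrict K)
    (g := fun n => mderiv α (f n)) (fun n => hLp 2 (contDiff_mderiv α (hf n))) hB fun n k => by
      have hsm := (contDiff_mderiv α (hf n)).sub (contDiff_mderiv α (hf k))
      refine (hC _ hsm).trans ?_
      rw [← mul_add, add_add_add_comm, ← Finset.sum_add_distrib]
      refine mul_le_mul' le_rfl (add_le_add (Finset.sum_le_sum fun i _ => ?_) ?_)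
      · have e1 : pderiv i (fun x => mderiv α (f n) x - mderiv α (f k) x) =
            (mderiv (α + Pi.single i 1) (f n) - v i) -
              (mderiv (α + Pi.single i 1) (f k) - v i) := by
          rw [mderiv_add_single α i (hf n), mderiv_add_single α i (hf k)]
          have := pderiv_sub i (contDiff_mderiv α (hf n)) (contDiff_mderiv α (hf k))
          rw [sub_sub_sub_cancel_right]
          exact this
        have hm : ∀ n, AEStronglyMeasurable (mderiv (α + Pi.single i 1) (f n) - v i)
            (volume.restrict K) := fun n =>
          ((contDiff_mderiv _ (hf n)).continuous.aestronglyMeasurable).sub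
            (hvL i K hKΩ hK).aestronglyMeasurable
        rw [e1]
        exact eLpNorm_sub_le (hm n) (hm k) (by norm_num)
      · have hi : ∀ n, Integrable fun x => η x • mderiv α (f n) x := fun n =>
          (hη.continuous.smul (contDiff_mderiv α (hf n)).continuous).integrable_of_hasCompactSupport
            hηc.smul_right
        simp only [smul_sub]
        rw [integral_sub (hi n) (hi k), ← edist_eq_enorm_sub]
        exact edist_triangle_right _ _ _
  refine ⟨w, ⟨hu.mono_set (interior_subset.trans hKΩ), ?_, fun ζ hζ hζc hζK => ?_⟩, hw⟩
  · exact (IntegrableOn.locallyIntegrableOn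
      (memLp_one_iff_integrable.1 (hw.mono_exponent (by norm_num)))).mono_set interior_subset
  · rw [setIntegral_smul_eq ((tsupport_mderiv α hζ).trans hζK), setIntegral_smul_eq hζK]
    have hζK' := hζK.trans interior_subset
    have l1 := hpair ζ hζ hζK'
    have l2 := tendsto_integral_smul hK (by norm_num : (1 : ℝ≥0∞) ≤ 2) hζ.continuous hζc hζK'
      (fun n => memLp_one_iff_integrable.1 (hLp 1 (contDiff_mderiv α (hf n))))
      (memLp_one_iff_integrable.1 (hw.mono_exponent (by norm_num))) hwl
    rw [← tendsto_nhds_unique l1 l2, smul_smul, ← mul_pow]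
    simp

/-- Weak derivatives on an increasing sequence of open sets fit together. -/
lemma exists_isWeakDeriv_iUnion {U : ℕ → Set (E d)} (hU : ∀ n, IsOpen (U n)) (hmono : Monotone U)
    {u : E d → V N} {α : MIndex d} (h : ∀ n, ∃ v, IsWeakDeriv α (U n) u v) :
    ∃ v, IsWeakDeriv α (⋃ n, U n) u v := by
  classical
  choose v hv using h
  let w : E d → V N := fun x => if hx : ∃ n, x ∈ U n then v (Nat.find hx) x else 0
  have hae : ∀ᵐ x, ∀ n k, k ≤ n → x ∈ U k → v k x = v n x := by
    rw [ae_all_iff]; intro n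
    rw [ae_all_iff]; intro k
    by_cases hkn : k ≤ n
    · have := (hv k).ae_eq (hU k) ((hv n).mono (hmono hkn))
      rw [Filter.EventuallyEq, ae_restrict_iff' (hU k).measurableSet] at this
      filter_upwards [this] with x hx _ using hx
    · exact Filter.Eventually.of_forall fun x h => absurd h hkn
  have hw : ∀ n, IsWeakDeriv α (U n) u w := fun n => by
    refine (hv n).congr (hU n) (Filter.EventuallyEq.refl _ _) ?_
    rw [Filter.EventuallyEq, ae_restrict_iff' (hU n).measurableSet]
    filter_upwards [hae] with x hx hxn
    have hex : ∃ n, x ∈ U n := ⟨n, hxn⟩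
    simp only [w, dif_pos hex]
    exact (hx n _ (Nat.find_min' hex hxn) (Nat.find_spec hex)).symm
  have hloc : ∀ g : E d → V N, (∀ n, LocallyIntegrableOn g (U n)) →
      LocallyIntegrableOn g (⋃ n, U n) := fun g hg x hx => by
    obtain ⟨n, hn⟩ := mem_iUnion.1 hx
    have := hg n x hn
    rw [IsOpen.nhdsWithin_eq (hU n) hn] at this
    rw [IsOpen.nhdsWithin_eq (isOpen_iUnion hU) hx]
    exact this
  refine ⟨w, hloc u fun n => (hw n).1, hloc w fun n => (hw n).2.1, fun η hη hc hs => ?_⟩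
  obtain ⟨n, hn⟩ := IsCompact.elim_directed_cover hc U hU hs (hmono.directed_le)
  have := (hw n).2.2 η hη hc hn
  rw [setIntegral_smul_eq ((tsupport_mderiv α hη).trans hs), setIntegral_smul_eq hs]
  rwa [setIntegral_smul_eq ((tsupport_mderiv α hη).trans hn), setIntegral_smul_eq hn] at this

/-- In a ball, if all weak derivatives of order `m` are locally square integrable, then so are all
weak derivatives of lower order, which exist. -/
lemma exists_isWeakDeriv_ball (c : E d) {R : ℝ} (hR : 0 < R) {u : E d → V N} {m : ℕ}
    (hu : LocallyIntegrableOn u (Metric.ball c R))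
    (h : ∀ α, order α = m → ∃ v, IsWeakDeriv α (Metric.ball c R) u v ∧
      MemLpLoc 2 (Metric.ball c R) v) :
    ∀ k α, order α + k = m → ∃ v, IsWeakDeriv α (Metric.ball c R) u v ∧
      MemLpLoc 2 (Metric.ball c R) v := by
  intro k
  induction k with
  | zero => intro α hα; exact h α (by omega)
  | succ k ih =>
    intro α hα
    let s : ℕ → ℝ := fun n => R * (1 - 1 / ((n : ℝ) + 2))
    have hs0 : ∀ n, 0 < s n := fun n => by
      have h1 : 1 / ((n : ℝ) + 2) < 1 := by
        rw [div_lt_one (by positivity)]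
        have : (0 : ℝ) ≤ n := Nat.cast_nonneg n
        linarith
      exact mul_pos hR (by linarith)
    have hsR : ∀ n, s n < R := fun n => by
      have h1 : 0 < 1 / ((n : ℝ) + 2) := by positivity
      change R * (1 - 1 / ((n : ℝ) + 2)) < R
      nlinarith
    have hsm : Monotone s := fun a b hab => by
      have : (a : ℝ) ≤ b := by exact_mod_cast hab
      change R * (1 - 1 / ((a : ℝ) + 2)) ≤ R * (1 - 1 / ((b : ℝ) + 2))
      gcongr
    have hstep : ∀ n, ∃ v, IsWeakDeriv α (Metric.ball c (s n)) u v ∧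
        MemLp v 2 (volume.restrict (Metric.closedBall c (s n))) := fun n => by
      have hi : interior (Metric.closedBall c (s n)) = Metric.ball c (s n) :=
        interior_closedBall c (hs0 n).ne'
      have := exists_isWeakDeriv_interior (K := Metric.closedBall c (s n)) Metric.isOpen_ball
        (isCompact_closedBall c (s n)) (convex_closedBall c (s n))
        (by rw [hi]; exact ⟨c, Metric.mem_ball_self (hs0 n)⟩)
        (Metric.closedBall_subset_ball (hsR n)) hu (α := α) fun i =>
          ih (α + Pi.single i 1) (by rw [order_add_single]; omega)
      rwa [hi] at this
    have hUnion : ⋃ n, Metric.ball c (s n) = Metric.ball c R := by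
      refine Subset.antisymm (iUnion_subset fun n => Metric.ball_subset_ball (hsR n).le) ?_
      intro x hx
      rw [Metric.mem_ball] at hx
      have hlim : Filter.Tendsto s Filter.atTop (nhds R) := by
        have h0 : Filter.Tendsto (fun n : ℕ => 1 / ((n : ℝ) + 2)) Filter.atTop (nhds 0) := by
          have := (Filter.tendsto_add_atTop_iff_nat 1).2
            (tendsto_one_div_add_atTop_nhds_zero_nat (𝕜 := ℝ))
          refine this.congr fun n => ?_
          push_cast
          ring
        simpa [s] using (h0.const_sub 1).const_mul R
      obtain ⟨n, hn⟩ := (hlim.eventually (lt_mem_nhds hx)).exists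
      exact mem_iUnion.2 ⟨n, hn⟩
    have hUm : Monotone fun n => Metric.ball c (s n) := fun a b hab =>
      Metric.ball_subset_ball (hsm hab)
    obtain ⟨v, hv⟩ := exists_isWeakDeriv_iUnion (fun n => Metric.isOpen_ball) hUm
      fun n => (hstep n).imp fun _ h => h.1
    rw [hUnion] at hv
    refine ⟨v, hv, fun K hK hKc => ?_⟩
    obtain ⟨n, hn⟩ := hKc.elim_directed_cover _ (fun n => Metric.isOpen_ball)
      (by rw [hUnion]; exact hK) hUm.directed_le
    obtain ⟨w, hw, hwL⟩ := hstep n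
    have hae := hw.ae_eq Metric.isOpen_ball (hv.mono (Metric.ball_subset_ball (hsR n).le))
    exact (hwL.mono_measure (Measure.restrict_mono (hn.trans Metric.ball_subset_closedBall)
      le_rfl)).ae_eq (ae_restrict_of_ae_restrict_of_subset hn hae)

end ExistenceOfWeakDerivatives

/-! ### Limits of jets of test functions -/

section JetLimits

variable {d N m : ℕ}

lemma tendsto_eLpNorm_two_of_sub {X F : Type*} [MeasurableSpace X] [NormedAddCommGroup F]
    {μ : Measure X} {f : ℕ → X → F} {g : X → F} (hf : ∀ n, MemLp (f n) 2 μ) (hg : MemLp g 2 μ)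
    (h : Filter.Tendsto (fun n => eLpNorm (f n - g) 2 μ) Filter.atTop (nhds 0)) :
    Filter.Tendsto (fun n => eLpNorm (f n) 2 μ) Filter.atTop (nhds (eLpNorm g 2 μ)) := by
  have h1 := ((Lp.tendsto_Lp_iff_tendsto_eLpNorm'' f hf g hg).2 h).enorm
  simpa only [Lp.enorm_toLp] using h1

/-- The jet `g` of order `m` is the limit in `L^2` of the jets of the test functions `p n`. -/
structure IsJetLimit (m : ℕ) (p : ℕ → E d → V N) (g : MIndex d → E d → V N) : Prop where
  smooth : ∀ n, ContDiff ℝ ∞ (p n)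
  compact : ∀ n, HasCompactSupport (p n)
  memLp : ∀ α ∈ indicesLE d m, MemLp (g α) 2 volume
  lim : ∀ α ∈ indicesLE d m,
    Filter.Tendsto (fun n => eLpNorm (mderiv α (p n) - g α) 2 volume) Filter.atTop (nhds 0)

/-- The sum of the `L^2` norms of the components of order `m` of a jet. -/
noncomputable def topNorm (m : ℕ) (g : MIndex d → E d → V N) : ℝ≥0∞ :=
  ∑ γ ∈ indicesEQ d m, eLpNorm (g γ) 2 volume

lemma memLp_mderiv {f : E d → V N} (hf : ContDiff ℝ ∞ f) (hc : HasCompactSupport f)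
    (α : MIndex d) (p : ℝ≥0∞) : MemLp (mderiv α f) p volume :=
  (contDiff_mderiv α hf).continuous.memLp_of_hasCompactSupport (hasCompactSupport_mderiv α hc)

lemma isJetLimit_const (m : ℕ) {f : E d → V N} (hf : ContDiff ℝ ∞ f) (hc : HasCompactSupport f) :
    IsJetLimit m (fun _ => f) fun α => mderiv α f :=
  ⟨fun _ => hf, fun _ => hc, fun α _ => memLp_mderiv hf hc α 2, fun α _ => by simp⟩

namespace IsJetLimit

variable {p q : ℕ → E d → V N} {g h : MIndex d → E d → V N}

lemma sub (hp : IsJetLimit m p g) (hq : IsJetLimit m q h) :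
    IsJetLimit m (fun n => p n - q n) (fun α => g α - h α) := by
  refine ⟨fun n => (hp.smooth n).sub (hq.smooth n), fun n => (hp.compact n).sub (hq.compact n),
    fun α hα => (hp.memLp α hα).sub (hq.memLp α hα), fun α hα => ?_⟩
  have hs := (hp.lim α hα).add (hq.lim α hα)
  rw [add_zero] at hs
  refine tendsto_of_tendsto_of_tendsto_of_le_of_le tendsto_const_nhds hs (fun n => zero_le)
    fun n => ?_
  rw [mderiv_sub α (hp.smooth n) (hq.smooth n), sub_sub_sub_comm]
  exact eLpNorm_sub_le
    ((memLp_mderiv (hp.smooth n) (hp.compact n) α 2).sub (hp.memLp α hα)).aestronglyMeasurable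
    ((memLp_mderiv (hq.smooth n) (hq.compact n) α 2).sub (hq.memLp α hα)).aestronglyMeasurable
    (by norm_num)

lemma comp_strictMono (hp : IsJetLimit m p g) {φ : ℕ → ℕ} (hφ : StrictMono φ) :
    IsJetLimit m (fun n => p (φ n)) g :=
  ⟨fun _ => hp.smooth _, fun _ => hp.compact _, hp.memLp,
    fun α hα => (hp.lim α hα).comp hφ.tendsto_atTop⟩

lemma exists_seq_tendsto_ae (hp : IsJetLimit m p g) {α : MIndex d} (hα : α ∈ indicesLE d m) :
    ∃ φ : ℕ → ℕ, StrictMono φ ∧ ∀ᵐ x, Filter.Tendsto (fun n => mderiv α (p (φ n)) x) Filter.atTop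
      (nhds (g α x)) :=
  (tendstoInMeasure_of_tendsto_eLpNorm (by norm_num)
    (fun n => (memLp_mderiv (hp.smooth n) (hp.compact n) α 2).aestronglyMeasurable)
    (hp.memLp α hα).aestronglyMeasurable (hp.lim α hα)).exists_seq_tendsto_ae

lemma tendsto_gradNorm (hp : IsJetLimit m p g) :
    Filter.Tendsto (fun n => gradNorm m (p n)) Filter.atTop (nhds (topNorm m g)) := by
  refine tendsto_finsetSum _ fun γ hγ => ?_
  have hγ' : γ ∈ indicesLE d m := mem_indicesLE.2 (mem_indicesEQ.1 hγ).le
  exact tendsto_eLpNorm_two_of_sub (fun n => memLp_mderiv (hp.smooth n) (hp.compact n) γ 2)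
    (hp.memLp γ hγ') (hp.lim γ hγ')

lemma topNorm_ne_top (hp : IsJetLimit m p g) : topNorm m g ≠ ⊤ :=
  (ENNReal.sum_lt_top.2 fun γ hγ =>
    (hp.memLp γ (mem_indicesLE.2 (mem_indicesEQ.1 hγ).le)).2).ne

lemma tendsto_topNorm_sub (hp : IsJetLimit m p g) :
    Filter.Tendsto (fun n => topNorm m fun α => mderiv α (p n) - g α) Filter.atTop (nhds 0) := by
  have := tendsto_finsetSum (indicesEQ d m) fun γ hγ =>
    hp.lim γ (mem_indicesLE.2 (mem_indicesEQ.1 hγ).le)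
  rw [Finset.sum_const_zero] at this
  exact this

/-- The Sobolev inequality passes to limits of jets. -/
lemma eLpNorm_critExp_le {C : ℝ≥0} (hC : ∀ k ≤ m, (k : ℝ) < d / 2 → ∀ f : E d → V N,
      ContDiff ℝ ∞ f → HasCompactSupport f → eLpNorm f (sobExp d k) volume ≤ C * gradNorm k f)
    (hp : IsJetLimit m p g) {α : MIndex d} (hα : α ∈ indicesY d m) :
    eLpNorm (g α) (critExp d m (order α)) volume ≤ C * topNorm m g := by
  obtain ⟨hα1, hα2⟩ := Finset.mem_filter.1 hα
  have hαm := mem_indicesLE.1 hα1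
  obtain ⟨φ, hφ, hae⟩ := hp.exists_seq_tendsto_ae hα1
  have hp' := hp.comp_strictMono hφ
  have h1 := Lp.eLpNorm_lim_le_liminf_eLpNorm (p := critExp d m (order α)) (μ := volume)
    (fun n => (memLp_mderiv (hp'.smooth n) (hp'.compact n) α 2).aestronglyMeasurable) (g α) hae
  refine h1.trans ?_
  have h2 : ∀ n, eLpNorm (mderiv α (p (φ n))) (critExp d m (order α)) volume ≤
      C * gradNorm m (p (φ n)) := fun n => by
    rw [critExp_eq hαm]
    refine (hC (m - order α) (Nat.sub_le _ _) ?_ _ (contDiff_mderiv α (hp'.smooth n))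
      (hasCompactSupport_mderiv α (hp'.compact n))).trans ?_
    · rw [Nat.cast_sub hαm]; linarith
    · gcongr
      refine (gradNorm_mderiv_le (hp'.smooth n) _ α).trans (le_of_eq ?_)
      rw [Nat.sub_add_cancel hαm]
  have h3 := ENNReal.Tendsto.const_mul (a := (C : ℝ≥0∞)) hp'.tendsto_gradNorm
    (Or.inr ENNReal.coe_ne_top)
  exact (Filter.liminf_le_liminf (Filter.Eventually.of_forall h2)).trans h3.liminf_eq.le

/-- The bound for the form passes to limits of jets, by Fatou's lemma. -/
lemma lintegral_form_le {A : Coeff d N} {C : ℝ≥0} (hA : FormBound m A C) (hp : IsJetLimit m p g)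
    (hq : IsJetLimit m q h) {α β : MIndex d} (hα : α ∈ indicesLE d m) (hβ : β ∈ indicesLE d m)
    (j k : Fin N) :
    ∫⁻ x, ‖g α x‖ₑ * ‖A j k α β x‖ₑ * ‖h β x‖ₑ ≤ C * (topNorm m g * topNorm m h) := by
  obtain ⟨φ, hφ, hae⟩ := hp.exists_seq_tendsto_ae hα
  obtain ⟨ψ, hψ, hae'⟩ := (hq.comp_strictMono hφ).exists_seq_tendsto_ae hβ
  have hp' := hp.comp_strictMono (hφ.comp hψ)
  have hq' := hq.comp_strictMono (hφ.comp hψ)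
  set f : ℕ → E d → ℝ≥0∞ := fun n x => ‖mderiv α (p (φ (ψ n))) x‖ₑ * ‖A j k α β x‖ₑ *
    ‖mderiv β (q (φ (ψ n))) x‖ₑ with hf
  have hlim : ∀ᵐ x, ‖g α x‖ₑ * ‖A j k α β x‖ₑ * ‖h β x‖ₑ ≤
      Filter.liminf (fun n => f n x) Filter.atTop := by
    filter_upwards [hae, hae'] with x hx hx'
    have t1 : Filter.Tendsto (fun n => ‖mderiv α (p (φ (ψ n))) x‖₊ * ‖A j k α β x‖₊ *
        ‖mderiv β (q (φ (ψ n))) x‖₊) Filter.atTop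
        (nhds (‖g α x‖₊ * ‖A j k α β x‖₊ * ‖h β x‖₊)) :=
      (((hx.comp hψ.tendsto_atTop).nnnorm).mul tendsto_const_nhds).mul hx'.nnnorm
    have t2 := (ENNReal.tendsto_coe.2 t1).liminf_eq
    simp only [ENNReal.coe_mul] at t2
    exact t2.ge
  refine (lintegral_mono_ae hlim).trans ((lintegral_liminf_le' fun n => ?_).trans ?_)
  · exact ((contDiff_mderiv α (hp'.smooth n)).continuous.enorm.measurable.aemeasurable.mul
      (hA.1 j k α hα β hβ).enorm).mul
        (contDiff_mderiv β (hq'.smooth n)).continuous.enorm.measurable.aemeasurable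
  · have hb : ∀ n, ∫⁻ x, f n x ≤
        C * (gradNorm m (p (φ (ψ n))) * gradNorm m (q (φ (ψ n)))) := fun n => by
      refine (hA.2 j k α hα β hβ _ _ (contDiff_mderiv α (hp'.smooth n))
        (hasCompactSupport_mderiv α (hp'.compact n)) (contDiff_mderiv β (hq'.smooth n))
        (hasCompactSupport_mderiv β (hq'.compact n))).trans ?_
      have e1 := gradNorm_mderiv_le (hp'.smooth n) (m - order α) α
      have e2 := gradNorm_mderiv_le (hq'.smooth n) (m - order β) β
      rw [Nat.sub_add_cancel (mem_indicesLE.1 hα)] at e1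
      rw [Nat.sub_add_cancel (mem_indicesLE.1 hβ)] at e2
      exact mul_le_mul' le_rfl (mul_le_mul' e1 e2)
    have t := ENNReal.Tendsto.const_mul (a := (C : ℝ≥0∞)) (ENNReal.Tendsto.mul
      hp'.tendsto_gradNorm (Or.inr hq.topNorm_ne_top) hq'.tendsto_gradNorm
      (Or.inr hp.topNorm_ne_top)) (Or.inr ENNReal.coe_ne_top)
    exact (Filter.liminf_le_liminf (Filter.Eventually.of_forall hb)).trans t.liminf_eq.le

lemma integrable_form {A : Coeff d N} {C : ℝ≥0} (hA : FormBound m A C) (hp : IsJetLimit m p g)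
    (hq : IsJetLimit m q h) {α β : MIndex d} (hα : α ∈ indicesLE d m) (hβ : β ∈ indicesLE d m)
    (j k : Fin N) : Integrable (fun x => conj (g α x j) * (A j k α β x * h β x k)) volume ∧
      ‖∫ x, conj (g α x j) * (A j k α β x * h β x k)‖ₑ ≤ C * (topNorm m g * topNorm m h) := by
  have hle := (lintegral_mono fun x => enorm_form_le (g α x) (h β x) (A j k α β x) j k).trans
    (hp.lintegral_form_le hA hq hα hβ j k)
  refine ⟨⟨aestronglyMeasurable_form (hp.memLp α hα).aestronglyMeasurable (hA.1 j k α hα β hβ)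
    (hq.memLp β hβ).aestronglyMeasurable j k, hle.trans_lt ?_⟩,
    (enorm_integral_le_lintegral_enorm _).trans hle⟩
  exact (ENNReal.mul_ne_top ENNReal.coe_ne_top
    (ENNReal.mul_ne_top hp.topNorm_ne_top hq.topNorm_ne_top)).lt_top

/-- The form is continuous along convergent jets. -/
lemma tendsto_jetForm {A : Coeff d N} {C : ℝ≥0} (hA : FormBound m A C) (hp : IsJetLimit m p g)
    (hq : IsJetLimit m q h) :
    Filter.Tendsto (fun n => jetForm m A (fun α => mderiv α (p n)) fun α => mderiv α (q n))
      Filter.atTop (nhds (jetForm m A g h)) := by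
  refine tendsto_finsetSum _ fun j _ => tendsto_finsetSum _ fun k _ =>
    tendsto_finsetSum _ fun α hα => tendsto_finsetSum _ fun β hβ => ?_
  rw [tendsto_iff_edist_tendsto_0]
  have hcp : ∀ n, IsJetLimit m (fun _ => p n) fun α => mderiv α (p n) := fun n =>
    isJetLimit_const m (hp.smooth n) (hp.compact n)
  have hcq : ∀ n, IsJetLimit m (fun _ => q n) fun α => mderiv α (q n) := fun n =>
    isJetLimit_const m (hq.smooth n) (hq.compact n)
  have hb : ∀ n, edist (∫ x, conj (mderiv α (p n) x j) * (A j k α β x * mderiv β (q n) x k))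
      (∫ x, conj (g α x j) * (A j k α β x * h β x k)) ≤
      C * (topNorm m (fun α => mderiv α (p n) - g α) * gradNorm m (q n)) +
      C * (topNorm m g * topNorm m (fun β => mderiv β (q n) - h β)) := fun n => by
    have i1 := ((hcp n).sub hp).integrable_form hA (hcq n) hα hβ j k
    have i2 := hp.integrable_form hA ((hcq n).sub hq) hα hβ j k
    have e : (∫ x, conj (mderiv α (p n) x j) * (A j k α β x * mderiv β (q n) x k)) -
        (∫ x, conj (g α x j) * (A j k α β x * h β x k)) =
        (∫ x, conj ((mderiv α (p n) - g α) x j) * (A j k α β x * mderiv β (q n) x k)) +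
        ∫ x, conj (g α x j) * (A j k α β x * (mderiv β (q n) - h β) x k) := by
      rw [← integral_add i1.1 i2.1, ← integral_sub ((hcp n).integrable_form hA (hcq n) hα hβ j k).1
        (hp.integrable_form hA hq hα hβ j k).1]
      refine integral_congr_ae (Filter.Eventually.of_forall fun x => ?_)
      simp
      ring
    rw [edist_eq_enorm_sub, e]
    exact (enorm_add_le _ _).trans (add_le_add i1.2 i2.2)
  have t1 := ENNReal.Tendsto.const_mul (a := (C : ℝ≥0∞)) (ENNReal.Tendsto.mul
    hp.tendsto_topNorm_sub (Or.inr hq.topNorm_ne_top) hq.tendsto_gradNorm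
    (Or.inr ENNReal.zero_ne_top)) (Or.inr ENNReal.coe_ne_top)
  have t2 := ENNReal.Tendsto.const_mul (a := (C : ℝ≥0∞)) (ENNReal.Tendsto.const_mul
    (a := topNorm m g) hq.tendsto_topNorm_sub (Or.inr hp.topNorm_ne_top))
    (Or.inr ENNReal.coe_ne_top)
  have t := t1.add t2
  simp only [zero_mul, mul_zero, add_zero] at t
  exact tendsto_of_tendsto_of_tendsto_of_le_of_le tendsto_const_nhds t (fun n => zero_le) hb

/-- The components of a limit of jets are the weak derivatives of its component of order zero. -/
lemma isWeakDeriv (hp : IsJetLimit m p g) {α : MIndex d} (hα : α ∈ indicesLE d m) :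
    IsWeakDeriv α univ (g 0) (g α) := by
  have h0 : (0 : MIndex d) ∈ indicesLE d m := mem_indicesLE.2 (by simp [order_zero])
  have hloc : ∀ β ∈ indicesLE d m, LocallyIntegrable (g β) := fun β hβ =>
    (hp.memLp β hβ).locallyIntegrable (by norm_num)
  refine ⟨(hloc 0 h0).locallyIntegrableOn _, (hloc α hα).locallyIntegrableOn _,
    fun η hη hc hs => ?_⟩
  have key : ∀ β ∈ indicesLE d m, ∀ ζ : E d → ℝ, ContDiff ℝ ∞ ζ → HasCompactSupport ζ →
      Filter.Tendsto (fun n => ∫ x, ζ x • mderiv β (p n) x) Filter.atTop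
        (nhds (∫ x, ζ x • g β x)) := fun β hβ ζ hζ hζc => by
    refine tendsto_integral_smul hζc (by norm_num : (1 : ℝ≥0∞) ≤ 2) hζ.continuous hζc subset_rfl
      (fun n => ?_) ((hloc β hβ).integrableOn_isCompact hζc) ?_
    · exact (memLp_one_iff_integrable.1
        (memLp_mderiv (hp.smooth n) (hp.compact n) β 1)).integrableOn
    · exact tendsto_of_tendsto_of_tendsto_of_le_of_le tendsto_const_nhds (hp.lim β hβ)
        (fun n => zero_le) fun n => eLpNorm_restrict_le _ _ _ _
  have l1 := key 0 h0 _ (contDiff_mderiv α hη) (hasCompactSupport_mderiv α hc)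
  have l2 := (key α hα η hη hc).const_smul ((-1 : ℝ) ^ order α)
  rw [Measure.restrict_univ]
  refine tendsto_nhds_unique l1 (l2.congr fun n => ?_)
  rw [mderiv_zero, integral_mderiv_smul α hη hc (hp.smooth n)]

end IsJetLimit

end JetLimits

/-! ### Local Sobolev spaces and smooth approximation -/

section LocalSobolev

variable {d N m : ℕ} {Ω K : Set (E d)} {u : E d → V N}

/-- `u` belongs locally to the Sobolev space `W^{m,2}` in `Ω`. -/
def MemSobolevLoc (m : ℕ) (Ω : Set (E d)) (u : E d → V N) : Prop :=
  ∀ α ∈ indicesLE d m, ∃ v, IsWeakDeriv α Ω u v ∧ MemLpLoc 2 Ω v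

lemma MemSobolevLoc.isWeakDeriv (hu : MemSobolevLoc m Ω u) {α : MIndex d}
    (hα : α ∈ indicesLE d m) : IsWeakDeriv α Ω u (weakDeriv α Ω u) :=
  isWeakDeriv_weakDeriv ((hu α hα).imp fun _ h => h.1)

lemma MemSobolevLoc.memLpLoc (hu : MemSobolevLoc m Ω u) (hΩ : IsOpen Ω) {α : MIndex d}
    (hα : α ∈ indicesLE d m) : MemLpLoc 2 Ω (weakDeriv α Ω u) := fun K hK hKc => by
  obtain ⟨v, hv, hvL⟩ := hu α hα
  have hae : weakDeriv α Ω u =ᵐ[volume.restrict K] v :=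
    ae_restrict_of_ae_restrict_of_subset hK (hv.weakDeriv_ae_eq hΩ)
  exact (hvL K hK hKc).ae_eq hae.symm

lemma zero_mem_indicesLE (d m : ℕ) : (0 : MIndex d) ∈ indicesLE d m :=
  mem_indicesLE.2 (by simp [order_zero])

lemma MemSobolevLoc.locallyIntegrableOn (hu : MemSobolevLoc m Ω u) : LocallyIntegrableOn u Ω :=
  (hu.isWeakDeriv (zero_mem_indicesLE d m)).1

/-- The smooth functions `f n` converge to `u` in `L^2(K)` with all derivatives of order at most
`m`. -/
structure IsLocalApprox (m : ℕ) (Ω K : Set (E d)) (u : E d → V N) (f : ℕ → E d → V N) : Prop where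
  smooth : ∀ n, ContDiff ℝ ∞ (f n)
  compact : ∀ n, HasCompactSupport (f n)
  memLp : ∀ α ∈ indicesLE d m, MemLp (weakDeriv α Ω u) 2 (volume.restrict K)
  lim : ∀ α ∈ indicesLE d m, Filter.Tendsto
    (fun n => eLpNorm (mderiv α (f n) - weakDeriv α Ω u) 2 (volume.restrict K)) Filter.atTop
    (nhds 0)

lemma MemSobolevLoc.exists_isLocalApprox (hu : MemSobolevLoc m Ω u) (hΩ : IsOpen Ω)
    (hK : IsCompact K) (hKΩ : K ⊆ Ω) : ∃ f, IsLocalApprox m Ω K u f := by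
  obtain ⟨f, hf, hfc, hlim⟩ := exists_smooth_approx hΩ hK hKΩ hu.locallyIntegrableOn
  exact ⟨f, hf, hfc, fun α hα => hu.memLpLoc hΩ hα K hKΩ hK, fun α hα =>
    hlim α _ 2 (by norm_num) (by norm_num) (hu.isWeakDeriv hα) (hu.memLpLoc hΩ hα)⟩

/-- Multiplication by a test function `φ` supported in `K` maps derivatives on `K` continuously to
derivatives on the whole space (Leibniz rule, without its coefficients). -/
lemma exists_eLpNorm_mderiv_smul_le (hK : IsCompact K) (α : MIndex d) :
    ∀ φ : E d → ℝ, ContDiff ℝ ∞ φ → tsupport φ ⊆ K → ∃ C : ℝ≥0, ∀ h : E d → V N,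
      ContDiff ℝ ∞ h → eLpNorm (mderiv α (φ • h)) 2 volume ≤
        C * ∑ γ ∈ indicesLE d (order α), eLpNorm (mderiv γ h) 2 (volume.restrict K) := by
  induction α using mindex_induction with
  | h0 =>
    intro φ hφ hs
    have hc : HasCompactSupport φ := hK.of_isClosed_subset (isClosed_tsupport φ) hs
    obtain ⟨M, hM⟩ : ∃ C, ∀ x, ‖φ x‖ ≤ C := hφ.continuous.bounded_above_of_compact_support hc
    refine ⟨M.toNNReal, fun h hh => ?_⟩
    rw [mderiv_zero, ← eLpNorm_restrict_eq_of_support_subset (s := K) (fun x hx => hs (by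
      by_contra hn
      exact hx (by simp [image_eq_zero_of_notMem_tsupport hn])))]
    refine (eLpNorm_le_mul_eLpNorm_of_ae_le_mul (g := h) (c := M)
      (Filter.Eventually.of_forall fun x => ?_) 2).trans (mul_le_mul' le_rfl ?_)
    · rw [Pi.smul_apply', norm_smul]
      exact mul_le_mul_of_nonneg_right (hM x) (norm_nonneg _)
    · have := Finset.single_le_sum (f := fun γ => eLpNorm (mderiv γ h) 2 (volume.restrict K))
        (fun _ _ => zero_le) (zero_mem_indicesLE d (order (0 : MIndex d)))
      simpa using this
  | hs α i ih =>
    intro φ hφ hs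
    obtain ⟨C₁, h₁⟩ := ih (pderiv i φ) (contDiff_pderiv i hφ) ((tsupport_pderiv i hφ).trans hs)
    obtain ⟨C₂, h₂⟩ := ih φ hφ hs
    refine ⟨C₁ + C₂ * (indicesLE d (order α)).card, fun h hh => ?_⟩
    have hi := contDiff_pderiv i hh
    have c1 := (contDiff_pderiv i hφ).smul hh
    have c2 := hφ.smul hi
    set S := ∑ γ ∈ indicesLE d (order (α + Pi.single i 1)),
      eLpNorm (mderiv γ h) 2 (volume.restrict K) with hS
    have hmem : ∀ γ ∈ indicesLE d (order (α + Pi.single i 1)),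
        eLpNorm (mderiv γ h) 2 (volume.restrict K) ≤ S := fun γ hγ =>
      Finset.single_le_sum (f := fun γ => eLpNorm (mderiv γ h) 2 (volume.restrict K))
        (fun _ _ => zero_le) hγ
    have b1 : ∑ γ ∈ indicesLE d (order α), eLpNorm (mderiv γ h) 2 (volume.restrict K) ≤ S :=
      Finset.sum_le_sum_of_subset fun γ hγ => mem_indicesLE.2 (by
        have := mem_indicesLE.1 hγ
        rw [order_add_single]; omega)
    have b2 : ∑ γ ∈ indicesLE d (order α), eLpNorm (mderiv γ (pderiv i h)) 2 (volume.restrict K) ≤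
        (indicesLE d (order α)).card * S := by
      rw [← nsmul_eq_mul]
      refine Finset.sum_le_card_nsmul _ _ _ fun γ hγ => ?_
      rw [← mderiv_add_single' γ i hh]
      exact hmem _ (mem_indicesLE.2 (by
        have := mem_indicesLE.1 hγ
        rw [order_add_single, order_add_single]; omega))
    rw [mderiv_add_single' α i (hφ.smul hh), pderiv_smul i hφ hh, mderiv_add α c1 c2]
    refine (eLpNorm_add_le (contDiff_mderiv α c1).continuous.aestronglyMeasurable
      (contDiff_mderiv α c2).continuous.aestronglyMeasurable (by norm_num)).trans ?_
    push_cast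
    rw [add_mul, mul_assoc]
    exact add_le_add ((h₁ h hh).trans (mul_le_mul' le_rfl b1))
      ((h₂ _ hi).trans (mul_le_mul' le_rfl b2))

/-- Products of the approximations with a test function converge globally. -/
lemma IsLocalApprox.exists_isJetLimit {f : ℕ → E d → V N} (hf : IsLocalApprox m Ω K u f)
    (hu : MemSobolevLoc m Ω u) (hΩ : IsOpen Ω) (hK : IsCompact K) (hKΩ : K ⊆ Ω)
    {φ : E d → ℝ} (hφ : ContDiff ℝ ∞ φ) (hs : tsupport φ ⊆ K) :
    ∃ g, IsJetLimit m (fun n => φ • f n) g ∧ g 0 =ᵐ[volume] φ • u := by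
  have hsm : ∀ n, ContDiff ℝ ∞ (φ • f n) := fun n => hφ.smul (hf.smooth n)
  have hcs : ∀ n, HasCompactSupport (φ • f n) := fun n => hasCompactSupport_smul φ (hf.compact n)
  have hm : ∀ α ∈ indicesLE d m, ∀ n, AEStronglyMeasurable (mderiv α (f n) - weakDeriv α Ω u)
      (volume.restrict K) := fun α hα n =>
    (contDiff_mderiv α (hf.smooth n)).continuous.aestronglyMeasurable.sub
      (hf.memLp α hα).aestronglyMeasurable
  have hex : ∀ α, ∃ g : E d → V N, α ∈ indicesLE d m → MemLp g 2 volume ∧ Filter.Tendsto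
      (fun n => eLpNorm (mderiv α (φ • f n) - g) 2 volume) Filter.atTop (nhds 0) := by
    intro α
    by_cases hα : α ∈ indicesLE d m
    swap
    · exact ⟨0, fun h => absurd h hα⟩
    have hαm := mem_indicesLE.1 hα
    obtain ⟨C, hC⟩ := exists_eLpNorm_mderiv_smul_le (N := N) hK α φ hφ hs
    have hle : ∀ γ ∈ indicesLE d (order α), γ ∈ indicesLE d m := fun γ hγ =>
      mem_indicesLE.2 ((mem_indicesLE.1 hγ).trans hαm)
    have ht := tendsto_finsetSum (indicesLE d (order α)) fun γ hγ => hf.lim γ (hle γ hγ)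
    have hB := ENNReal.Tendsto.const_mul (a := (C : ℝ≥0∞)) ht (Or.inr ENNReal.coe_ne_top)
    rw [Finset.sum_const_zero, mul_zero] at hB
    obtain ⟨g, hg, hgl⟩ := cauchySeq_eLpNorm_complete
      (fun n => memLp_mderiv (hsm n) (hcs n) α 2) hB fun n k => by
        have e : mderiv α (φ • f n) - mderiv α (φ • f k) = mderiv α (φ • (f n - f k)) := by
          rw [smul_sub, mderiv_sub α (hsm n) (hsm k)]
        rw [e]
        refine (hC (f n - f k) ((hf.smooth n).sub (hf.smooth k))).trans ?_
        rw [← mul_add, ← Finset.sum_add_distrib]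
        refine mul_le_mul' le_rfl (Finset.sum_le_sum fun γ hγ => ?_)
        rw [mderiv_sub γ (hf.smooth n) (hf.smooth k),
          ← sub_sub_sub_cancel_right _ _ (weakDeriv γ Ω u)]
        exact eLpNorm_sub_le (hm γ (hle γ hγ) n) (hm γ (hle γ hγ) k) (by norm_num)
    exact ⟨g, fun _ => ⟨hg, hgl⟩⟩
  choose g hg using hex
  have h0 := zero_mem_indicesLE d m
  have hlim : IsJetLimit m (fun n => φ • f n) g :=
    ⟨hsm, hcs, fun α hα => (hg α hα).1, fun α hα => (hg α hα).2⟩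
  refine ⟨g, hlim, ?_⟩
  -- the products also converge to `φ • u`
  have hc : HasCompactSupport φ := hK.of_isClosed_subset (isClosed_tsupport φ) hs
  obtain ⟨M, hM⟩ : ∃ C, ∀ x, ‖φ x‖ ≤ C := hφ.continuous.bounded_above_of_compact_support hc
  have hw0 : weakDeriv 0 Ω u =ᵐ[volume.restrict K] u :=
    ae_restrict_of_ae_restrict_of_subset hKΩ
      ((isWeakDeriv_zero hu.locallyIntegrableOn).weakDeriv_ae_eq hΩ)
  have huK : AEStronglyMeasurable u (volume.restrict K) :=
    (hf.memLp 0 h0).aestronglyMeasurable.congr hw0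
  have hφu : AEStronglyMeasurable (φ • u) volume := by
    have h1 : AEStronglyMeasurable (K.indicator (φ • u)) volume :=
      (aestronglyMeasurable_indicator_iff hK.measurableSet).2
        (hφ.continuous.aestronglyMeasurable.smul huK)
    refine h1.congr (Filter.Eventually.of_forall fun x => ?_)
    by_cases hx : x ∈ K
    · rw [indicator_of_mem hx]
    · rw [indicator_of_notMem hx, Pi.smul_apply',
        image_eq_zero_of_notMem_tsupport fun h => hx (hs h), zero_smul]
  have ht : Filter.Tendsto (fun n => eLpNorm (φ • f n - φ • u) 2 volume) Filter.atTop
      (nhds 0) := by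
    have hB := ENNReal.Tendsto.const_mul (a := ENNReal.ofReal M) (hf.lim 0 h0)
      (Or.inr ENNReal.ofReal_ne_top)
    rw [mul_zero] at hB
    refine tendsto_of_tendsto_of_tendsto_of_le_of_le tendsto_const_nhds hB (fun _ => zero_le)
      fun n => ?_
    rw [← smul_sub, ← eLpNorm_restrict_eq_of_support_subset (s := K) (fun x hx => hs (by
      by_contra hn
      exact hx (by simp [image_eq_zero_of_notMem_tsupport hn])))]
    refine eLpNorm_le_mul_eLpNorm_of_ae_le_mul ?_ 2
    filter_upwards [hw0] with x hx
    rw [Pi.smul_apply', norm_smul, Pi.sub_apply, Pi.sub_apply, mderiv_zero, hx]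
    exact mul_le_mul_of_nonneg_right (hM x) (norm_nonneg _)
  have hl := hlim.lim 0 h0
  simp only [mderiv_zero] at hl
  have hme : ∀ n, AEStronglyMeasurable (φ • f n) volume := fun n =>
    (hsm n).continuous.aestronglyMeasurable
  exact tendstoInMeasure_ae_unique
    (tendstoInMeasure_of_tendsto_eLpNorm (by norm_num) hme
      (hlim.memLp 0 h0).aestronglyMeasurable hl)
    (tendstoInMeasure_of_tendsto_eLpNorm (by norm_num) hme hφu ht)

end LocalSobolev

/-! ### Passage to the limit -/

section WeakCaccioppoli

variable {d N m : ℕ} {Ω K : Set (E d)} {u : E d → V N}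

lemma integral_norm_sq_eq_eLpNorm {X F : Type*} [MeasurableSpace X] [NormedAddCommGroup F]
    {μ : Measure X} {f : X → F} (hf : MemLp f 2 μ) :
    ∫ x, ‖f x‖ ^ 2 ∂μ = (eLpNorm f 2 μ).toReal ^ 2 := by
  rw [eLpNorm_two_eq_sqrt hf, ENNReal.toReal_ofReal (Real.sqrt_nonneg _),
    Real.sq_sqrt (integral_nonneg fun x => sq_nonneg _)]

/-- Squares integrated against a continuous weight over subsets of `K` are continuous for
convergence in `L^2(K)`. -/
lemma tendsto_setIntegral_weight {F : Type*} [NormedAddCommGroup F] [NormedSpace ℝ F]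
    (hK : IsCompact K) {S : Set (E d)} (hSK : S ⊆ K) {a : E d → ℝ} (ha : Continuous a)
    {f : ℕ → E d → F} {g : E d → F} (hf : ∀ n, MemLp (f n) 2 (volume.restrict K))
    (hg : MemLp g 2 (volume.restrict K))
    (h : Filter.Tendsto (fun n => eLpNorm (f n - g) 2 (volume.restrict K)) Filter.atTop (nhds 0)) :
    Filter.Tendsto (fun n => ∫ x in S, ‖a x • f n x‖ ^ 2) Filter.atTop
      (nhds (∫ x in S, ‖a x • g x‖ ^ 2)) := by
  obtain ⟨M, hM⟩ := hK.exists_bound_of_continuousOn ha.continuousOn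
  have hMae : ∀ w : E d → F, ∀ᵐ x ∂volume.restrict K, ‖a x • w x‖ ≤ M * ‖w x‖ := fun w =>
    (ae_restrict_iff' hK.measurableSet).2 (Filter.Eventually.of_forall fun x hx => by
      rw [norm_smul]; exact mul_le_mul_of_nonneg_right (hM x hx) (norm_nonneg _))
  have hmem : ∀ w : E d → F, MemLp w 2 (volume.restrict K) →
      MemLp (fun x => a x • w x) 2 (volume.restrict S) := fun w hw =>
    (hw.of_le_mul (ha.aestronglyMeasurable.smul hw.aestronglyMeasurable)
      (hMae w)).mono_measure (Measure.restrict_mono hSK le_rfl)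
  simp only [integral_norm_sq_eq_eLpNorm (hmem _ (hf _)), integral_norm_sq_eq_eLpNorm (hmem g hg)]
  have ht : Filter.Tendsto (fun n => eLpNorm ((fun x => a x • f n x) - fun x => a x • g x) 2
      (volume.restrict S)) Filter.atTop (nhds 0) := by
    have hB := ENNReal.Tendsto.const_mul (a := ENNReal.ofReal M) h (Or.inr ENNReal.ofReal_ne_top)
    rw [mul_zero] at hB
    refine tendsto_of_tendsto_of_tendsto_of_le_of_le tendsto_const_nhds hB (fun _ => zero_le)
      fun n => ?_
    have e : ((fun x => a x • f n x) - fun x => a x • g x) = fun x => a x • (f n - g) x := by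
      funext x; simp [smul_sub]
    rw [e]
    exact (eLpNorm_mono_measure _ (Measure.restrict_mono hSK le_rfl)).trans
      (eLpNorm_le_mul_eLpNorm_of_ae_le_mul (hMae _) 2)
  exact ((ENNReal.tendsto_toReal (hmem g hg).2.ne).comp
    (tendsto_eLpNorm_two_of_sub (fun n => hmem _ (hf n)) (hmem g hg) ht)).pow 2

lemma weight_norm_sq {F : Type*} [NormedAddCommGroup F] [NormedSpace ℝ F] (a : ℝ) (k : ℕ) (v : F) :
    a ^ (2 * k) * ‖v‖ ^ 2 = ‖a ^ k • v‖ ^ 2 := by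
  rw [norm_smul, mul_pow, norm_pow, ← pow_mul, mul_comm k 2, pow_mul, pow_mul, Real.norm_eq_abs,
    sq_abs]

lemma IsLocalApprox.tendsto_wInt {f : ℕ → E d → V N} (hf : IsLocalApprox m Ω K u f)
    (hK : IsCompact K) {S : Set (E d)} (hSK : S ⊆ K) (r : ℝ) {ρ : E d → ℝ} (hρ : Continuous ρ)
    {k : ℕ} (hk : k ≤ m) :
    Filter.Tendsto (fun n => wInt m r ρ S (fun γ => mderiv γ (f n)) k) Filter.atTop
      (nhds (wInt m r ρ S (fun γ => weakDeriv γ Ω u) k)) := by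
  refine tendsto_finsetSum _ fun γ hγ => Filter.Tendsto.const_mul _ ?_
  have hγ' : γ ∈ indicesLE d m := mem_indicesLE.2 ((mem_indicesEQ.1 hγ).le.trans hk)
  simp only [weight_norm_sq]
  exact tendsto_setIntegral_weight hK hSK (hρ.pow k)
    (fun n => (memLp_mderiv (hf.smooth n) (hf.compact n) γ 2).restrict K) (hf.memLp γ hγ')
    (hf.lim γ hγ')

/-- For `k ≥ 1` the weight `ρ^{2k}` restricts the integral to the set that supports `ρ`; for `k = 0`
there is no weight. -/
lemma wInt_univ_eq {F : Type*} [NormedAddCommGroup F] (m : ℕ) (r : ℝ) {ρ : E d → ℝ}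
    {S : Set (E d)} (hρ : ∀ x, x ∉ S → ρ x = 0) (w : MIndex d → E d → F) {k : ℕ} (hk : 1 ≤ k) :
    wInt m r ρ univ w k = wInt m r ρ S w k := by
  unfold wInt
  refine Finset.sum_congr rfl fun γ _ => ?_
  rw [Measure.restrict_univ, setIntegral_eq_integral_of_forall_compl_eq_zero fun x hx => by
    rw [hρ x hx, zero_pow (by omega), zero_mul]]

/-- The weighted interpolation inequality for functions that are locally in a Sobolev space. -/
lemma exists_weak_interpolation (d N m : ℕ) {C₀ ε : ℝ} (hC₀ : 0 ≤ C₀) (hε : 0 < ε) :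
    ∃ C : ℝ, 0 ≤ C ∧ ∀ (Ω K S : Set (E d)) (r : ℝ) (ρ : E d → ℝ) (u : E d → V N), IsOpen Ω →
      IsCompact K → K ⊆ Ω → MeasurableSet S → S ⊆ K → 0 < r → ContDiff ℝ ∞ ρ → (∀ x, 0 ≤ ρ x) →
      (∀ i x, |pderiv i ρ x| ≤ C₀ * r) → (∀ x, x ∉ S → ρ x = 0) → MemSobolevLoc m Ω u →
      ∀ k, k < m → wInt m r ρ S (fun γ => weakDeriv γ Ω u) k ≤
        ε * wInt m r ρ S (fun γ => weakDeriv γ Ω u) m +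
          C * wInt m r ρ S (fun γ => weakDeriv γ Ω u) 0 := by
  obtain ⟨C, hC, h⟩ := exists_weighted_interpolation (F := V N) d m hC₀ hε (innerSL ℝ)
    (fun v => real_inner_self_eq_norm_sq v) fun v w => abs_real_inner_le_norm v w
  refine ⟨C, hC, fun Ω K S r ρ u hΩ hK hKΩ hS hSK hr hρ hρ0 hρb hρS hu k hk => ?_⟩
  obtain ⟨f, hf⟩ := hu.exists_isLocalApprox hΩ hK hKΩ
  refine le_of_tendsto_of_tendsto' (hf.tendsto_wInt hK hSK r hρ.continuous hk.le)
    (((hf.tendsto_wInt hK hSK r hρ.continuous le_rfl).const_mul ε).add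
      ((hf.tendsto_wInt hK hSK r hρ.continuous (Nat.zero_le m)).const_mul C)) fun n => ?_
  exact h r ρ S (f n) hr hρ hρ0 hρb hS hρS (hf.smooth n) (hf.compact n) k hk

/-- The infimum in the definition of the dual norm is attained. -/
lemma norm_apply_le_dualNorm {T : Y0 d N m Ω →ₗ[ℂ] ℂ} (hT : MemYDual m Ω T) (ψ : Y0 d N m Ω) :
    ‖T ψ‖ ≤ dualNorm m Ω T * normY m Ω (ψ : E d → V N) := by
  have hY0 : ∀ φ : E d → V N, 0 ≤ normY m Ω φ := fun φ =>
    Finset.sum_nonneg fun _ _ => ENNReal.toReal_nonneg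
  obtain ⟨K₀, hK₀⟩ := hT
  rcases (hY0 ψ).eq_or_lt with h0 | hpos
  · have := hK₀ ψ
    rw [← h0, mul_zero] at this ⊢
    exact this
  · rw [← div_le_iff₀ hpos]
    refine le_csInf ⟨max K₀ 0, le_max_right _ _, fun φ => (hK₀ φ).trans ?_⟩ fun b hb => ?_
    · exact mul_le_mul_of_nonneg_right (le_max_left _ _) (hY0 φ)
    · rw [div_le_iff₀ hpos]
      exact hb.2 ψ

lemma dualNorm_nonneg (T : Y0 d N m Ω →ₗ[ℂ] ℂ) : 0 ≤ dualNorm m Ω T :=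
  Real.sInf_nonneg fun _ h => h.1

variable {p : ℕ → E d → V N} {g h : MIndex d → E d → V N}

lemma IsJetLimit.isWeakDeriv_of_ae_eq (hp : IsJetLimit m p g) {ψ : E d → V N}
    (h0 : g 0 =ᵐ[volume] ψ) {α : MIndex d} (hα : α ∈ indicesLE d m) :
    IsWeakDeriv α univ ψ (g α) :=
  (hp.isWeakDeriv hα).congr isOpen_univ (by rwa [Measure.restrict_univ]) (by rfl)

lemma IsJetLimit.ae_eq_zero (hp : IsJetLimit m p g) {α : MIndex d} (hα : α ∈ indicesLE d m)
    {S : Set (E d)} (hS : ∀ n, tsupport (p n) ⊆ S) : ∀ᵐ x, x ∉ S → g α x = 0 := by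
  obtain ⟨φ, hφ, hae⟩ := hp.exists_seq_tendsto_ae hα
  filter_upwards [hae] with x hx hxS
  refine tendsto_nhds_unique hx (tendsto_const_nhds.congr fun n => ?_)
  exact (image_eq_zero_of_notMem_tsupport fun h =>
    hxS (hS _ (tsupport_mderiv α (hp.smooth _) h))).symm

/-- A limit of jets of test functions that vanishes outside `Ω` is an admissible test function: its
derivatives lie in the critical Lebesgue spaces by the Sobolev inequality. -/
lemma IsJetLimit.mem_Y0 (hp : IsJetLimit m p g) {ψ : E d → V N} (h0 : g 0 =ᵐ[volume] ψ)
    (hψ : ∀ x, x ∉ Ω → ψ x = 0) : ψ ∈ Y0 d N m Ω := by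
  obtain ⟨C, hC⟩ := exists_sobolev_uniform (V N) d m
  refine ⟨⟨(hp.isWeakDeriv_of_ae_eq h0 (zero_mem_indicesLE d m)).1, fun α hα => ?_⟩,
    Filter.Eventually.of_forall hψ⟩
  have hα' : α ∈ indicesLE d m := (Finset.mem_filter.1 hα).1
  refine ⟨g α, hp.isWeakDeriv_of_ae_eq h0 hα', ?_⟩
  rw [Measure.restrict_univ]
  exact ⟨(hp.memLp α hα').aestronglyMeasurable, (hp.eLpNorm_critExp_le hC hα).trans_lt
    (ENNReal.mul_ne_top ENNReal.coe_ne_top hp.topNorm_ne_top).lt_top⟩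

/-- The norm of `Y^{m,2}(Ω)` is controlled by the derivatives of order `m` alone. -/
lemma IsJetLimit.normY_le (hp : IsJetLimit m p g) {C : ℝ≥0}
    (hC : ∀ k ≤ m, (k : ℝ) < d / 2 → ∀ f : E d → V N, ContDiff ℝ ∞ f → HasCompactSupport f →
      eLpNorm f (sobExp d k) volume ≤ C * gradNorm k f)
    {ψ : E d → V N} (h0 : g 0 =ᵐ[volume] ψ) (hΩ : IsOpen Ω) :
    normY m Ω ψ ≤ (indicesY d m).card * (C * (topNorm m g).toReal) := by
  unfold normY
  rw [← nsmul_eq_mul]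
  refine Finset.sum_le_card_nsmul _ _ _ fun α hα => ?_
  have hα' : α ∈ indicesLE d m := (Finset.mem_filter.1 hα).1
  have hae := ((hp.isWeakDeriv_of_ae_eq h0 hα').mono (subset_univ Ω)).weakDeriv_ae_eq hΩ
  have hle : eLpNorm (weakDeriv α Ω ψ) (critExp d m (order α)) (volume.restrict Ω) ≤
      C * topNorm m g := by
    rw [eLpNorm_congr_ae hae]
    exact (eLpNorm_restrict_le _ _ _ _).trans (hp.eLpNorm_critExp_le hC hα)
  refine (ENNReal.toReal_mono (ENNReal.mul_ne_top ENNReal.coe_ne_top hp.topNorm_ne_top)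
    hle).trans (le_of_eq ?_)
  simp

/-- The pairing of `Lu` with `φ u` in `Ω` is the value of the form on the global jets of `φ u` and
`χ u`, where `χ = 1` near the support of `φ`. -/
lemma IsJetLimit.jetForm_eq_conj_pairing (A : Coeff d N) {q : ℕ → E d → V N}
    (hp : IsJetLimit m p g) (hq : IsJetLimit m q h) (hΩ : IsOpen Ω) (hu : MemSobolevLoc m Ω u)
    {ψ : E d → V N} (hg0 : g 0 =ᵐ[volume] ψ) {χ : E d → ℝ} (hh0 : h 0 =ᵐ[volume] χ • u)
    {S U : Set (E d)} (hpS : ∀ n, tsupport (p n) ⊆ S) (hSU : S ⊆ U) (hU : IsOpen U) (hUΩ : U ⊆ Ω)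
    (hχ : ∀ x ∈ U, χ x = 1) : jetForm m A g h = conj (pairing m A Ω u ψ) := by
  simp only [jetForm, pairing, map_sum, ← integral_conj]
  refine Finset.sum_congr rfl fun j _ => Finset.sum_congr rfl fun k _ =>
    Finset.sum_congr rfl fun α hα => Finset.sum_congr rfl fun β hβ => ?_
  have hz := hp.ae_eq_zero hα hpS
  have a1 := ((hp.isWeakDeriv_of_ae_eq hg0 hα).mono (subset_univ Ω)).weakDeriv_ae_eq hΩ
  have a2 : IsWeakDeriv β U u (h β) := by
    refine ((hq.isWeakDeriv_of_ae_eq hh0 hβ).mono (subset_univ U)).congr hU ?_ (by rfl)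
    refine (ae_restrict_iff' hU.measurableSet).2 (Filter.Eventually.of_forall fun x hx => ?_)
    simp [hχ x hx]
  have a3 := a2.ae_eq hU ((hu.isWeakDeriv hβ).mono hUΩ)
  rw [Filter.EventuallyEq, ae_restrict_iff' hU.measurableSet] at a3
  rw [Filter.EventuallyEq, ae_restrict_iff' hΩ.measurableSet] at a1
  rw [← integral_indicator hΩ.measurableSet]
  refine integral_congr_ae ?_
  filter_upwards [hz, a1, a3] with x h1 h2 h3
  by_cases hxS : x ∈ S
  · have hxU := hSU hxS
    rw [indicator_of_mem (hUΩ hxU), h2 (hUΩ hxU), h3 hxU]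
    simp
  · rw [h1 hxS]
    by_cases hxΩ : x ∈ Ω
    · rw [indicator_of_mem hxΩ, h2 hxΩ, h1 hxS]
      simp
    · rw [indicator_of_notMem hxΩ]
      simp

/-- A cutoff `χ` that is `1` in a neighbourhood `U` of `S`, together with a compact set `K` that
supports it. -/
lemma exists_cutoff_one_nhds {S : Set (E d)} (hS : IsCompact S) (hΩ : IsOpen Ω) (hSΩ : S ⊆ Ω) :
    ∃ (K U : Set (E d)) (χ : E d → ℝ), IsCompact K ∧ K ⊆ Ω ∧ IsOpen U ∧ S ⊆ U ∧ U ⊆ K ∧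
      ContDiff ℝ ∞ χ ∧ tsupport χ ⊆ K ∧ ∀ x ∈ U, χ x = 1 := by
  obtain ⟨K, hK, hSK, hKΩ⟩ := exists_compact_between hS hΩ hSΩ
  obtain ⟨χ, h1, h0, -⟩ := exists_contMDiffMap_one_nhds_of_subset_interior (n := (⊤ : ℕ∞))
    𝓘(ℝ, E d) hS.isClosed hSK
  obtain ⟨U, hU, hSU, hU1⟩ := (mem_nhdsSet_iff_exists).1 h1
  refine ⟨K, U, χ, hK, hKΩ, hU, hSU, fun x hx => ?_, contMDiff_iff_contDiff.1 χ.contMDiff, ?_,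
    fun x hx => hU1 hx⟩
  · by_contra hn
    have e1 : χ x = 1 := hU1 hx
    rw [h0 x hn] at e1
    exact zero_ne_one e1
  · refine closure_minimal (fun x hx => ?_) hK.isClosed
    by_contra hn
    exact hx (h0 x hn)

end WeakCaccioppoli

/-! ### The Caccioppoli inequality for weak solutions -/

section WeakCaccioppoliMain

variable {d N m : ℕ}

/-- The form only sees its second argument where the first does not vanish. -/
lemma jetForm_congr_right {A : Coeff d N} {F G G' : MIndex d → E d → V N}
    (h : ∀ α ∈ indicesLE d m, ∀ β ∈ indicesLE d m, ∀ x, F α x = 0 ∨ G β x = G' β x) :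
    jetForm m A F G = jetForm m A F G' := by
  refine Finset.sum_congr rfl fun j _ => Finset.sum_congr rfl fun k _ =>
    Finset.sum_congr rfl fun α hα => Finset.sum_congr rfl fun β hβ => ?_
  congr 1
  funext x
  rcases h α hα β hβ x with h0 | h1
  · simp [h0]
  · rw [h1]

/-- Absorption of `√X`, which comes from the norm of the test function, into the left-hand side. -/
lemma absorb_caccioppoli {X I τ Z C M : ℝ} (hX : 0 ≤ X) (hI : 0 ≤ I) (hZ : 0 ≤ Z) (hC : 0 ≤ C)
    (h : X ≤ C * (I + τ * (M * (√X + √Z)) + Z)) :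
    X ≤ (2 * C ^ 2 * M ^ 2 + C * M ^ 2 + 3 * C) * (I + τ ^ 2 + Z) := by
  set a := √X
  set b := √Z
  have ha : a ^ 2 = X := Real.sq_sqrt hX
  have hb : b ^ 2 = Z := Real.sq_sqrt hZ
  have h1 : C * (τ * M * a) ≤ X / 2 + C ^ 2 * M ^ 2 * τ ^ 2 / 2 := by
    nlinarith [sq_nonneg (a - C * M * τ)]
  have h2 : C * (τ * M * b) ≤ C * (M ^ 2 * τ ^ 2 / 2 + Z / 2) := by
    refine mul_le_mul_of_nonneg_left ?_ hC
    nlinarith [sq_nonneg (b - M * τ)]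
  have h3 : X ≤ 2 * (C * I) + C ^ 2 * M ^ 2 * τ ^ 2 + C * M ^ 2 * τ ^ 2 + 3 * (C * Z) := by
    nlinarith
  refine h3.trans ?_
  have e1 : 0 ≤ C ^ 2 * M ^ 2 * I := by positivity
  have e2 : 0 ≤ C ^ 2 * M ^ 2 * Z := by positivity
  have e3 : 0 ≤ C * M ^ 2 * I := by positivity
  have e4 : 0 ≤ C * M ^ 2 * Z := by positivity
  have e5 : 0 ≤ C * τ ^ 2 := by positivity
  have e6 : 0 ≤ C * I := by positivity
  have e7 : 0 ≤ C ^ 2 * M ^ 2 * τ ^ 2 := by positivity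
  nlinarith

/-- The weighted Caccioppoli inequality for weak solutions. It follows from the inequality for
smooth functions, applied to mollifications of `u`, since the form evaluated at the approximations
of the test function `ρ^{2m} u` converges to the value of the functional `T` there. -/
lemma exists_weak_caccioppoli (d N m : ℕ) (hm : 1 ≤ m) (K : ℕ → ℝ) (CA : ℝ≥0) {lam : ℝ}
    (hlam : 0 < lam) :
    ∃ C : ℝ, 0 ≤ C ∧ ∀ (Ω P : Set (E d)) (r : ℝ) (ρ : E d → ℝ) (A : Coeff d N) (δ : ℝ)
      (u : E d → V N) (T : Y0 d N m Ω →ₗ[ℂ] ℂ), IsOpen Ω → 0 < r → IsCutoff K r ρ →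
      (∀ j, VanishOff P (pderiv j ρ)) → P ⊆ tsupport ρ → tsupport ρ ⊆ Ω →
      0 ≤ δ → FormBound m A CA → WeakGarding m A lam δ → MemSobolevLoc m Ω u → MemYDual m Ω T →
      SolvesIn m A Ω u T →
      wInt m r ρ univ (fun γ => weakDeriv γ Ω u) m ≤
        C * (δ * (∫ x, ‖ρ x ^ m • u x‖ ^ 2) + dualNorm m Ω T ^ 2 +
          lowerOrder m r ρ P fun γ => weakDeriv γ Ω u) := by
  obtain ⟨C₁, hC₁, h₁⟩ := exists_smooth_caccioppoli d N m K CA hlam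
  obtain ⟨C₂, hC₂, h₂⟩ := exists_gradNorm_test_le (d := d) (N := N) (K := K) m
  obtain ⟨C₃, h₃⟩ := exists_sobolev_uniform (V N) d m
  set M : ℝ := (indicesY d m).card * (C₃ * C₂) with hM
  have hM0 : 0 ≤ M := mul_nonneg (Nat.cast_nonneg _) (by positivity)
  refine ⟨2 * C₁ ^ 2 * M ^ 2 + C₁ * M ^ 2 + 3 * C₁, by positivity, ?_⟩
  intro Ω P r ρ A δ u T hΩ hr hρ hP hPρ hρΩ hδ hA hG hu hT hsol
  obtain ⟨L, U, χ, hL, hLΩ, hU, hρU, hUL, hχ, hχL, hχ1⟩ :=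
    exists_cutoff_one_nhds hρ.compact hΩ hρΩ
  have hρL : tsupport ρ ⊆ L := hρU.trans hUL
  obtain ⟨f, hf⟩ := hu.exists_isLocalApprox hΩ hL hLΩ
  have h2m : 2 * m ≠ 0 := by omega
  set φ : E d → ℝ := ρ ^ (2 * m) with hφ
  have hφs : ContDiff ℝ ∞ φ := hρ.smooth.pow _
  have hφρ : tsupport φ ⊆ tsupport ρ := by
    refine closure_mono fun x hx => ?_
    contrapose! hx
    simp only [Function.mem_support, not_not] at hx ⊢
    simp [hφ, hx, h2m]
  obtain ⟨g, hg, hg0⟩ := hf.exists_isJetLimit hu hΩ hL hLΩ hφs (hφρ.trans hρL)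
  obtain ⟨h, hh, hh0⟩ := hf.exists_isJetLimit hu hΩ hL hLΩ hχ hχL
  have hφu : φ • u ∈ Y0 d N m Ω := hg.mem_Y0 hg0 fun x hx => by
    rw [Pi.smul_apply', image_eq_zero_of_notMem_tsupport fun h => hx (hρΩ (hφρ h)), zero_smul]
  let D : ℕ → CutoffDatum d N K := fun n =>
    ⟨r, ρ, P, f n, hr, hρ, hP, hf.smooth n, hf.compact n⟩
  set w : MIndex d → E d → V N := fun γ => weakDeriv γ Ω u with hw
  have hρL0 : ∀ x, x ∉ L → ρ x = 0 := fun x hx =>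
    image_eq_zero_of_notMem_tsupport fun h => hx (hρL h)
  -- convergence of all quantities in the smooth inequality
  have tX : Filter.Tendsto (fun n => wInt m r ρ univ (fun γ => mderiv γ (f n)) m) Filter.atTop
      (nhds (wInt m r ρ univ w m)) := by
    simp only [wInt_univ_eq m r hρL0 _ hm]
    exact hf.tendsto_wInt hL subset_rfl r hρ.smooth.continuous le_rfl
  have tZ : Filter.Tendsto (fun n => (D n).low m) Filter.atTop
      (nhds (lowerOrder m r ρ P w)) :=
    tendsto_finsetSum _ fun k hk => hf.tendsto_wInt hL (hPρ.trans hρL) r hρ.smooth.continuous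
      (Finset.mem_range.1 hk).le
  have hu0 : weakDeriv 0 Ω u =ᵐ[volume.restrict L] u :=
    ae_restrict_of_ae_restrict_of_subset hLΩ
      ((isWeakDeriv_zero hu.locallyIntegrableOn).weakDeriv_ae_eq hΩ)
  have tI : Filter.Tendsto (fun n => ∫ x, ‖ρ x ^ m • f n x‖ ^ 2) Filter.atTop
      (nhds (∫ x, ‖ρ x ^ m • u x‖ ^ 2)) := by
    have e : ∀ v : E d → V N, ∫ x, ‖ρ x ^ m • v x‖ ^ 2 = ∫ x in L, ‖ρ x ^ m • v x‖ ^ 2 :=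
      fun v => (setIntegral_eq_integral_of_forall_compl_eq_zero fun x hx => by
        rw [hρL0 x hx, zero_pow (by omega), zero_smul, norm_zero, zero_pow two_ne_zero]).symm
    have e2 : ∫ x in L, ‖ρ x ^ m • u x‖ ^ 2 = ∫ x in L, ‖ρ x ^ m • weakDeriv 0 Ω u x‖ ^ 2 := by
      refine integral_congr_ae ?_
      filter_upwards [hu0] with x hx
      rw [hx]
    simp only [e]
    rw [e2]
    have h0 := zero_mem_indicesLE d m
    have hl := hf.lim 0 h0
    simp only [mderiv_zero] at hl
    exact tendsto_setIntegral_weight hL subset_rfl (hρ.smooth.continuous.pow m)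
      (fun n => by simpa using (memLp_mderiv (hf.smooth n) (hf.compact n) 0 2).restrict L)
      (hf.memLp 0 h0) hl
  have hcongr : ∀ n, jetForm m A (fun α => mderiv α (φ • f n)) (fun α => mderiv α (f n)) =
      jetForm m A (fun α => mderiv α (φ • f n)) fun α => mderiv α (χ • f n) := fun n => by
    refine jetForm_congr_right fun α _ β _ x => ?_
    by_cases hx : x ∈ tsupport ρ
    · right
      refine (mderiv_congr β ?_ (hf.smooth n) (hχ.smul (hf.smooth n))).eq_of_nhds
      filter_upwards [hU.mem_nhds (hρU hx)] with y hy
      rw [Pi.smul_apply', hχ1 y hy, one_smul]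
    · left
      refine image_eq_zero_of_notMem_tsupport fun h' => hx (hφρ ?_)
      exact closure_mono (Function.support_smul_subset_left φ (f n))
        (tsupport_mderiv α (hφs.smul (hf.smooth n)) h')
  have tB : Filter.Tendsto (fun n => ‖jetForm m A (fun α => mderiv α (φ • f n))
      (fun α => mderiv α (f n))‖) Filter.atTop (nhds ‖jetForm m A g h‖) := by
    simp only [hcongr]
    exact (hg.tendsto_jetForm hA hh).norm
  have hX : wInt m r ρ univ w m ≤ C₁ * (δ * (∫ x, ‖ρ x ^ m • u x‖ ^ 2) + ‖jetForm m A g h‖ +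
      lowerOrder m r ρ P w) :=
    le_of_tendsto_of_tendsto' tX ((((tI.const_mul δ).add tB).add tZ).const_mul C₁)
      fun n => h₁ (D n) A δ hδ hA hG
  -- the form is the value of `T` at the test function `φ • u`
  have hform : ‖jetForm m A g h‖ = ‖T ⟨φ • u, hφu⟩‖ := by
    rw [hg.jetForm_eq_conj_pairing A hh hΩ hu hg0 hh0 (S := tsupport ρ) (U := U) (fun n => ?_)
      hρU hU (hUL.trans hLΩ) hχ1, RCLike.norm_conj, ← hsol ⟨φ • u, hφu⟩]
    exact (closure_mono (Function.support_smul_subset_left φ (f n))).trans hφρ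
  have htop : topNorm m g ≤
      ENNReal.ofReal (C₂ * (√(wInt m r ρ univ w m) + √(lowerOrder m r ρ P w))) := by
    refine le_of_tendsto_of_tendsto' hg.tendsto_gradNorm (ENNReal.tendsto_ofReal
      (((Real.continuous_sqrt.tendsto _).comp tX).add
        ((Real.continuous_sqrt.tendsto _).comp tZ) |>.const_mul C₂)) fun n => h₂ (D n)
  have hnorm : normY m Ω (φ • u) ≤
      M * (√(wInt m r ρ univ w m) + √(lowerOrder m r ρ P w)) := by
    refine (hg.normY_le h₃ hg0 hΩ).trans ?_
    have := ENNReal.toReal_mono ENNReal.ofReal_ne_top htop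
    rw [ENNReal.toReal_ofReal (by positivity)] at this
    calc ((indicesY d m).card : ℝ) * (C₃ * (topNorm m g).toReal)
        ≤ (indicesY d m).card * (C₃ * (C₂ * (√(wInt m r ρ univ w m) +
          √(lowerOrder m r ρ P w)))) := by gcongr
      _ = _ := by rw [hM]; ring
  refine absorb_caccioppoli (wInt_nonneg m hr.le _ _ _ m)
    (mul_nonneg hδ (integral_nonneg fun x => sq_nonneg _)) (lowerOrder_nonneg m hr.le _ _ _) hC₁
    (hX.trans (mul_le_mul_of_nonneg_left ?_ hC₁))
  have hTle := (norm_apply_le_dualNorm hT ⟨φ • u, hφu⟩).trans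
    (mul_le_mul_of_nonneg_left hnorm (dualNorm_nonneg T))
  rw [hform]
  linarith

end WeakCaccioppoliMain

/-! ### Cutoff functions adapted to cubes -/

section CubeCutoffs

variable {d : ℕ}

lemma exists_iteratedDeriv_smoothTransition_bound (k : ℕ) :
    ∃ C : ℝ, 0 ≤ C ∧ ∀ t, |iteratedDeriv k Real.smoothTransition t| ≤ C := by
  have hS : ContDiff ℝ ∞ Real.smoothTransition := Real.smoothTransition.contDiff
  have hc : Continuous (iteratedDeriv k Real.smoothTransition) :=
    hS.continuous_iteratedDeriv k (by exact_mod_cast le_top)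
  obtain ⟨M, hM⟩ := (isCompact_Icc (a := (0 : ℝ)) (b := 1)).exists_bound_of_continuousOn
    hc.continuousOn
  -- away from `[0, 1]` the smooth transition is locally constant
  have hout : ∀ (t a : ℝ), |a| ≤ 1 → Real.smoothTransition =ᶠ[nhds t] (fun _ => a) →
      |iteratedDeriv k Real.smoothTransition t| ≤ 1 := fun t a ha h => by
    rw [h.iteratedDeriv_eq k, iteratedDeriv_const]
    split_ifs
    · exact ha
    · simp
  refine ⟨max M 1, le_max_of_le_right zero_le_one, fun t => ?_⟩
  by_cases h0 : t < 0
  · refine (hout t 0 (by simp) ?_).trans (le_max_right _ _)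
    filter_upwards [Iio_mem_nhds h0] with s hs
    exact Real.smoothTransition.zero_of_nonpos (le_of_lt hs)
  by_cases h1 : 1 < t
  · refine (hout t 1 (by simp) ?_).trans (le_max_right _ _)
    filter_upwards [Ioi_mem_nhds h1] with s hs
    exact Real.smoothTransition.one_of_one_le (le_of_lt hs)
  exact (hM t ⟨not_lt.1 h0, not_lt.1 h1⟩).trans (le_max_left _ _)

/-- Derivatives of a function of one affine coordinate `q x_i + b`; the number `κ` is a power of
`q`, or `0` if `ξ` involves another coordinate. -/
lemma exists_mderiv_comp_coord {G : ℝ → ℝ} (hG : ContDiff ℝ ∞ G) (i : Fin d) (q b : ℝ)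
    (ξ : MIndex d) : ∃ κ : ℝ, |κ| ≤ |q| ^ order ξ ∧
      mderiv ξ (fun x : E d => G (q * x i + b)) =
        fun x => κ * iteratedDeriv (order ξ) G (q * x i + b) := by
  have hf : ContDiff ℝ ∞ fun x : E d => G (q * x i + b) :=
    hG.comp ((contDiff_const.mul (contDiff_apply ℝ ℝ i)).add contDiff_const)
  induction ξ using mindex_induction with
  | h0 => exact ⟨1, by simp [order_zero], by funext x; simp [order_zero]⟩
  | hs ξ j ih =>
    obtain ⟨κ, hκ, e⟩ := ih
    refine ⟨κ * (q * (Pi.single j (1 : ℝ) : E d) i), ?_, ?_⟩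
    · rw [abs_mul, abs_mul, order_add_single, pow_succ]
      gcongr
      refine mul_le_of_le_one_right (abs_nonneg q) ?_
      rw [Pi.single_apply]
      split_ifs <;> simp
    · rw [mderiv_add_single ξ j hf, e]
      funext x
      have hd : HasDerivAt (iteratedDeriv (order ξ) G)
          (iteratedDeriv (order ξ + 1) G (q * x i + b)) (q * x i + b) := by
        rw [iteratedDeriv_succ]
        exact ((hG.differentiable_iteratedDeriv (order ξ)
          (by exact_mod_cast ENat.natCast_lt_top _)) _).hasDerivAt
      have hl : HasFDerivAt (fun x : E d => q * x i + b)
          (q • (ContinuousLinearMap.proj i : E d →L[ℝ] ℝ)) x :=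
        ((ContinuousLinearMap.proj (R := ℝ) (φ := fun _ : Fin d => ℝ) i).hasFDerivAt.const_mul
          q).add_const b
      have h3 := (hd.comp_hasFDerivAt x hl).const_mul κ
      rw [pderiv, order_add_single]
      erw [h3.fderiv]
      simp
      ring

/-- The index set of the family of all cutoffs: the length `h` of the transition, the center and
the half side length of the cube on which the cutoff is `1`. -/
abbrev CutoffIndex (d : ℕ) := {h : ℝ // 0 < h} × E d × ℝ

/-- A smooth function that is `1` on the cube with center `c` and half side length `a`, and `0`
outside the cube with half side length `a + h`. -/
noncomputable def cubeCutoff (h : ℝ) (c : E d) (a : ℝ) : E d → ℝ :=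
  ∏ i, (fun x => Real.smoothTransition ((a + h - (x i - c i)) / h)) *
    fun x => Real.smoothTransition ((a + h + (x i - c i)) / h)

lemma cubeCutoff_apply (h : ℝ) (c : E d) (a : ℝ) (x : E d) : cubeCutoff h c a x =
    ∏ i, (Real.smoothTransition ((a + h - (x i - c i)) / h) *
      Real.smoothTransition ((a + h + (x i - c i)) / h)) := by
  simp [cubeCutoff, Finset.prod_apply]

lemma isSymbol_smoothTransition (i : Fin d) (σ : ℝ) (hσ : |σ| ≤ 1) (b : CutoffIndex d → ℝ) :
    IsSymbol (fun t : CutoffIndex d => 1 / (t.1 : ℝ)) 0 fun t (x : E d) =>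
      Real.smoothTransition (σ * (1 / t.1) * x i + b t) := by
  have hS : ContDiff ℝ ∞ Real.smoothTransition := Real.smoothTransition.contDiff
  refine ⟨fun t => hS.comp ((contDiff_const.mul (contDiff_apply ℝ ℝ i)).add contDiff_const),
    fun ξ => ?_⟩
  obtain ⟨C, hC, hb⟩ := exists_iteratedDeriv_smoothTransition_bound (order ξ)
  refine ⟨C, hC, fun t x => ?_⟩
  obtain ⟨κ, hκ, e⟩ := exists_mderiv_comp_coord hS i (σ * (1 / t.1)) (b t) ξ
  have ht : 0 < (t.1 : ℝ) := t.1.2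
  rw [e, abs_mul, zero_add, mul_comm C]
  refine mul_le_mul (hκ.trans ?_) (hb _) (abs_nonneg _) (by positivity)
  refine pow_le_pow_left₀ (abs_nonneg _) ?_ _
  rw [abs_mul, abs_of_pos (show 0 < 1 / (t.1 : ℝ) by positivity)]
  exact mul_le_of_le_one_left (by positivity) hσ

lemma isSymbol_cubeCutoff :
    IsSymbol (fun t : CutoffIndex d => 1 / (t.1 : ℝ)) 0 fun t => cubeCutoff t.1 t.2.1 t.2.2 := by
  have hr : ∀ t : CutoffIndex d, 0 ≤ 1 / (t.1 : ℝ) := fun t => (one_div_pos.2 t.1.2).le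
  have hfac : ∀ i : Fin d, IsSymbol (fun t : CutoffIndex d => 1 / (t.1 : ℝ)) 0
      fun t : CutoffIndex d =>
        (fun x : E d => Real.smoothTransition ((t.2.2 + t.1 - (x i - t.2.1 i)) / t.1)) *
          fun x => Real.smoothTransition ((t.2.2 + t.1 + (x i - t.2.1 i)) / t.1) := fun i => by
    have h1 := isSymbol_smoothTransition i (-1) (by simp)
      fun t => (t.2.2 + t.1 + t.2.1 i) / t.1
    have h2 := isSymbol_smoothTransition i 1 (by simp)
      fun t => (t.2.2 + t.1 - t.2.1 i) / t.1
    have h3 := h1.mul hr h2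
    have e : (fun (t : CutoffIndex d) =>
        (fun x : E d => Real.smoothTransition ((t.2.2 + t.1 - (x i - t.2.1 i)) / t.1)) *
          fun x => Real.smoothTransition ((t.2.2 + t.1 + (x i - t.2.1 i)) / t.1)) =
        fun t => (fun x : E d => Real.smoothTransition
          (-1 * (1 / t.1) * x i + (t.2.2 + t.1 + t.2.1 i) / t.1)) *
          fun x => Real.smoothTransition (1 * (1 / t.1) * x i + (t.2.2 + t.1 - t.2.1 i) / t.1) := by
      funext t x
      simp only [Pi.mul_apply]
      congr 2 <;> ring
    rw [e]
    exact h3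
  have hprod : ∀ s : Finset (Fin d), IsSymbol (fun t : CutoffIndex d => 1 / (t.1 : ℝ)) 0
      fun t : CutoffIndex d => ∏ i ∈ s,
        (fun x : E d => Real.smoothTransition ((t.2.2 + t.1 - (x i - t.2.1 i)) / t.1)) *
          fun x => Real.smoothTransition ((t.2.2 + t.1 + (x i - t.2.1 i)) / t.1) := by
    classical
    intro s
    induction s using Finset.induction_on with
    | empty =>
      simp only [Finset.prod_empty]
      exact isSymbol_const 1 hr
    | insert i s hi ih =>
      simp only [Finset.prod_insert hi]
      exact (hfac i).mul hr ih
  exact hprod Finset.univ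

lemma cubeCutoff_nonneg (h : ℝ) (c : E d) (a : ℝ) (x : E d) : 0 ≤ cubeCutoff h c a x := by
  rw [cubeCutoff_apply]
  exact Finset.prod_nonneg fun i _ => mul_nonneg (Real.smoothTransition.nonneg _)
    (Real.smoothTransition.nonneg _)

lemma cubeCutoff_le_one (h : ℝ) (c : E d) (a : ℝ) (x : E d) : cubeCutoff h c a x ≤ 1 := by
  rw [cubeCutoff_apply]
  exact Finset.prod_le_one (fun i _ => mul_nonneg (Real.smoothTransition.nonneg _)
    (Real.smoothTransition.nonneg _)) fun i _ => mul_le_one₀ (Real.smoothTransition.le_one _)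
    (Real.smoothTransition.nonneg _) (Real.smoothTransition.le_one _)

lemma cubeCutoff_eq_one {h : ℝ} (hh : 0 < h) {c : E d} {a : ℝ} {x : E d}
    (hx : ∀ i, |x i - c i| ≤ a) : cubeCutoff h c a x = 1 := by
  rw [cubeCutoff_apply]
  refine Finset.prod_eq_one fun i _ => ?_
  have := abs_le.1 (hx i)
  rw [Real.smoothTransition.one_of_one_le (by rw [le_div_iff₀ hh]; linarith),
    Real.smoothTransition.one_of_one_le (by rw [le_div_iff₀ hh]; linarith), one_mul]

lemma cubeCutoff_eq_zero {h : ℝ} (hh : 0 < h) {c : E d} {a : ℝ} {x : E d} {i : Fin d}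
    (hx : a + h ≤ |x i - c i|) : cubeCutoff h c a x = 0 := by
  rw [cubeCutoff_apply]
  refine Finset.prod_eq_zero (Finset.mem_univ i) ?_
  rcases le_abs.1 hx with h1 | h1
  · rw [Real.smoothTransition.zero_of_nonpos (div_nonpos_of_nonpos_of_nonneg (by linarith) hh.le),
      zero_mul]
  · rw [Real.smoothTransition.zero_of_nonpos (x := (a + h + (x i - c i)) / h)
      (div_nonpos_of_nonpos_of_nonneg (by linarith) hh.le), mul_zero]

lemma isClosed_closedCube (c : E d) (b : ℝ) : IsClosed {x : E d | ∀ i, |x i - c i| ≤ b} := by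
  rw [Set.ofPred_forall]
  exact isClosed_iInter fun i => isClosed_le (by fun_prop) continuous_const

lemma isCompact_closedCube (c : E d) (b : ℝ) : IsCompact {x : E d | ∀ i, |x i - c i| ≤ b} := by
  refine (isCompact_closedBall c (max b 0)).of_isClosed_subset (isClosed_closedCube c b) ?_
  intro x hx
  rw [mem_closedBall_iff_norm]
  refine (pi_norm_le_iff_of_nonneg (le_max_right _ _)).2 fun i => ?_
  exact (hx i).trans (le_max_left _ _)

lemma tsupport_cubeCutoff_subset {h : ℝ} (hh : 0 < h) (c : E d) (a : ℝ) :
    tsupport (cubeCutoff h c a) ⊆ {x | ∀ i, |x i - c i| ≤ a + h} := by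
  refine closure_minimal (fun x hx i => ?_) (isClosed_closedCube c _)
  by_contra hn
  exact hx (cubeCutoff_eq_zero hh (not_le.1 hn).le)

/-- The cutoffs for all cubes satisfy uniform bounds with respect to the length of transition. -/
lemma exists_isCutoff_cubeCutoff (d : ℕ) :
    ∃ K : ℕ → ℝ, ∀ (h : ℝ) (c : E d) (a : ℝ), 0 < h → IsCutoff K (1 / h) (cubeCutoff h c a) := by
  choose C hC hb using (isSymbol_cubeCutoff (d := d)).2
  refine ⟨fun k => ∑ ξ ∈ indicesEQ d k, C ξ, fun h c a hh => ?_⟩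
  refine ⟨isSymbol_cubeCutoff.1 (⟨h, hh⟩, c, a), (isCompact_closedCube c _).of_isClosed_subset
    (isClosed_tsupport _) (tsupport_cubeCutoff_subset hh c a), cubeCutoff_nonneg h c a,
    cubeCutoff_le_one h c a, fun ξ x => ?_⟩
  have h1 := hb ξ (⟨h, hh⟩, c, a) x
  rw [zero_add] at h1
  refine h1.trans (mul_le_mul_of_nonneg_right ?_ (by positivity))
  exact Finset.single_le_sum (f := C) (fun ξ _ => hC ξ) (mem_indicesEQ.2 rfl)

/-- The difference of two nested cutoffs is a cutoff for the region between the cubes. -/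
lemma IsCutoff.sub {K : ℕ → ℝ} {r : ℝ} {ρ ρ' : E d → ℝ} (hρ : IsCutoff K r ρ)
    (hρ' : IsCutoff K r ρ') (h : ∀ x, ρ' x ≤ ρ x) :
    IsCutoff (fun k => 2 * K k) r (ρ - ρ') := by
  refine ⟨hρ.smooth.sub hρ'.smooth, hρ.compact.sub hρ'.compact, fun x => sub_nonneg.2 (h x),
    fun x => ?_, fun ξ x => ?_⟩
  · have := hρ'.nonneg x
    have := hρ.le_one x
    rw [Pi.sub_apply]; linarith
  · rw [mderiv_sub ξ hρ.smooth hρ'.smooth, Pi.sub_apply]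
    have h1 := hρ.bound ξ x
    have h2 := hρ'.bound ξ x
    calc |mderiv ξ ρ x - mderiv ξ ρ' x| ≤ |mderiv ξ ρ x| + |mderiv ξ ρ' x| := abs_sub _ _
      _ ≤ 2 * K (order ξ) * r ^ order ξ := by linarith

/-- The support of the gradient of a function. -/
def gradSupport (ρ : E d → ℝ) : Set (E d) := ⋃ j, tsupport (pderiv j ρ)

lemma isClosed_gradSupport (ρ : E d → ℝ) : IsClosed (gradSupport ρ) :=
  isClosed_iUnion_of_finite fun _ => isClosed_tsupport _

lemma gradSupport_subset {ρ : E d → ℝ} (hρ : ContDiff ℝ ∞ ρ) : gradSupport ρ ⊆ tsupport ρ :=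
  iUnion_subset fun j => tsupport_pderiv j hρ

lemma vanishOff_gradSupport (ρ : E d → ℝ) (j : Fin d) :
    VanishOff (gradSupport ρ) (pderiv j ρ) := fun _ hx =>
  notMem_tsupport_iff_eventuallyEq.1 fun h => hx (mem_iUnion.2 ⟨j, h⟩)

lemma disjoint_gradSupport {ρ : E d → ℝ} {U : Set (E d)} (hU : IsOpen U) {a : ℝ}
    (h : ∀ x ∈ U, ρ x = a) : Disjoint (gradSupport ρ) U := by
  rw [Set.disjoint_left]
  rintro x hx hxU
  obtain ⟨j, hj⟩ := mem_iUnion.1 hx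
  refine (notMem_tsupport_iff_eventuallyEq.2 ?_) hj
  filter_upwards [hU.mem_nhds hxU] with y hy
  have e : ρ =ᶠ[nhds y] fun _ => a := by
    filter_upwards [hU.mem_nhds hy] with z hz using h z hz
  rw [pderiv, e.fderiv_eq]
  simp

end CubeCutoffs

/-! ### Weighted integrals and integrals over regions -/

section WeightedIntegrals

variable {d N m k : ℕ} {Ω K S S' : Set (E d)} {u : E d → V N} {r : ℝ} {ρ ρ' : E d → ℝ}

lemma MemSobolevLoc.integrableOn_weight (hu : MemSobolevLoc m Ω u) (hΩ : IsOpen Ω)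
    (hK : IsCompact K) (hKΩ : K ⊆ Ω) (hρ : Continuous ρ) (k : ℕ) {γ : MIndex d}
    (hγ : γ ∈ indicesLE d m) :
    IntegrableOn (fun x => ρ x ^ (2 * k) * ‖weakDeriv γ Ω u x‖ ^ 2) K :=
  IntegrableOn.continuousOn_mul (hρ.pow _).continuousOn
    ((hu.memLpLoc hΩ hγ K hKΩ hK).integrable_norm_pow two_ne_zero) hK

lemma MemSobolevLoc.lintegral_gradSq (hu : MemSobolevLoc m Ω u) (hS : S ⊆ Ω)
    (hk : k ≤ m) : ∫⁻ x in S, gradSq k Ω u x =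
      ∑ γ ∈ indicesEQ d k, ∫⁻ x in S, ‖weakDeriv γ Ω u x‖ₑ ^ 2 := by
  unfold gradSq
  refine lintegral_finsetSum' _ fun γ hγ => ?_
  have hγ' : γ ∈ indicesLE d m := mem_indicesLE.2 ((mem_indicesEQ.1 hγ).le.trans hk)
  exact (((hu.isWeakDeriv hγ').2.1.aestronglyMeasurable.mono_measure
    (Measure.restrict_mono hS le_rfl)).enorm).pow_const 2

lemma MemSobolevLoc.lintegral_gradSq_zero (hu : MemSobolevLoc m Ω u) (hΩ : IsOpen Ω)
    (hS : S ⊆ Ω) : ∫⁻ x in S, gradSq 0 Ω u x = ∫⁻ x in S, ‖u x‖ₑ ^ 2 := by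
  have h0 : indicesEQ d 0 = {0} := by
    ext γ; rw [mem_indicesEQ, order_eq_zero, Finset.mem_singleton]
  refine lintegral_congr_ae ?_
  have := ae_restrict_of_ae_restrict_of_subset hS
    ((isWeakDeriv_zero hu.locallyIntegrableOn).weakDeriv_ae_eq hΩ)
  filter_upwards [this] with x hx
  simp [gradSq, h0, hx]

lemma ofReal_integral_weight_le {F : Type*} [NormedAddCommGroup F] [NormedSpace ℝ F]
    (hρ0 : ∀ x, 0 ≤ ρ x) (hρ1 : ∀ x, ρ x ≤ 1) (hSS : S ⊆ S') (k : ℕ) (w : E d → F) :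
    ENNReal.ofReal (∫ x in S, ‖ρ x ^ k • w x‖ ^ 2) ≤ ∫⁻ x in S', ‖w x‖ₑ ^ 2 := by
  refine (Real.ofReal_le_enorm _).trans ((enorm_integral_le_lintegral_enorm _).trans
    ((lintegral_mono fun x => ?_).trans (lintegral_mono_set hSS)))
  rw [enorm_pow, enorm_norm, enorm_smul]
  gcongr
  refine mul_le_of_le_one_left zero_le ?_
  rw [Real.enorm_of_nonneg (pow_nonneg (hρ0 x) k), ENNReal.ofReal_le_one]
  exact pow_le_one₀ (hρ0 x) (hρ1 x)

lemma MemSobolevLoc.ofReal_wInt_le (hu : MemSobolevLoc m Ω u) (hr : 0 ≤ r)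
    (hρ0 : ∀ x, 0 ≤ ρ x) (hρ1 : ∀ x, ρ x ≤ 1) (hSS : S ⊆ S') (hS : S' ⊆ Ω) (hk : k ≤ m) :
    ENNReal.ofReal (wInt m r ρ S (fun γ => weakDeriv γ Ω u) k) ≤
      ENNReal.ofReal (r ^ (2 * (m - k))) * ∫⁻ x in S', gradSq k Ω u x := by
  rw [hu.lintegral_gradSq hS hk, wInt, ENNReal.ofReal_sum_of_nonneg, Finset.mul_sum]
  · refine Finset.sum_le_sum fun γ _ => ?_
    rw [ENNReal.ofReal_mul (by positivity)]
    simp only [weight_norm_sq]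
    gcongr
    exact ofReal_integral_weight_le hρ0 hρ1 hSS k _
  · intro γ _
    refine mul_nonneg (by positivity) (integral_nonneg fun x => ?_)
    have := hρ0 x
    positivity

lemma MemSobolevLoc.le_ofReal_wInt (hu : MemSobolevLoc m Ω u) (hΩ : IsOpen Ω) (hr : 0 ≤ r)
    (hρ : Continuous ρ) (hρ1 : ∀ x ∈ S, ρ x = 1) (hS : MeasurableSet S) (hSK : S ⊆ K)
    (hK : IsCompact K) (hKΩ : K ⊆ Ω) (hk : k ≤ m) :
    ENNReal.ofReal (r ^ (2 * (m - k))) * ∫⁻ x in S, gradSq k Ω u x ≤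
      ENNReal.ofReal (wInt m r ρ K (fun γ => weakDeriv γ Ω u) k) := by
  have hnn : ∀ (γ : MIndex d) x, 0 ≤ ρ x ^ (2 * k) * ‖weakDeriv γ Ω u x‖ ^ 2 := fun γ x => by
    rw [weight_norm_sq]; positivity
  rw [hu.lintegral_gradSq (hSK.trans hKΩ) hk, wInt, ENNReal.ofReal_sum_of_nonneg,
    Finset.mul_sum]
  · refine Finset.sum_le_sum fun γ hγ => ?_
    have hγ' : γ ∈ indicesLE d m := mem_indicesLE.2 ((mem_indicesEQ.1 hγ).le.trans hk)
    rw [ENNReal.ofReal_mul (by positivity), ofReal_integral_eq_lintegral_ofReal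
      (hu.integrableOn_weight hΩ hK hKΩ hρ k hγ') (Filter.Eventually.of_forall (hnn γ))]
    refine mul_le_mul' le_rfl (le_trans (le_of_eq ?_) (lintegral_mono_set hSK))
    refine setLIntegral_congr_fun hS fun x hx => ?_
    simp only [hρ1 x hx, one_pow, one_mul]
    rw [ENNReal.ofReal_pow (norm_nonneg _), ofReal_norm]
  · intro γ _
    exact mul_nonneg (by positivity) (integral_nonneg (hnn γ))

lemma MemSobolevLoc.wInt_mono (hu : MemSobolevLoc m Ω u) (hΩ : IsOpen Ω) (hr : 0 ≤ r)
    (hρ : Continuous ρ) (hρ' : Continuous ρ') (hρ0 : ∀ x, 0 ≤ ρ x) (hρρ : ∀ x ∈ S, ρ x ≤ ρ' x)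
    (hS : MeasurableSet S) (hSS : S ⊆ S') (hK : IsCompact K)
    (hSK : S' ⊆ K) (hKΩ : K ⊆ Ω) (hk : k ≤ m) :
    wInt m r ρ S (fun γ => weakDeriv γ Ω u) k ≤ wInt m r ρ' S' (fun γ => weakDeriv γ Ω u) k := by
  refine Finset.sum_le_sum fun γ hγ => mul_le_mul_of_nonneg_left ?_ (by positivity)
  have hγ' : γ ∈ indicesLE d m := mem_indicesLE.2 ((mem_indicesEQ.1 hγ).le.trans hk)
  have i1 := (hu.integrableOn_weight hΩ hK hKΩ hρ k hγ').mono_set (hSS.trans hSK)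
  have i2 := (hu.integrableOn_weight hΩ hK hKΩ hρ' k hγ').mono_set hSK
  refine (setIntegral_mono_on i1 (i2.mono_set hSS) hS fun x hx => ?_).trans
    (setIntegral_mono_set i2 (Filter.Eventually.of_forall fun x => ?_) hSS.eventuallyLE)
  · exact mul_le_mul_of_nonneg_right (pow_le_pow_left₀ (hρ0 x) (hρρ x hx) _) (sq_nonneg _)
  · change 0 ≤ ρ' x ^ (2 * k) * ‖weakDeriv γ Ω u x‖ ^ 2
    rw [weight_norm_sq]
    positivity

end WeightedIntegrals

/-! ### The estimates in concentric cubes -/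

section CubeEstimates

variable {d N m : ℕ}

lemma IsCutoff.abs_pderiv_le {K : ℕ → ℝ} {r : ℝ} {ρ : E d → ℝ} (hρ : IsCutoff K r ρ)
    (hr : 0 ≤ r) (i : Fin d) (x : E d) : |pderiv i ρ x| ≤ |K 1| * r := by
  have h := hρ.bound (Pi.single i 1) x
  have ho : order (Pi.single i 1 : MIndex d) = 1 := by
    have := order_add_single (0 : MIndex d) i
    rwa [zero_add, order_zero, zero_add] at this
  rw [mderiv_single i hρ.smooth, ho, pow_one] at h
  exact h.trans (mul_le_mul_of_nonneg_right (le_abs_self _) hr)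

lemma isOpen_cube (c : E d) (l : ℝ) : IsOpen (cube c l) := by
  rw [cube, Set.ofPred_forall]
  exact isOpen_iInter_of_finite fun i => isOpen_lt (by fun_prop) continuous_const

lemma cube_eq_ball (c : E d) {l : ℝ} (hl : 0 < l) : cube c l = Metric.ball c (l / 2) := by
  ext x
  rw [Metric.mem_ball, dist_pi_lt_iff (by positivity)]
  exact Iff.rfl

/-- Two cutoffs with their supports for a cube `cube c l` inside `cube c (l + 10 h)`: `ρ` is `1` on
the small cube, and `ρ'` vanishes there and is `1` where the gradient of `ρ` does not vanish. -/
lemma exists_cutoff_pair (d : ℕ) : ∃ K : ℕ → ℝ, ∀ (c : E d) (l h : ℝ), 0 < l → 0 < h →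
    ∃ (ρ ρ' : E d → ℝ) (L : Set (E d)), IsCutoff K (1 / h) ρ ∧
      IsCutoff (fun k => 2 * K k) (1 / h) ρ' ∧ IsCompact L ∧ L ⊆ cube c (l + 10 * h) ∧
      cube c l ⊆ L ∧ tsupport ρ ⊆ L ∧ tsupport ρ' ⊆ L ∧ (∀ x ∈ cube c l, ρ x = 1) ∧
      (∀ x, x ∉ L \ cube c l → ρ' x = 0) ∧ gradSupport ρ ⊆ L \ cube c l ∧
      gradSupport ρ' ⊆ L \ cube c l ∧ ∀ x ∈ gradSupport ρ, ρ' x = 1 := by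
  obtain ⟨K, hK⟩ := exists_isCutoff_cubeCutoff d
  refine ⟨K, fun c l h hl hh => ?_⟩
  -- `ρ` decreases at distances `2h` to `3h` from the small cube; `ρo - ρi` increases at distances
  -- `0` to `h`, decreases at `3h` to `4h`, and is `1` in between
  set ρ := cubeCutoff h c (l / 2 + 2 * h) with hρ
  set ρo := cubeCutoff h c (l / 2 + 3 * h) with hρo
  set ρi := cubeCutoff h c (l / 2) with hρi
  set L : Set (E d) := {x | ∀ i, |x i - c i| ≤ l / 2 + 4 * h} with hL
  have hcρ : IsCutoff K (1 / h) ρ := hK h c _ hh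
  have hco : IsCutoff K (1 / h) ρo := hK h c _ hh
  have hci : IsCutoff K (1 / h) ρi := hK h c _ hh
  have hQ : ∀ x ∈ cube c l, ∀ i, |x i - c i| ≤ l / 2 := fun x hx i => (hx i).le
  have hQL : cube c l ⊆ L := fun x hx i => (hQ x hx i).trans (by linarith)
  have hle : ∀ x, ρi x ≤ ρo x := fun x => by
    by_cases hx : ∀ i, |x i - c i| ≤ l / 2 + 3 * h
    · rw [hρo, cubeCutoff_eq_one hh hx]
      exact hci.le_one x
    · push Not at hx
      obtain ⟨i, hi⟩ := hx
      rw [hρi, cubeCutoff_eq_zero hh (i := i) (by linarith)]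
      exact hco.nonneg x
  have hρQ : ∀ x ∈ cube c (l + 4 * h), ρ x = 1 := fun x hx =>
    cubeCutoff_eq_one hh fun i => (hx i).le.trans (by linarith)
  have hzero : ∀ x, x ∉ L \ cube c l → (ρo - ρi) x = 0 := fun x hx => by
    rw [Pi.sub_apply]
    by_cases hxQ : x ∈ cube c l
    · rw [hρo, hρi, cubeCutoff_eq_one hh fun i => (hQ x hxQ i).trans (by linarith),
        cubeCutoff_eq_one hh (hQ x hxQ), sub_self]
    · have hxL : ¬ ∀ i, |x i - c i| ≤ l / 2 + 4 * h := fun h' => hx ⟨h', hxQ⟩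
      push Not at hxL
      obtain ⟨i, hi⟩ := hxL
      rw [hρo, hρi, cubeCutoff_eq_zero hh (i := i) (by linarith),
        cubeCutoff_eq_zero hh (i := i) (by linarith), sub_self]
  have htρ : tsupport ρ ⊆ {x | ∀ i, |x i - c i| ≤ l / 2 + 3 * h} := fun x hx i =>
    (tsupport_cubeCutoff_subset hh c _ hx i).trans (by linarith)
  have hts' : tsupport (ρo - ρi) ⊆ L := closure_minimal (fun x hx => by
    by_contra hn
    exact hx (hzero x fun h' => hn h'.1)) (isClosed_closedCube c _)
  have hdisj := disjoint_gradSupport (isOpen_cube c (l + 4 * h)) hρQ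
  have hQQ : cube c l ⊆ cube c (l + 4 * h) := fun x hx i => (hx i).trans (by linarith)
  have hc' := hco.sub hci hle
  refine ⟨ρ, ρo - ρi, L, hcρ, hc', isCompact_closedCube c _, fun x hx i => ?_, hQL,
    fun x hx i => (htρ hx i).trans (by linarith), hts', fun x hx => hρQ x (hQQ hx), hzero,
    fun x hx => ⟨fun i => ?_, fun hn => ?_⟩, fun x hx => ⟨?_, fun hn => ?_⟩, fun x hx => ?_⟩
  · exact (hx i).trans_lt (by linarith)
  · exact (htρ (gradSupport_subset hcρ.smooth hx) i).trans (by linarith)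
  · exact (Set.disjoint_left.1 hdisj) hx (hQQ hn)
  · exact hts' (gradSupport_subset hc'.smooth hx)
  · exact (Set.disjoint_left.1 (disjoint_gradSupport (isOpen_cube c l) (a := 0)
      fun y hy => hzero y fun h' => h'.2 hy)) hx hn
  · have h1 : ¬ ∀ i, |x i - c i| < (l + 4 * h) / 2 := fun h' =>
      (Set.disjoint_left.1 hdisj) hx h'
    push Not at h1
    obtain ⟨i, hi⟩ := h1
    rw [Pi.sub_apply, hρo, hρi, cubeCutoff_eq_one hh (htρ (gradSupport_subset hcρ.smooth hx)),
      cubeCutoff_eq_zero hh (i := i) (by linarith), sub_zero]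

/-- Conversion of a real estimate to extended nonnegative reals, where the integrals on the right
may be infinite. -/
lemma ofReal_sum_le {δ a b c C : ℝ} (hδ : 0 ≤ δ) (ha : 0 ≤ a) (hc : 0 ≤ c) (hC : 0 ≤ C)
    {x : ℝ} (h : x ≤ C * (δ * a + b ^ 2 + c)) {U W : ℝ≥0∞} (hU : ENNReal.ofReal a ≤ U)
    (hW : ENNReal.ofReal c ≤ W) : ENNReal.ofReal x ≤ ENNReal.ofReal C * W +
      ENNReal.ofReal (C * δ) * U + ENNReal.ofReal (C * b ^ 2) := by
  refine (ENNReal.ofReal_le_ofReal h).trans ?_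
  have e : C * (δ * a + b ^ 2 + c) = C * c + C * δ * a + C * b ^ 2 := by ring
  rw [e, ENNReal.ofReal_add (by positivity) (by positivity),
    ENNReal.ofReal_add (by positivity) (by positivity), ENNReal.ofReal_mul hC,
    ENNReal.ofReal_mul (p := C * δ) (by positivity)]
  gcongr

/-- Elimination of the intermediate derivatives: `X` and `X'` are the terms of order `m` for a
cutoff and for a second one that lives between the cubes, `Z` and `Z'` the corresponding lower order
terms. Interpolation bounds `Z` and `Z'` by a small multiple of `X'` and the term `J` of order
zero; the second Caccioppoli inequality absorbs `X'`. -/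
lemma absorb_interpolation {X X' Z Z' δ I I' t J C₁ C₂ C₃ ε M : ℝ} (hI : 0 ≤ δ * I)
    (hI' : 0 ≤ δ * I') (ht : 0 ≤ t) (hX' : 0 ≤ X') (hJ : 0 ≤ J) (hC₁ : 0 ≤ C₁) (hC₂ : 0 ≤ C₂)
    (hC₃ : 0 ≤ C₃) (hM : 0 ≤ M) (hε1 : M * ε ≤ 1 / 2) (hε2 : C₂ * (M * ε) ≤ 1 / 2)
    (h1 : X ≤ C₁ * (δ * I + t + Z)) (h2 : X' ≤ C₂ * (δ * I' + t + Z'))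
    (hZ : Z ≤ M * (ε * X' + C₃ * J)) (hZ' : Z' ≤ M * (ε * X' + C₃ * J)) :
    X ≤ C₁ * (1 + 2 * C₂ + (2 * C₂ + 1) * M * C₃) * (δ * (I + I') + t + J) := by
  have c3 : X' ≤ 2 * C₂ * (δ * I' + t + M * C₃ * J) := by
    have e1 := mul_le_mul_of_nonneg_left hZ' hC₂
    have e2 := mul_le_mul_of_nonneg_right hε2 hX'
    linarith
  have c4 : Z ≤ X' + M * C₃ * J := by
    have e2 := mul_le_mul_of_nonneg_right hε1 hX'
    linarith
  refine h1.trans ?_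
  rw [mul_assoc C₁]
  refine mul_le_mul_of_nonneg_left ?_ hC₁
  have p4 : 0 ≤ C₂ * (δ * I) := by positivity
  have p5 : 0 ≤ C₂ * J := by positivity
  have p6 : 0 ≤ (2 * C₂ + 1) * M * C₃ * (δ * I + δ * I' + t) := by positivity
  linarith

lemma ofReal_half_add_le {a b : ℝ} (ha : 0 ≤ a) (hb : 0 ≤ b) {U : ℝ≥0∞}
    (h1 : ENNReal.ofReal a ≤ U) (h2 : ENNReal.ofReal b ≤ U) :
    ENNReal.ofReal ((a + b) / 2) ≤ U := by
  rw [ENNReal.ofReal_div_of_pos two_pos, ENNReal.ofReal_add ha hb]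
  refine (ENNReal.div_le_div_right (add_le_add h1 h2) _).trans (le_of_eq ?_)
  rw [← two_mul, ENNReal.ofReal_ofNat, ENNReal.mul_div_right_comm,
    ENNReal.div_self two_ne_zero (by norm_num), one_mul]

/-- The Caccioppoli inequalities in concentric cubes, in terms of the width of the region between
the cubes. -/
lemma exists_cube_caccioppoli (d N m : ℕ) (hm : 1 ≤ m) (CA : ℝ≥0) {lam : ℝ} (hlam : 0 < lam) :
    ∃ C : ℝ, 0 ≤ C ∧ ∀ (A : Coeff d N) (δ : ℝ) (c : E d) (l h : ℝ) (u : E d → V N) (Q Ω : Set (E d))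
      (T : Y0 d N m Ω →ₗ[ℂ] ℂ), Q = cube c l → Ω = cube c (l + 10 * h) → 0 ≤ δ → FormBound m A CA →
      WeakGarding m A lam δ → 0 < l → 0 < h → MemSobolevLoc m Ω u → MemYDual m Ω T →
      SolvesIn m A Ω u T →
      (∫⁻ x in Q, gradSq m Ω u x ≤
        ENNReal.ofReal C * (∑ k ∈ Finset.range m, ENNReal.ofReal ((1 / h) ^ (2 * (m - k))) *
          ∫⁻ x in Ω \ Q, gradSq k Ω u x) +
        ENNReal.ofReal (C * δ) * (∫⁻ x in Ω, ‖u x‖ₑ ^ 2) +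
        ENNReal.ofReal (C * dualNorm m Ω T ^ 2)) ∧
      (∫⁻ x in Q, gradSq m Ω u x ≤
        ENNReal.ofReal C * (ENNReal.ofReal ((1 / h) ^ (2 * m)) * ∫⁻ x in Ω \ Q, ‖u x‖ₑ ^ 2) +
        ENNReal.ofReal (C * δ) * (∫⁻ x in Ω, ‖u x‖ₑ ^ 2) +
        ENNReal.ofReal (C * dualNorm m Ω T ^ 2)) ∧
      ∀ j < m, ENNReal.ofReal ((1 / h) ^ (2 * (m - j))) * ∫⁻ x in Q, gradSq j Ω u x ≤
        ENNReal.ofReal C * (ENNReal.ofReal ((1 / h) ^ (2 * m)) * ∫⁻ x in Ω, ‖u x‖ₑ ^ 2) +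
        ENNReal.ofReal (C * δ) * (∫⁻ x in Ω, ‖u x‖ₑ ^ 2) +
        ENNReal.ofReal (C * dualNorm m Ω T ^ 2) := by
  obtain ⟨K, hK⟩ := exists_cutoff_pair d
  obtain ⟨C₁, hC₁, h₁⟩ := exists_weak_caccioppoli d N m hm K CA hlam
  obtain ⟨C₂, hC₂, h₂⟩ := exists_weak_caccioppoli d N m hm (fun k => 2 * K k) CA hlam
  -- small enough to absorb the terms of highest order
  set ε : ℝ := 1 / (2 * (C₂ + 1) * (m + 1)) with hε
  have hm0 : (0 : ℝ) ≤ m := Nat.cast_nonneg m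
  have hε0 : 0 < ε := by positivity
  have hε1 : m * ε ≤ 1 / 2 := by
    rw [hε, mul_one_div, div_le_div_iff₀ (by positivity) (by norm_num)]
    nlinarith
  have hε2 : C₂ * (m * ε) ≤ 1 / 2 := by
    rw [hε, mul_one_div, ← mul_div_assoc, div_le_div_iff₀ (by positivity) (by norm_num)]
    nlinarith
  obtain ⟨C₃, hC₃, h₃⟩ := exists_weak_interpolation d N m (abs_nonneg (2 * K 1)) hε0
  obtain ⟨C₄, hC₄, h₄⟩ := exists_weak_interpolation d N m (abs_nonneg (K 1)) one_pos
  set B : ℝ := C₁ * (1 + 2 * C₂ + (2 * C₂ + 1) * m * C₃) with hB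
  have hB0 : 0 ≤ B := by positivity
  have hCB : C₁ ≤ B := by
    have : 0 ≤ 2 * C₂ + (2 * C₂ + 1) * m * C₃ := by positivity
    rw [hB]; nlinarith
  refine ⟨2 * (B + C₄), by positivity, ?_⟩
  intro A δ c l h u Q Ω T hQ hΩ hδ hA hG hl hh hu hT hsol
  subst hQ
  obtain ⟨ρ, ρ', L, hρ, hρ', hL, hLΩ, hQL, hρL, hρL', hρ1, hρ0', hP, hP', hρP⟩ := hK c l h hl hh
  rw [← hΩ] at hLΩ
  have hΩo : IsOpen Ω := hΩ ▸ isOpen_cube c _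
  have hQo : IsOpen (cube c l) := isOpen_cube c l
  set r : ℝ := 1 / h with hr
  have hr0 : 0 < r := one_div_pos.2 hh
  set S : Set (E d) := L \ cube c l with hS
  have hSm : MeasurableSet S := hL.measurableSet.diff hQo.measurableSet
  have hSL : S ⊆ L := sdiff_subset
  have hSΩ : S ⊆ Ω \ cube c l := sdiff_subset_sdiff_left hLΩ
  have hρL0 : ∀ x, x ∉ L → ρ x = 0 := fun x hx =>
    image_eq_zero_of_notMem_tsupport fun h => hx (hρL h)
  set w : MIndex d → E d → V N := fun γ => weakDeriv γ Ω u with hw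
  set τ := dualNorm m Ω T with hτ
  set X := wInt m r ρ L w m with hX
  set X' := wInt m r ρ' S w m with hX'
  set J' := wInt m r ρ' S w 0 with hJ'
  set I := ∫ x, ‖ρ x ^ m • u x‖ ^ 2 with hI
  set I' := ∫ x, ‖ρ' x ^ m • u x‖ ^ 2 with hI'
  have hI0 : 0 ≤ I := integral_nonneg fun x => sq_nonneg _
  have hI0' : 0 ≤ I' := integral_nonneg fun x => sq_nonneg _
  have hX0' : 0 ≤ X' := wInt_nonneg m hr0.le _ _ _ m
  have hJ0' : 0 ≤ J' := wInt_nonneg m hr0.le _ _ _ 0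
  set Z := lowerOrder m r ρ (gradSupport ρ) w with hZ
  have hZ0 : 0 ≤ Z := lowerOrder_nonneg m hr0.le _ _ _
  have c1 : X ≤ C₁ * (δ * I + τ ^ 2 + Z) := by
    have := h₁ Ω (gradSupport ρ) r ρ A δ u T hΩo hr0 hρ (vanishOff_gradSupport ρ)
      (gradSupport_subset hρ.smooth) (hρL.trans hLΩ) hδ hA
      hG hu hT hsol
    rwa [wInt_univ_eq m r hρL0 _ hm] at this
  have c2 : X' ≤ C₂ * (δ * I' + τ ^ 2 + lowerOrder m r ρ' (gradSupport ρ') w) := by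
    have := h₂ Ω (gradSupport ρ') r ρ' A δ u T hΩo hr0 hρ' (vanishOff_gradSupport ρ')
      (gradSupport_subset hρ'.smooth) (hρL'.trans hLΩ) hδ
      hA hG hu hT hsol
    rwa [wInt_univ_eq m r hρ0' _ hm] at this
  -- interpolation bounds the lower order terms in the region between the cubes
  have hY : ∑ k ∈ Finset.range m, wInt m r ρ' S w k ≤ m * (ε * X' + C₃ * J') := by
    refine (Finset.sum_le_card_nsmul _ _ (ε * X' + C₃ * J') fun k hk => ?_).trans (le_of_eq ?_)
    · exact h₃ Ω L S r ρ' u hΩo hL hLΩ hSm hSL hr0 hρ'.smooth hρ'.nonneg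
        (hρ'.abs_pderiv_le hr0.le) hρ0' hu k (Finset.mem_range.1 hk)
    · rw [Finset.card_range, nsmul_eq_mul]
  have hZY : Z ≤ m * (ε * X' + C₃ * J') := by
    refine le_trans (Finset.sum_le_sum fun k hk => ?_) hY
    exact hu.wInt_mono hΩo hr0.le hρ.smooth.continuous hρ'.smooth.continuous hρ.nonneg
      (fun x hx => (hρ.le_one x).trans (hρP x hx).ge) (isClosed_gradSupport ρ).measurableSet hP hL
      hSL hLΩ (Finset.mem_range.1 hk).le
  have hZY' : lowerOrder m r ρ' (gradSupport ρ') w ≤ m * (ε * X' + C₃ * J') := by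
    refine le_trans (Finset.sum_le_sum fun k hk => ?_) hY
    exact hu.wInt_mono hΩo hr0.le hρ'.smooth.continuous hρ'.smooth.continuous hρ'.nonneg
      (fun x _ => le_rfl) (isClosed_gradSupport ρ').measurableSet hP' hL hSL hLΩ
      (Finset.mem_range.1 hk).le
  have c5 : X ≤ B * (δ * (I + I') + τ ^ 2 + J') :=
    absorb_interpolation (mul_nonneg hδ hI0) (mul_nonneg hδ hI0') (sq_nonneg τ) hX0' hJ0' hC₁ hC₂
      hC₃ hm0 hε1 hε2 c1 c2 hZY hZY'
  -- translation into integrals of nonnegative functions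
  set G : ℝ≥0∞ := ∫⁻ x in Ω, ‖u x‖ₑ ^ 2 with hGdef
  have hIG : ENNReal.ofReal I ≤ G := by
    have e : I = ∫ x in L, ‖ρ x ^ m • u x‖ ^ 2 :=
      (setIntegral_eq_integral_of_forall_compl_eq_zero fun x hx => by
        rw [hρL0 x hx, zero_pow (by omega), zero_smul, norm_zero, zero_pow two_ne_zero]).symm
    rw [e]
    exact ofReal_integral_weight_le hρ.nonneg hρ.le_one hLΩ m u
  have hIG' : ENNReal.ofReal I' ≤ G := by
    have e : I' = ∫ x in S, ‖ρ' x ^ m • u x‖ ^ 2 :=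
      (setIntegral_eq_integral_of_forall_compl_eq_zero fun x hx => by
        rw [hρ0' x hx, zero_pow (by omega), zero_smul, norm_zero, zero_pow two_ne_zero]).symm
    rw [e]
    exact ofReal_integral_weight_le hρ'.nonneg hρ'.le_one (hSL.trans hLΩ) m u
  have hQX : ∫⁻ x in cube c l, gradSq m Ω u x ≤ ENNReal.ofReal X := by
    have := hu.le_ofReal_wInt hΩo hr0.le hρ.smooth.continuous hρ1 hQo.measurableSet hQL hL hLΩ
      (le_refl m)
    simpa using this
  have hdiff : Ω \ cube c l ⊆ Ω := sdiff_subset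
  have hJG' : ENNReal.ofReal J' ≤
      ENNReal.ofReal (r ^ (2 * m)) * ∫⁻ x in Ω \ cube c l, ‖u x‖ₑ ^ 2 := by
    have := hu.ofReal_wInt_le hr0.le hρ'.nonneg hρ'.le_one hSΩ hdiff (Nat.zero_le m)
    rwa [hu.lintegral_gradSq_zero hΩo hdiff, Nat.sub_zero] at this
  have hZG : ENNReal.ofReal Z ≤ ∑ k ∈ Finset.range m, ENNReal.ofReal (r ^ (2 * (m - k))) *
      ∫⁻ x in Ω \ cube c l, gradSq k Ω u x := by
    rw [hZ, lowerOrder, ENNReal.ofReal_sum_of_nonneg fun k _ => wInt_nonneg m hr0.le _ _ _ k]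
    refine Finset.sum_le_sum fun k hk => ?_
    exact hu.ofReal_wInt_le hr0.le hρ.nonneg hρ.le_one (hP.trans hSΩ) hdiff
      (Finset.mem_range.1 hk).le
  have hII : ENNReal.ofReal ((I + I') / 2) ≤ G := ofReal_half_add_le hI0 hI0' hIG hIG'
  refine ⟨hQX.trans (ofReal_sum_le hδ hI0 hZ0 (by positivity) (c1.trans ?_) hIG hZG),
    hQX.trans (ofReal_sum_le hδ (a := (I + I') / 2) (by positivity) hJ0' (by positivity)
      (c5.trans ?_) hII hJG'), fun j hj => ?_⟩
  · refine mul_le_mul_of_nonneg_right (by linarith) (by positivity)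
  · have p2 : 0 ≤ δ * (I + I') := by positivity
    have q1 : B * (δ * (I + I') + τ ^ 2 + J') ≤
        (B + C₄) * (δ * (I + I') + τ ^ 2 + J') :=
      mul_le_mul_of_nonneg_right (by linarith) (by positivity)
    have q2 : 0 ≤ (B + C₄) * (τ ^ 2 + J') := by positivity
    linarith
  · have hQj := hu.le_ofReal_wInt hΩo hr0.le hρ.smooth.continuous hρ1 hQo.measurableSet hQL hL hLΩ
      hj.le
    set J := wInt m r ρ L w 0 with hJ
    have hJ0 : 0 ≤ J := wInt_nonneg m hr0.le _ _ _ 0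
    have c6 : wInt m r ρ L w j ≤ 1 * X + C₄ * J := h₄ Ω L L r ρ u hΩo hL hLΩ hL.measurableSet
      subset_rfl hr0 hρ.smooth hρ.nonneg (hρ.abs_pderiv_le hr0.le) hρL0 hu j hj
    have hJG : ENNReal.ofReal J ≤ ENNReal.ofReal (r ^ (2 * m)) * G := by
      have := hu.ofReal_wInt_le hr0.le hρ.nonneg hρ.le_one hLΩ (subset_refl Ω) (Nat.zero_le m)
      rwa [hu.lintegral_gradSq_zero hΩo (subset_refl Ω), Nat.sub_zero] at this
    have hJJ : ENNReal.ofReal ((J' + J) / 2) ≤ ENNReal.ofReal (r ^ (2 * m)) * G :=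
      ofReal_half_add_le hJ0' hJ0 (hJG'.trans (mul_le_mul' le_rfl (lintegral_mono_set hdiff))) hJG
    refine hQj.trans (ofReal_sum_le hδ (a := (I + I') / 2) (c := (J' + J) / 2) (by positivity)
      (by positivity) (by positivity) (c6.trans ?_) hII hJJ)
    have p2 : 0 ≤ C₄ * (δ * (I + I')) := by positivity
    have p3 : 0 ≤ C₄ * τ ^ 2 := by positivity
    have p4 : 0 ≤ B * τ ^ 2 := by positivity
    have p5 : 0 ≤ C₄ * J' := by positivity
    have p6 : 0 ≤ B * J := by positivity
    linarith

end CubeEstimates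

/-! ### Scaling -/

section Scaling

variable {d N m : ℕ}

/-- On a cube, membership in `Y^{m,2}` gives local square integrability of all derivatives of order
at most `m`. Only the derivatives of order `m` are used. -/
lemma MemY.memSobolevLoc (hd : 0 < d) {c : E d} {l : ℝ} (hl : 0 < l) {u : E d → V N}
    (hu : MemY m (cube c l) u) : MemSobolevLoc m (cube c l) u := by
  rw [cube_eq_ball c hl] at hu ⊢
  intro α hα
  refine exists_isWeakDeriv_ball (m := m) c (by positivity) hu.1 (fun β hβ => ?_) (m - order α) α
    (by have := mem_indicesLE.1 hα; omega)
  have hd' : (0 : ℝ) < d := by exact_mod_cast hd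
  obtain ⟨v, hv, hvL⟩ := hu.2 β (Finset.mem_filter.2 ⟨mem_indicesLE.2 hβ.le, by
    rw [hβ]; linarith⟩)
  have hexp : critExp d m (order β) = 2 := by
    rw [hβ, critExp_eq le_rfl, Nat.sub_self, sobExp_zero]
    norm_num
  rw [hexp] at hvL
  exact ⟨v, hv, fun K hK _ => hvL.mono_measure (Measure.restrict_mono hK le_rfl)⟩

/-- The constant for the width `R / 10` in terms of `R`. -/
lemma scale_le {C R : ℝ} (hC : 0 ≤ C) (hR : 0 < R) {m k : ℕ} (hk : k ≤ m) :
    C * (1 / (R / 10)) ^ (2 * (m - k)) ≤ 10 ^ (2 * m) * (C + 1) / R ^ (2 * m - 2 * k) := by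
  have e : 2 * m - 2 * k = 2 * (m - k) := by omega
  rw [e, one_div_div, div_pow, ← mul_div_assoc]
  refine div_le_div_of_nonneg_right ?_ (by positivity)
  have h1 : (10 : ℝ) ^ (2 * (m - k)) ≤ 10 ^ (2 * m) :=
    pow_le_pow_right₀ (by norm_num) (by omega)
  have h2 : (0 : ℝ) ≤ 10 ^ (2 * m) := by positivity
  calc C * 10 ^ (2 * (m - k)) ≤ C * 10 ^ (2 * m) := by gcongr
    _ ≤ 10 ^ (2 * m) * (C + 1) := by nlinarith

/-- Rescaling an estimate with the width of the region between the cubes to one with the side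
length of the small cube. -/
lemma rescale_estimate {C l t : ℝ} (hC : 0 ≤ C) (hl : 0 < l) (ht : 0 < t) (ht1 : t ≤ 1) {m j : ℕ}
    (hj : j ≤ m) {D : ℝ} {a b G U : ℝ≥0∞} (hD : 10 ^ (2 * m) * C ≤ D)
    (h : ENNReal.ofReal ((1 / (t * l / 10)) ^ (2 * (m - j))) * G ≤
      ENNReal.ofReal C * (ENNReal.ofReal ((1 / (t * l / 10)) ^ (2 * m)) * U) + a + b) :
    ENNReal.ofReal (1 / l ^ (2 * m - 2 * j)) * G ≤
      ENNReal.ofReal (D / (t ^ (2 * j) * l ^ (2 * m))) * U + a + b := by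
  have e : 2 * m - 2 * j = 2 * (m - j) := by omega
  have hsplit : 2 * m = 2 * (m - j) + 2 * j := by omega
  set s : ℝ := (t / 10) ^ (2 * (m - j)) with hs
  have hs0 : 0 ≤ s := by positivity
  have hs1 : s ≤ 1 := pow_le_one₀ (by positivity) (by linarith)
  have hsE : ENNReal.ofReal s ≤ 1 := ENNReal.ofReal_le_one.2 hs1
  have e1 : 1 / l ^ (2 * m - 2 * j) = s * (1 / (t * l / 10)) ^ (2 * (m - j)) := by
    rw [e, hs, ← mul_pow, ← one_div_pow]
    congr 1
    field_simp
  have e2 : s * (C * (1 / (t * l / 10)) ^ (2 * m)) ≤ D / (t ^ (2 * j) * l ^ (2 * m)) := by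
    have e3 : s * (C * (1 / (t * l / 10)) ^ (2 * m)) =
        10 ^ (2 * j) * C / (t ^ (2 * j) * l ^ (2 * m)) := by
      rw [hs, hsplit, pow_add (1 / (t * l / 10)), pow_add l]
      rw [one_div_div, div_pow, div_pow, div_pow, mul_pow, mul_pow]
      field_simp
    rw [e3]
    gcongr
    refine le_trans ?_ hD
    gcongr
    · norm_num
  rw [e1, ENNReal.ofReal_mul hs0, mul_assoc]
  refine (mul_le_mul' le_rfl h).trans ?_
  rw [mul_add, mul_add]
  refine add_le_add (add_le_add ?_ (mul_le_of_le_one_left zero_le hsE))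
    (mul_le_of_le_one_left zero_le hsE)
  rw [← mul_assoc, ← mul_assoc, mul_assoc (ENNReal.ofReal s), ← ENNReal.ofReal_mul hC,
    ← ENNReal.ofReal_mul hs0]
  gcongr

end Scaling

end HigherOrderElliptic

theorem mainTheorem4 (n m N : ℕ) (hn : 1 ≤ n) (hm : 1 ≤ m) (lam Lam : ℝ) (hlam : 0 < lam) :
    ∃ C : ℝ, 0 < C ∧
      ∀ (A : HigherOrderElliptic.Coeff (n + 1) N) (δ : ℝ), 0 ≤ δ →
      (∀ j k, ∀ α ∈ HigherOrderElliptic.indicesLE (n + 1) m,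
        ∀ β ∈ HigherOrderElliptic.indicesLE (n + 1) m, AEMeasurable (A j k α β) volume) →
      HigherOrderElliptic.WeakGarding m A lam δ →
      (HigherOrderElliptic.LebesgueBound m A Lam ∨ HigherOrderElliptic.BochnerBound m A Lam) →
      ∀ (c : HigherOrderElliptic.E (n + 1)) (l θ : ℝ), 0 < l → 1 < θ → θ ≤ 2 →
      ∀ Q θQ : Set (HigherOrderElliptic.E (n + 1)),
      Q = HigherOrderElliptic.cube c l → θQ = HigherOrderElliptic.cube c (θ * l) →
      ∀ u : HigherOrderElliptic.E (n + 1) → HigherOrderElliptic.V N,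
      HigherOrderElliptic.MemY m θQ u →
      ∀ T : HigherOrderElliptic.Y0 (n + 1) N m θQ →ₗ[ℂ] ℂ,
      HigherOrderElliptic.MemYDual m θQ T →
      HigherOrderElliptic.SolvesIn m A θQ u T →
      -- all weak derivatives of order at most `m` exist in `θQ`
      (∀ α ∈ HigherOrderElliptic.indicesLE (n + 1) m,
        ∃ v, HigherOrderElliptic.IsWeakDeriv α θQ u v) ∧
      -- the inequality with intermediate derivatives
      (∫⁻ x in Q, HigherOrderElliptic.gradSq m θQ u x ≤
        (∑ k ∈ Finset.range m, ENNReal.ofReal (C / ((θ - 1) * l) ^ (2 * m - 2 * k)) *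
          ∫⁻ x in θQ \ Q, HigherOrderElliptic.gradSq k θQ u x) +
        ENNReal.ofReal (C * δ) * (∫⁻ x in θQ, ‖u x‖ₑ ^ 2) +
        ENNReal.ofReal (C * HigherOrderElliptic.dualNorm m θQ T ^ 2)) ∧
      -- the inequality without intermediate derivatives
      (∫⁻ x in Q, HigherOrderElliptic.gradSq m θQ u x ≤
        ENNReal.ofReal (C / ((θ - 1) * l) ^ (2 * m)) * (∫⁻ x in θQ \ Q, ‖u x‖ₑ ^ 2) +
        ENNReal.ofReal (C * δ) * (∫⁻ x in θQ, ‖u x‖ₑ ^ 2) +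
        ENNReal.ofReal (C * HigherOrderElliptic.dualNorm m θQ T ^ 2)) ∧
      -- the bounds for the intermediate derivatives
      (∀ j : ℕ, 1 ≤ j → j ≤ m - 1 →
        ENNReal.ofReal (1 / l ^ (2 * m - 2 * j)) *
            (∫⁻ x in Q, HigherOrderElliptic.gradSq j θQ u x) ≤
          ENNReal.ofReal (C / ((θ - 1) ^ (2 * j) * l ^ (2 * m))) * (∫⁻ x in θQ, ‖u x‖ₑ ^ 2) +
          ENNReal.ofReal (C * δ) * (∫⁻ x in θQ, ‖u x‖ₑ ^ 2) +
          ENNReal.ofReal (C * HigherOrderElliptic.dualNorm m θQ T ^ 2)) := by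
  obtain ⟨CA, hCA⟩ := HigherOrderElliptic.exists_form_bound (HigherOrderElliptic.V N) n m N hn Lam
  obtain ⟨C, hC, hmain⟩ := HigherOrderElliptic.exists_cube_caccioppoli (n + 1) N m hm CA hlam
  -- the cubes are `(θ - 1) l / 2 = 5 h` apart, and the factor `10 ^ (2 * m)` pays for passing from
  -- `h` to `(θ - 1) l`; adding `1` makes the constant positive
  have hp : (1 : ℝ) ≤ 10 ^ (2 * m) := one_le_pow₀ (by norm_num)
  set D : ℝ := 10 ^ (2 * m) * (C + 1) with hD
  have hCD : C ≤ D := by nlinarith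
  refine ⟨D, by positivity, ?_⟩
  intro A δ hδ hmeas hG hbound c l θ hl hθ1 hθ2 Q Ω hQ hΩ u hu T hT hsol
  have ht : 0 < θ - 1 := by linarith
  have hR : 0 < (θ - 1) * l := mul_pos ht hl
  have hθl : θ * l = l + 10 * ((θ - 1) * l / 10) := by ring
  have huS : HigherOrderElliptic.MemSobolevLoc m Ω u := by
    rw [hΩ] at hu ⊢
    exact hu.memSobolevLoc n.succ_pos (mul_pos (by linarith) hl)
  obtain ⟨h1, h2, h3⟩ := hmain A δ c l ((θ - 1) * l / 10) u Q Ω T hQ (by rw [hΩ, hθl]) hδ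
    ⟨hmeas, hCA A hmeas hbound⟩ hG hl (by positivity) huS hT hsol
  have hδ' : ENNReal.ofReal (C * δ) ≤ ENNReal.ofReal (D * δ) :=
    ENNReal.ofReal_le_ofReal (mul_le_mul_of_nonneg_right hCD hδ)
  have hT' : ENNReal.ofReal (C * HigherOrderElliptic.dualNorm m Ω T ^ 2) ≤
      ENNReal.ofReal (D * HigherOrderElliptic.dualNorm m Ω T ^ 2) :=
    ENNReal.ofReal_le_ofReal (mul_le_mul_of_nonneg_right hCD (sq_nonneg _))
  refine ⟨fun α hα => (huS α hα).imp fun _ h => h.1, h1.trans ?_, h2.trans ?_, fun j _ hj => ?_⟩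
  · refine add_le_add (add_le_add ?_ (mul_le_mul' hδ' le_rfl)) hT'
    rw [Finset.mul_sum]
    refine Finset.sum_le_sum fun k hk => ?_
    rw [← mul_assoc, ← ENNReal.ofReal_mul hC]
    exact mul_le_mul' (ENNReal.ofReal_le_ofReal
      (HigherOrderElliptic.scale_le hC hR (Finset.mem_range.1 hk).le)) le_rfl
  · refine add_le_add (add_le_add ?_ (mul_le_mul' hδ' le_rfl)) hT'
    rw [← mul_assoc, ← ENNReal.ofReal_mul hC]
    refine mul_le_mul' (ENNReal.ofReal_le_ofReal ?_) le_rfl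
    simpa using HigherOrderElliptic.scale_le hC hR (Nat.zero_le m)
  · refine (HigherOrderElliptic.rescale_estimate (D := D) hC hl ht (by linarith)
      (show j ≤ m by omega) (by rw [hD]; nlinarith) (h3 j (by omega))).trans ?_
    exact add_le_add (add_le_add le_rfl (mul_le_mul' hδ' le_rfl)) hT'
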